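/- **Notation.** Let $F$ be a totally real number field with ring of integers $\mathfrak o$ and different $\mathfrak d$; put $\mathfrak f^*=\mathfrak f^{-1}\mathfrak d^{-1}$ for a nonzero fractional ideal $\mathfrak f$, and let $\mathcal I_F$ be the group of nonzero fractional ideals. Let $D_{\mathbb Q}$ be a subgroup of $F^\times$ containing $\mathbb Q^\times$ (for example $D(\mathbb Q)$ for a connected algebraic group $\mathbb G_m\subset D\subset \mathrm{Res}_{F/\mathbb Q}\mathbb G_m$), and let $\mathfrak o_{D+}^\times$ be the group of totally positive units of $\mathfrak o$ lying in $D_{\mathbb Q}$. Let $\mathfrak c$ be a nonzero fractional ideal, $\mathfrak n$ a nonzero ideal of $\mathfrak o$, and $y_0\in F$ with $\mathfrak n+y_0\mathfrak c=\mathfrak o$. Matrices act on the left on row vectors by $\gamma\cdot l=l\gamma^{-1}$. Let $G^D_{\mathbb Q}=\{\gamma\in GL_2(F):\det\gamma\in D_{\mathbb Q}\}$, $G^{\mathfrak o}_{\mathbb Q}=\{\gamma\in GL_2(F):\det\gamma\in\mathfrak o_{D+}^\times\}$, $G^+(L)$ the stabilizer of a lattice $L\subset F^2$ in the subgroup of elements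 of $G^D_{\mathbb Q}$ with totally positive determinant, and $$\Gamma=\Big\{\begin{pmatrix}a&b\\c&d\end{pmatrix}\in G^+(\mathfrak o\oplus\mathfrak c^*): c\in\mathfrak{cdn},\ d\equiv1 \bmod \mathfrak n\Big\}.$$ Let $B_{\mathbb Q}$ be the group of upper triangular matrices in $G^D_{\mathbb Q}$, $U_{\mathbb Q}$ the group of matrices $\begin{pmatrix}1&\xi\\0&1\end{pmatrix}$, $\xi\in F$, and $T_{\mathbb Z}$ the group of matrices $\mathrm{diag}(u\epsilon,u^{-1})$ with $u\in\mathfrak o^\times$, $\epsilon\in\mathfrak o_{D+}^\times$. Diagonal matrices $\mathrm{diag}(u\epsilon,u^{-1})$ are written $(u,\epsilon)$, and $T_1$ is the group of diagonal matrices of determinant $1$. An *$(R,\mathfrak n)$-cusp* is an equivalence class of tuples $(\mathfrak a,\mathfrak b,L,i,j,\lambda,\beta)$, where $\mathfrak a,\mathfrak b$ are nonzero fractional ideals with $\mathfrak a^*\mathfrak b=\mathfrak c^*$, $L$ is an $\mathfrak o$-lattice of $F^2$, $0\to\mathfrak a^*\xrightarrow{i}L\xrightarrow{j}\mathfrak b\to0$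 is an exact sequence of $\mathfrak o$-modules, $\lambda:\wedge^2_{\mathfrak o}L\cong\mathfrak c^*$ and $\beta:\mathfrak n^{-1}\mathfrak d^{-1}/\mathfrak d^{-1}\hookrightarrow\mathfrak n^{-1}L/L$ is $\mathfrak o$-linear. Two tuples are equivalent (resp. isomorphic) if $\mathfrak a=\mathfrak a'$, $\mathfrak b=\mathfrak b'$ (resp. $\mathfrak a=\xi\mathfrak a'$, $\mathfrak b=\xi\mathfrak b'$ for some $\xi\in F^\times$) and there is an isomorphism $L\cong L'$ which extends to an isomorphism of the two exact sequences, carries $\lambda$ to $\lambda'$ up to an element of $\mathfrak o_{D+}^\times$, and whose reduction carries $\beta$ to $\beta'$. To a cusp one attaches the fractional ideal $\mathfrak b'\supset\mathfrak b$ with $\mathfrak b'/\mathfrak b=j(\mathrm{im}\,\beta)\subset\mathfrak n^{-1}\mathfrak b/\mathfrak b$ and the exponent $n$ of $\mathfrak b'/\mathfrak b$; the cusp is *unramified* if $\beta$ factors through $\mathfrak n^{-1}\mathfrak a^*/\mathfrak a^*\hookrightarrow\mathfrak n^{-1}L/L$, equivalently $\mathfrak b'=\mathfrak b$. Two cusps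 belong to the same *$(R,\mathfrak n)$-component* if they become equivalent after replacing $\beta$ by $\varphi\circ\beta$ for some automorphism $\varphi$ of $\mathfrak n^{-1}L/L$ that is the identity on $\mathfrak n^{-1}\mathfrak a^*/\mathfrak a^*$ and multiplication by (an integer lifting) some $\bar a\in(\mathbb Z/n)^\times$ on $\mathfrak n^{-1}\mathfrak b/\mathfrak b$. For $g\in G^{\mathfrak o}_{\mathbb Q}$ the cusp *given by* $g$ is the class of the tuple with $L=g\cdot(\mathfrak o\oplus\mathfrak c^*)$, $i(y)=(0,y)$, $j$ the first coordinate, $\lambda(v\wedge w)=v_0w_1-v_1w_0$ and $\beta(t)=g\cdot(0,y_0t)$. **Proposition.** Each $g\in G^{\mathfrak o}_{\mathbb Q}$ gives exactly one $(R,\mathfrak n)$-cusp, and this induces a bijection from $T_{\mathbb Z}U_{\mathbb Q}\backslash G^{\mathfrak o}_{\mathbb Q}/\Gamma$ to the set of $(R,\mathfrak n)$-cusps. The ideal classes of $\mathfrak b$ and $\mathfrak b'$ depend only on the isomorphism class of the cusp. Let $\mathcal C$ be the cusp given by $T_{\mathbb Z}U_{\mathbb Q}\gamma^{-1}\Gamma$,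 $\gamma=\begin{pmatrix}a&b\\c&d\end{pmatrix}\in G^{\mathfrak o}_{\mathbb Q}$. (i) $\mathfrak b=a\mathfrak o+c\,\mathfrak c^*$. After multiplying $\gamma$ on the right by an element of $U_{\mathbb Q}$, which does not change the double coset, one has $$(\star)\qquad \gamma\in\begin{pmatrix}\mathfrak b&(\mathfrak{bc})^*\\ \mathfrak{bcd}&\mathfrak b^{-1}\end{pmatrix}.$$ (ii) Under $(\star)$, $\mathcal C$ is represented by the tuple with $\mathfrak a=\mathfrak{bc}$, $L=\mathfrak b\oplus\mathfrak a^*$, $i,j,\lambda$ as above, and $\beta(t)=(y_0ct,y_0dt)$. (iii) $\mathfrak b'\subset\mathfrak n^{-1}\mathfrak b$ and $\mathfrak b'=a\mathfrak o+c(\mathfrak{cn})^*$. The cusp $\mathcal C$ is unramified if and only if $c\in\mathfrak{nbcd}$ (and if and only if $\mathfrak b'=\mathfrak b$). (iv) Under $(\star)$, the automorphism group of $\mathcal C$ (the automorphisms of the lattice $L$ in (ii) compatible with all the data) equals $\gamma^{-1}\Gamma\gamma\cap B_{\mathbb Q}$, and the unipotent and diagonal parts give an exact sequence $$0\to X^*\to\gamma^{-1}\Gamma\gamma\cap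 B_{\mathbb Q}\to\mathfrak o_{\mathcal C}^\times\to1,\qquad X=\mathfrak{cbb'},$$ $$\mathfrak o_{\mathcal C}^\times=\{(u,\epsilon)\in\mathfrak o^\times\times\mathfrak o_{D+}^\times : u-1\in\mathfrak{nb'b}^{-1},\ u\epsilon-1\in\mathfrak{bb'}^{-1}\}.$$ In particular $\mathfrak o_{\mathcal C}^\times\cap T_1=\{u\in\mathfrak o^\times: u\in(1+\mathfrak{bb'}^{-1})\cap(1+\mathfrak{nb'b}^{-1})\}$. Now let $\mathfrak b\in\mathcal I_F$ be arbitrary, $\mathfrak a=\mathfrak{bc}$, $L=\mathfrak b\oplus\mathfrak a^*$, and let $(\mathfrak n^{-1}L/L)_{\rm prim}$ be the set of primitive vectors, i.e. those whose annihilator in $\mathfrak o$ is $\mathfrak n$. There are $\gamma\in G^{\mathfrak o}_{\mathbb Q}$ satisfying $(\star)$; the module $\mathfrak n^{-1}\mathfrak d^{-1}/\mathfrak d^{-1}$ is cyclic, and there are finitely many fractional ideals $\mathfrak b'$ with $\mathfrak b\subset\mathfrak b'\subset\mathfrak n^{-1}\mathfrak b$. (v) For each $\gamma\in G^{\mathfrak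 o}_{\mathbb Q}$ satisfying $(\star)$, sending the class of $g$ to the cusp given by $g\gamma^{-1}$ is a bijection from $(G^+(L)\cap T_{\mathbb Z}U_{\mathbb Q})\backslash G^+(L)/\gamma^{-1}\Gamma\gamma$ to the set of $(R,\mathfrak n)$-cusps with ideal $\mathfrak b$. For each generator $\tau$ of $\mathfrak n^{-1}\mathfrak d^{-1}/\mathfrak d^{-1}$, each such cusp is represented by a tuple with lattice $L$ and $i,j,\lambda$ as above, and $\beta\mapsto\beta(\tau)$ induces a bijection from this set of cusps to $$(\mathfrak n^{-1}L/L)_{\rm prim}\Big/\Big\{\begin{pmatrix}u\epsilon&\xi^*\\0&u^{-1}\end{pmatrix}: u\in\mathfrak o^\times,\ \epsilon\in\mathfrak o_{D+}^\times,\ \xi^*\in(\mathfrak{cb}^2)^*\Big\},$$ the matrices acting on row vectors by right multiplication. This set is finite, of cardinality $$\sum_{\mathfrak n^{-1}\mathfrak b\supset\mathfrak b'\supset\mathfrak b}\frac{\#(\mathfrak o/\mathfrak{bb'}^{-1})^\times\ \#(\mathfrak o/\mathfrak{nb'b}^{-1})^\times}{[(\mathfrak o^\times\times\mathfrak o_{D+}^\times):\mathfrak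 o_{\mathcal C}^\times]},$$ with $\mathfrak o_{\mathcal C}^\times$ attached to $(\mathfrak b,\mathfrak b')$ by the formula in (iv). (vi) In the same way, $\beta\mapsto\beta(\tau)$ induces a bijection from the set of $(R,\mathfrak n)$-components with ideal $\mathfrak b$ to $$(\mathfrak n^{-1}L/L)_{\rm prim}\Big/\Big\{\begin{pmatrix}\bar au\epsilon&\xi^*\\0&u^{-1}\end{pmatrix}: u\in\mathfrak o^\times,\ \epsilon\in\mathfrak o_{D+}^\times,\ \bar a\in(\mathbb Z/n)^\times,\ \xi^*\in(\mathfrak{cb}^2)^*\Big\},$$ where $n$ is the exponent of $\mathfrak b'/\mathfrak b$, with $\mathfrak b'/\mathfrak b$ generated by the first coordinate of the vector. This set is finite, of cardinality $$\sum_{\mathfrak n^{-1}\mathfrak b\supset\mathfrak b'\supset\mathfrak b}\frac{\#(\mathfrak o/\mathfrak{bb'}^{-1})^\times\ \#(\mathfrak o/\mathfrak{nb'b}^{-1})^\times}{\#(\mathbb Z/n)^\times\ [(\mathfrak o^\times\times\mathfrak o_{D+}^\times):\mathfrak o_{\overline{\mathcal C}}^\times]},$$ where $n$ is the exponent of $\mathfrak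 b'/\mathfrak b$ and $$\mathfrak o_{\overline{\mathcal C}}^\times=\{(u,\epsilon)\in\mathfrak o^\times\times\mathfrak o_{D+}^\times: u-1\in\mathfrak{nb'b}^{-1},\ u\epsilon\in(\mathbb Z/n)^\times+\mathfrak{bb'}^{-1}\};$$ moreover $\mathfrak o_{\overline{\mathcal C}}^\times\cap T_1=\{u\in\mathfrak o^\times: u\in(1+\mathfrak{nb'b}^{-1})\cap((\mathbb Z/n)^\times+\mathfrak{bb'}^{-1})\}$. -/

import Mathlib

open scoped NumberField nonZeroDivisors Matrix

noncomputable section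

namespace HilbertCusp

set_option linter.unusedSectionVars false

/-! ### Fractional ideals and totally positive units -/

/-- The group of nonzero fractional ideals of `F`. -/
abbrev FracId (F : Type*) [Field F] [NumberField F] : Type _ := (FractionalIdeal (𝓞 F)⁰ F)ˣ

section Ideals

variable {F : Type*} [Field F] [NumberField F]

/-- A fractional ideal as an `𝓞 F`-submodule of `F`. -/
def FracId.mod (f : FracId F) : Submodule (𝓞 F) F :=
  ((f : FractionalIdeal (𝓞 F)⁰ F) : Submodule (𝓞 F) F)

variable (F) in
/-- The different of `F` over `ℚ`. -/
def diff : FracId F :=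
  Units.mk0 ((differentIdeal ℤ (𝓞 F) : Ideal (𝓞 F)) : FractionalIdeal (𝓞 F)⁰ F)
    (FractionalIdeal.coeIdeal_ne_zero.mpr differentIdeal_ne_bot)

/-- `f^* = f⁻¹ 𝔡⁻¹`. -/
def FracId.star (f : FracId F) : FracId F := f⁻¹ * (diff F)⁻¹

/-- A nonzero ideal of `𝓞 F`, as a fractional ideal. -/
def ofIdeal (n : Ideal (𝓞 F)) [NeZero n] : FracId F :=
  Units.mk0 (n : FractionalIdeal (𝓞 F)⁰ F) (FractionalIdeal.coeIdeal_ne_zero.mpr (NeZero.ne n))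

/-- The ideal `f ∩ 𝓞 F` of `𝓞 F`; it is `f` itself when `f` is integral. -/
def FracId.toIdeal (f : FracId F) : Ideal (𝓞 F) :=
  Submodule.comap (Algebra.linearMap (𝓞 F) F) f.mod

variable (F) in
/-- Totally positive elements of `Fˣ`. -/
def totPos : Subgroup Fˣ where
  carrier := {x | ∀ φ : F →+* ℝ, 0 < φ x}
  one_mem' := by intro φ; simp
  mul_mem' := by
    intro x y hx hy φ
    simpa using mul_pos (hx φ) (hy φ)
  inv_mem' := by
    intro x hx φ
    simpa using hx φ

/-- Units of `𝓞 F` as elements of `Fˣ`. -/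
def unitsToField : (𝓞 F)ˣ →* Fˣ := Units.map (algebraMap (𝓞 F) F : 𝓞 F →* F)

/-- `𝓞_{D+}^×`: the totally positive units of `𝓞 F` lying in `D_ℚ`. -/
def unitsDPlus (D : Subgroup Fˣ) : Subgroup (𝓞 F)ˣ := (totPos F ⊓ D).comap unitsToField

/-- The exponent of the abelian group `N / M` (for `M ≤ N`). -/
def quotExponent (M N : Submodule (𝓞 F) F) : ℕ := AddMonoid.exponent (N ⧸ M.submoduleOf N)

/-- Multiplication by an integral element preserves a fractional ideal. -/
theorem int_mul_mem (f : FracId F) (s : 𝓞 F) {x : F} (hx : x ∈ f.mod) :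
    (s : F) * x ∈ f.mod := by
  have := f.mod.smul_mem s hx
  rwa [Algebra.smul_def] at this

theorem mem_mod_mul {f g : FracId F} {x y : F} (hx : x ∈ f.mod) (hy : y ∈ g.mod) :
    x * y ∈ (f * g).mod :=
  FractionalIdeal.mul_mem_mul hx hy

theorem mem_mod_one {x : F} : x ∈ (1 : FracId F).mod ↔ ∃ s : 𝓞 F, (s : F) = x :=
  FractionalIdeal.mem_one_iff _

theorem mem_mul_inv {f g : FracId F} {x : F} (h : ∀ y ∈ g.mod, x * y ∈ f.mod) :
    x ∈ (f * g⁻¹).mod := by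
  have h0 : (g : FractionalIdeal (𝓞 F)⁰ F) ≠ 0 := g.ne_zero
  change _ ∈ ((f * g⁻¹ : FracId F) : FractionalIdeal (𝓞 F)⁰ F)
  have e : ((f * g⁻¹ : FracId F) : FractionalIdeal (𝓞 F)⁰ F)
      = (f : FractionalIdeal (𝓞 F)⁰ F) / (g : FractionalIdeal (𝓞 F)⁰ F) := by
    rw [Units.val_mul, Units.val_inv_eq_inv_val, div_eq_mul_inv]
  rw [e, FractionalIdeal.mem_div_iff_of_ne_zero h0]
  exact h

/-- The exponent of `b'/b` lies in `b b'⁻¹`. -/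
theorem exponent_mem (b b' : FracId F) :
    ((quotExponent b.mod b'.mod : ℕ) : F) ∈ (b * b'⁻¹).mod := by
  refine mem_mul_inv fun y hy => ?_
  have h := AddMonoid.exponent_nsmul_eq_zero
    (Submodule.Quotient.mk ⟨y, hy⟩ : b'.mod ⧸ b.mod.submoduleOf b'.mod)
  rw [← Submodule.Quotient.mk_smul, Submodule.Quotient.mk_eq_zero] at h
  have h2 : quotExponent b.mod b'.mod • y ∈ b.mod := h
  rwa [nsmul_eq_mul] at h2

/-- `𝓞_C^× = {(u, ε) | u - 1 ∈ 𝔫b'b⁻¹, uε - 1 ∈ bb'⁻¹}`. -/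
def unitsC (D : Subgroup Fˣ) (n : Ideal (𝓞 F)) [NeZero n] (b b' : FracId F) :
    Subgroup ((𝓞 F)ˣ × unitsDPlus D) where
  carrier := {p | ((p.1 : 𝓞 F) : F) - 1 ∈ (ofIdeal n * b' * b⁻¹).mod ∧
    ((p.1 : 𝓞 F) : F) * ((p.2.1 : 𝓞 F) : F) - 1 ∈ (b * b'⁻¹).mod}
  one_mem' := by simp
  mul_mem' := by
    rintro ⟨u, ε⟩ ⟨v, η⟩ ⟨h1, h2⟩ ⟨k1, k2⟩
    constructor
    · have := add_mem (int_mul_mem _ (u : 𝓞 F) k1) h1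
      simp only [Prod.mk_mul_mk, Units.val_mul, map_mul] at this ⊢
      convert this using 1
      ring
    · have := add_mem (int_mul_mem _ ((u : 𝓞 F) * (ε.1 : 𝓞 F)) k2) h2
      simp only [Prod.mk_mul_mk, Subgroup.coe_mul, Units.val_mul, map_mul] at this ⊢
      convert this using 1
      ring
  inv_mem' := by
    rintro ⟨u, ε⟩ ⟨h1, h2⟩
    have eu : (((u⁻¹ : (𝓞 F)ˣ) : 𝓞 F) : F) * ((u : 𝓞 F) : F) = 1 := by
      rw [← map_mul, Units.inv_mul, map_one]
    have ee : (((ε.1⁻¹ : (𝓞 F)ˣ) : 𝓞 F) : F) * ((ε.1 : 𝓞 F) : F) = 1 := by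
      rw [← map_mul, Units.inv_mul, map_one]
    constructor
    · have := neg_mem (int_mul_mem _ ((u⁻¹ : (𝓞 F)ˣ) : 𝓞 F) h1)
      simp only [Prod.inv_mk] at this ⊢
      convert this using 1
      linear_combination eu
    · have := neg_mem (int_mul_mem _
        (((u⁻¹ : (𝓞 F)ˣ) : 𝓞 F) * ((ε.1⁻¹ : (𝓞 F)ˣ) : 𝓞 F)) h2)
      simp only [Prod.inv_mk, Subgroup.coe_inv, map_mul] at this ⊢
      convert this using 1
      linear_combination (((ε.1⁻¹ : (𝓞 F)ˣ) : 𝓞 F) : F) * ((ε.1 : 𝓞 F) : F) * eu + ee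

/-- `𝓞_{C̄}^× = {(u, ε) | u - 1 ∈ 𝔫b'b⁻¹, uε ∈ (ℤ/n)^× + bb'⁻¹}`, where `n` is the exponent
of `b'/b`. -/
def unitsCbar (D : Subgroup Fˣ) (n : Ideal (𝓞 F)) [NeZero n] (b b' : FracId F) :
    Subgroup ((𝓞 F)ˣ × unitsDPlus D) where
  carrier := {p | ((p.1 : 𝓞 F) : F) - 1 ∈ (ofIdeal n * b' * b⁻¹).mod ∧
    ∃ k : ℤ, IsCoprime k (quotExponent b.mod b'.mod : ℤ) ∧
      ((p.1 : 𝓞 F) : F) * ((p.2.1 : 𝓞 F) : F) - (k : F) ∈ (b * b'⁻¹).mod}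
  one_mem' := by
    refine ⟨by simp, 1, isCoprime_one_left, by simp⟩
  mul_mem' := by
    rintro ⟨u, ε⟩ ⟨v, η⟩ ⟨h1, k, hk, h2⟩ ⟨k1, l, hl, k2⟩
    constructor
    · have := add_mem (int_mul_mem _ (u : 𝓞 F) k1) h1
      simp only [Prod.mk_mul_mk, Units.val_mul, map_mul] at this ⊢
      convert this using 1
      ring
    · refine ⟨k * l, hk.mul_left hl, ?_⟩
      have := add_mem (int_mul_mem _ ((u : 𝓞 F) * (ε.1 : 𝓞 F)) k2) (int_mul_mem _ (l : 𝓞 F) h2)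
      simp only [Prod.mk_mul_mk, Subgroup.coe_mul, Units.val_mul, map_mul, map_intCast,
        Int.cast_mul] at this ⊢
      convert this using 1
      ring
  inv_mem' := by
    rintro ⟨u, ε⟩ ⟨h1, k, ⟨k', m, hk⟩, h2⟩
    have eu : (((u⁻¹ : (𝓞 F)ˣ) : 𝓞 F) : F) * ((u : 𝓞 F) : F) = 1 := by
      rw [← map_mul, Units.inv_mul, map_one]
    have ee : (((ε.1⁻¹ : (𝓞 F)ˣ) : 𝓞 F) : F) * ((ε.1 : 𝓞 F) : F) = 1 := by
      rw [← map_mul, Units.inv_mul, map_one]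
    constructor
    · have := neg_mem (int_mul_mem _ ((u⁻¹ : (𝓞 F)ˣ) : 𝓞 F) h1)
      simp only [Prod.inv_mk] at this ⊢
      convert this using 1
      linear_combination eu
    · refine ⟨k', ⟨k, m, by rw [mul_comm k k']; exact hk⟩, ?_⟩
      have hkF : (k' : F) * (k : F) + (m : F) * ((quotExponent b.mod b'.mod : ℕ) : F) = 1 := by
        exact_mod_cast congrArg (Int.cast : ℤ → F) hk
      have := sub_mem (int_mul_mem _
        (((u⁻¹ : (𝓞 F)ˣ) : 𝓞 F) * ((ε.1⁻¹ : (𝓞 F)ˣ) : 𝓞 F) * (m : 𝓞 F)) (exponent_mem b b'))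
        (int_mul_mem _
        (((u⁻¹ : (𝓞 F)ˣ) : 𝓞 F) * ((ε.1⁻¹ : (𝓞 F)ˣ) : 𝓞 F) * (k' : 𝓞 F)) h2)
      simp only [Prod.inv_mk, Subgroup.coe_inv, map_mul, map_intCast] at this ⊢
      convert this using 1
      linear_combination (k' : F) * (((ε.1⁻¹ : (𝓞 F)ˣ) : 𝓞 F) : F) * ((ε.1 : 𝓞 F) : F) * eu
        + (k' : F) * ee
        - (((u⁻¹ : (𝓞 F)ˣ) : 𝓞 F) : F) * (((ε.1⁻¹ : (𝓞 F)ˣ) : 𝓞 F) : F) * hkF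

end Ideals

/-! ### Lattices, `n`-torsion and induced maps -/

section Lattices

variable {F : Type*} [Field F] [NumberField F]
variable {V W Z : Type*} [AddCommGroup V] [Module F V] [Module (𝓞 F) V] [IsScalarTower (𝓞 F) F V]
  [AddCommGroup W] [Module F W] [Module (𝓞 F) W] [IsScalarTower (𝓞 F) F W]
  [AddCommGroup Z] [Module F Z] [Module (𝓞 F) Z] [IsScalarTower (𝓞 F) F Z]

/-- `n⁻¹M = {v | n v ⊆ M}`. -/
def divBy (n : Ideal (𝓞 F)) (M : Submodule (𝓞 F) V) : Submodule (𝓞 F) V where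
  carrier := {v | ∀ s ∈ n, s • v ∈ M}
  zero_mem' := by intro s _; simp
  add_mem' := by
    intro v w hv hw s hs
    rw [smul_add]
    exact M.add_mem (hv s hs) (hw s hs)
  smul_mem' := by
    intro t v hv s hs
    rw [smul_comm]
    exact M.smul_mem t (hv s hs)

/-- The `𝓞 F / n`-module `n⁻¹M / M`. -/
abbrev Tors (n : Ideal (𝓞 F)) (M : Submodule (𝓞 F) V) : Type _ :=
  divBy n M ⧸ M.submoduleOf (divBy n M)

/-- The class in `n⁻¹M / M` of an element of `n⁻¹M`. -/
abbrev Tors.mk {n : Ideal (𝓞 F)} {M : Submodule (𝓞 F) V} (v : divBy n M) : Tors n M :=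
  Submodule.Quotient.mk v

theorem map_int_smul (f : V →ₗ[F] W) (s : 𝓞 F) (v : V) : f (s • v) = s • f v :=
  (f.restrictScalars (𝓞 F)).map_smul s v

theorem divBy_map (n : Ideal (𝓞 F)) {M : Submodule (𝓞 F) V} {N : Submodule (𝓞 F) W}
    (f : V →ₗ[F] W) (hf : ∀ v ∈ M, f v ∈ N) : ∀ v ∈ divBy n M, f v ∈ divBy n N := by
  intro v hv s hs
  rw [← map_int_smul]
  exact hf _ (hv s hs)

/-- The map `n⁻¹M / M → n⁻¹N / N` induced by a linear map carrying `M` into `N`. -/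
def torsMap (n : Ideal (𝓞 F)) {M : Submodule (𝓞 F) V} {N : Submodule (𝓞 F) W}
    (f : V →ₗ[F] W) (hf : ∀ v ∈ M, f v ∈ N) : Tors n M →ₗ[𝓞 F] Tors n N :=
  Submodule.mapQ _ _ ((f.restrictScalars (𝓞 F)).restrict (divBy_map n f hf))
    (fun v hv => hf v.1 hv)

/-- Isomorphisms of `𝓞 F`-lattices `M ≅ N`. An `𝓞 F`-linear isomorphism between lattices of two
`F`-vector spaces extends uniquely to an `F`-linear isomorphism of the spaces, and is recorded
here by that extension. -/
structure LatIso (M : Submodule (𝓞 F) V) (N : Submodule (𝓞 F) W) where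
  toEquiv : V ≃ₗ[F] W
  mem_iff : ∀ v, v ∈ M ↔ toEquiv v ∈ N

namespace LatIso

variable {M : Submodule (𝓞 F) V} {N : Submodule (𝓞 F) W} {P : Submodule (𝓞 F) Z}

/-- The underlying map of lattices. -/
def onLat (f : LatIso M N) : M →ₗ[𝓞 F] N :=
  (f.toEquiv.toLinearMap.restrictScalars (𝓞 F)).restrict (fun v hv => (f.mem_iff v).1 hv)

/-- The reduction `n⁻¹M / M → n⁻¹N / N`. -/
def onTors (n : Ideal (𝓞 F)) (f : LatIso M N) : Tors n M →ₗ[𝓞 F] Tors n N :=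
  torsMap n f.toEquiv.toLinearMap (fun v hv => (f.mem_iff v).1 hv)

def refl (M : Submodule (𝓞 F) V) : LatIso M M := ⟨LinearEquiv.refl F V, fun _ => Iff.rfl⟩

def symm (f : LatIso M N) : LatIso N M :=
  ⟨f.toEquiv.symm, fun v => by rw [f.mem_iff, LinearEquiv.apply_symm_apply]⟩

def trans (f : LatIso M N) (g : LatIso N P) : LatIso M P :=
  ⟨f.toEquiv.trans g.toEquiv, fun v => (f.mem_iff v).trans (g.mem_iff _)⟩

end LatIso

end Lattices

/-! ### The matrix groups -/

section Groups

variable {F : Type*} [Field F] [NumberField F]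

/-- The lattice `p ⊕ q` of `F²`. -/
def prodLat (p q : FracId F) : Submodule (𝓞 F) (Fin 2 → F) where
  carrier := {v | v 0 ∈ p.mod ∧ v 1 ∈ q.mod}
  zero_mem' := ⟨p.mod.zero_mem, q.mod.zero_mem⟩
  add_mem' := fun hv hw => ⟨p.mod.add_mem hv.1 hw.1, q.mod.add_mem hv.2 hw.2⟩
  smul_mem' := fun s _ hv => ⟨p.mod.smul_mem s hv.1, q.mod.smul_mem s hv.2⟩

/-- The left action of `GL₂(F)` on row vectors, `γ · v = v γ⁻¹`. -/
def rowAct : GL (Fin 2) F →* ((Fin 2 → F) ≃ₗ[F] (Fin 2 → F)) where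
  toFun g :=
    { toFun := fun v => v ᵥ* (g⁻¹ : GL (Fin 2) F).1
      invFun := fun v => v ᵥ* g.1
      map_add' := fun v w => Matrix.add_vecMul _ v w
      map_smul' := fun s v => Matrix.smul_vecMul s v _
      left_inv := fun v => by
        change (v ᵥ* (g⁻¹ : GL (Fin 2) F).1) ᵥ* g.1 = v
        rw [Matrix.vecMul_vecMul, ← Units.val_mul, inv_mul_cancel, Units.val_one, Matrix.vecMul_one]
      right_inv := fun v => by
        change (v ᵥ* g.1) ᵥ* (g⁻¹ : GL (Fin 2) F).1 = v
        rw [Matrix.vecMul_vecMul, ← Units.val_mul, mul_inv_cancel, Units.val_one,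
          Matrix.vecMul_one] }
  map_one' := by
    ext1 v
    simp
  map_mul' g h := by
    ext1 v
    change v ᵥ* ((g * h)⁻¹ : GL (Fin 2) F).1 = (v ᵥ* (h⁻¹ : GL (Fin 2) F).1) ᵥ* _
    rw [Matrix.vecMul_vecMul, ← Units.val_mul, mul_inv_rev]

/-- `G^D_ℚ = {γ ∈ GL₂(F) | ν(γ) ∈ D_ℚ}`, with `ν = det`. -/
def GD (D : Subgroup Fˣ) : Subgroup (GL (Fin 2) F) := D.comap Matrix.GeneralLinearGroup.det

/-- `G^D_{ℚ+}`: the elements of `G^D_ℚ` with totally positive determinant. -/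
def GDplus (D : Subgroup Fˣ) : Subgroup (GL (Fin 2) F) :=
  GD D ⊓ (totPos F).comap Matrix.GeneralLinearGroup.det

/-- `G^𝓞_ℚ = {γ ∈ G^D_ℚ | ν(γ) ∈ 𝓞_+^×}`. -/
def GDint (D : Subgroup Fˣ) : Subgroup (GL (Fin 2) F) :=
  GD D ⊓ (totPos F ⊓ (unitsToField (F := F)).range).comap Matrix.GeneralLinearGroup.det

/-- The stabilizer `G^+(L)` of the lattice `L` in `G^D_{ℚ+}`. -/
def Gplus (D : Subgroup Fˣ) (L : Submodule (𝓞 F) (Fin 2 → F)) : Subgroup (GL (Fin 2) F) where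
  carrier := {g | g ∈ GDplus D ∧ ∀ v, v ∈ L ↔ rowAct g v ∈ L}
  one_mem' := ⟨one_mem _, fun v => by simp⟩
  mul_mem' := fun {g h} hg hh => ⟨mul_mem hg.1 hh.1, fun v => by
    rw [map_mul, LinearEquiv.mul_apply, ← hg.2, ← hh.2]⟩
  inv_mem' := fun {g} hg => ⟨inv_mem hg.1, fun v => by
    rw [hg.2 (rowAct g⁻¹ v), ← LinearEquiv.mul_apply, ← map_mul, mul_inv_cancel, map_one,
      LinearEquiv.coe_one, id]⟩

/-- The lattice `L₀ = 𝓞 ⊕ c^*`. -/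
def baseLat (c : FracId F) : Submodule (𝓞 F) (Fin 2 → F) := prodLat 1 c.star

/-- The Borel subgroup `B_ℚ` of `G^D_ℚ` (upper triangular matrices). -/
def borelQ (D : Subgroup Fˣ) : Subgroup (GL (Fin 2) F) where
  carrier := {g | g ∈ GD D ∧ g.1 1 0 = 0}
  one_mem' := ⟨one_mem _, by simp⟩
  mul_mem' := fun {g h} hg hh => ⟨mul_mem hg.1 hh.1, by
    simp [Matrix.mul_apply, hg.2, hh.2]⟩
  inv_mem' := fun {g} hg => ⟨inv_mem hg.1, by
    rw [Matrix.coe_units_inv, Matrix.inv_def, Matrix.adjugate_fin_two]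
    simp [hg.2]⟩

/-- The matrix `(p ξ; 0 q)`. -/
def upperMat (p q : Fˣ) (ξ : F) : GL (Fin 2) F where
  val := !![(p : F), ξ; 0, (q : F)]
  inv := !![(p : F)⁻¹, -((p : F)⁻¹ * ξ * (q : F)⁻¹); 0, (q : F)⁻¹]
  val_inv := by
    have hp := p.ne_zero
    have hq := q.ne_zero
    ext i j
    fin_cases i <;> fin_cases j <;> simp [Matrix.mul_apply]
    field_simp
    ring
  inv_val := by
    have hp := p.ne_zero
    have hq := q.ne_zero
    ext i j
    fin_cases i <;> fin_cases j <;> simp [Matrix.mul_apply]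

/-- The matrix `(1 ξ; 0 1)`; these matrices form `U_ℚ`. -/
def unip (ξ : F) : GL (Fin 2) F := upperMat 1 1 ξ

/-- The matrix `(uε ξ; 0 u⁻¹)`. -/
def triMat (u ε : (𝓞 F)ˣ) (ξ : F) : GL (Fin 2) F :=
  upperMat (unitsToField u * unitsToField ε) (unitsToField u)⁻¹ ξ

theorem upperMat_mul (p q p' q' : Fˣ) (ξ ξ' : F) :
    upperMat p q ξ * upperMat p' q' ξ' = upperMat (p * p') (q * q') (p * ξ' + ξ * q') := by
  ext i j
  fin_cases i <;> fin_cases j <;> simp [upperMat, Matrix.mul_apply]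

theorem upperMat_inv (p q : Fˣ) (ξ : F) :
    (upperMat p q ξ)⁻¹ = upperMat p⁻¹ q⁻¹ (-((p : F)⁻¹ * ξ * (q : F)⁻¹)) := by
  rw [inv_eq_iff_mul_eq_one, upperMat_mul]
  have hp := p.ne_zero
  have hq := q.ne_zero
  ext i j
  fin_cases i <;> fin_cases j <;> simp [upperMat]
  field_simp
  ring

/-- `T_ℤ U_ℚ`, where `T_ℤ` consists of the matrices `(uε 0; 0 u⁻¹)` with `u ∈ 𝓞^×` and
`ε ∈ 𝓞_{D+}^×`. -/
def TZUQ (D : Subgroup Fˣ) : Subgroup (GL (Fin 2) F) where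
  carrier := {g | ∃ u : (𝓞 F)ˣ, ∃ ε ∈ unitsDPlus D, ∃ ξ : F, g = triMat u ε ξ}
  one_mem' := by
    refine ⟨1, 1, one_mem _, 0, ?_⟩
    ext i j
    fin_cases i <;> fin_cases j <;> simp [triMat, upperMat]
  mul_mem' := by
    rintro _ _ ⟨u, ε, hε, ξ, rfl⟩ ⟨u', ε', hε', ξ', rfl⟩
    refine ⟨u * u', ε * ε', mul_mem hε hε',
      ((unitsToField u * unitsToField ε : Fˣ) : F) * ξ' + ξ * (((unitsToField u')⁻¹ : Fˣ) : F), ?_⟩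
    rw [triMat, triMat, upperMat_mul, triMat]
    congr 1
    · rw [map_mul, map_mul, mul_mul_mul_comm]
    · rw [map_mul, mul_inv]
  inv_mem' := by
    rintro _ ⟨u, ε, hε, ξ, rfl⟩
    refine ⟨u⁻¹, ε⁻¹, inv_mem hε, -(((unitsToField u * unitsToField ε : Fˣ) : F)⁻¹ * ξ *
      (((unitsToField u)⁻¹ : Fˣ) : F)⁻¹), ?_⟩
    rw [triMat, upperMat_inv, triMat]
    congr 1
    rw [map_inv, map_inv, mul_inv]

theorem Gplus_base_row {D : Subgroup Fˣ} {c : FracId F} {g : GL (Fin 2) F}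
    (hg : g ∈ Gplus D (baseLat c)) {v : Fin 2 → F} (hv : v ∈ baseLat c) :
    v ᵥ* g.1 ∈ baseLat c := by
  have h := ((inv_mem hg).2 v).1 hv
  change v ᵥ* ((g⁻¹)⁻¹ : GL (Fin 2) F).1 ∈ _ at h
  rwa [inv_inv] at h

/-- The entries of an element of `G^+(𝓞 ⊕ c^*)`. -/
theorem Gplus_base_entries {D : Subgroup Fˣ} {c : FracId F} {g : GL (Fin 2) F}
    (hg : g ∈ Gplus D (baseLat c)) :
    g.1 0 0 ∈ (1 : FracId F).mod ∧ g.1 0 1 ∈ c.star.mod ∧ g.1 1 0 ∈ (c * diff F).mod ∧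
      g.1 1 1 ∈ (1 : FracId F).mod := by
  have h1 : (![1, 0] : Fin 2 → F) ᵥ* g.1 ∈ baseLat c :=
    Gplus_base_row hg ⟨mem_mod_one.2 ⟨1, by simp⟩, by simp⟩
  have h2 : ∀ y ∈ c.star.mod, (![0, y] : Fin 2 → F) ᵥ* g.1 ∈ baseLat c := fun y hy =>
    Gplus_base_row hg ⟨by simp, by simpa using hy⟩
  refine ⟨?_, ?_, ?_, ?_⟩
  · simpa [Matrix.vecMul, dotProduct] using h1.1
  · simpa [Matrix.vecMul, dotProduct] using h1.2
  · have := mem_mul_inv (f := 1) (g := c.star) (x := g.1 1 0) fun y hy => by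
      simpa [Matrix.vecMul, dotProduct, mul_comm] using (h2 y hy).1
    have e : (1 : FracId F) * c.star⁻¹ = c * diff F := by
      rw [FracId.star, one_mul, mul_inv, inv_inv, inv_inv]
    rwa [e] at this
  · have := mem_mul_inv (f := c.star) (g := c.star) (x := g.1 1 1) fun y hy => by
      simpa [Matrix.vecMul, dotProduct, mul_comm] using (h2 y hy).2
    rwa [mul_inv_cancel] at this

/-- The congruence group `Γ = Γ₁^D(c, n)`: matrices `(a b; c' d)` in `G^+(𝓞 ⊕ c^*)` with
`c' ∈ c𝔡n` and `d ≡ 1 mod n`. -/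
def Gam (D : Subgroup Fˣ) (c : FracId F) (n : Ideal (𝓞 F)) [NeZero n] :
    Subgroup (GL (Fin 2) F) where
  carrier := {g | g ∈ Gplus D (baseLat c) ∧ g.1 1 0 ∈ (c * diff F * ofIdeal n).mod ∧
    g.1 1 1 - 1 ∈ (ofIdeal n).mod}
  one_mem' := ⟨one_mem _, by simp, by simp⟩
  mul_mem' := by
    rintro g h ⟨hg, hg1, hg2⟩ ⟨hh, hh1, hh2⟩
    obtain ⟨-, -, -, gd⟩ := Gplus_base_entries hg
    obtain ⟨ha, hb, -, -⟩ := Gplus_base_entries hh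
    refine ⟨mul_mem hg hh, ?_, ?_⟩
    · have k1 := mem_mod_mul hg1 ha
      have k2 := mem_mod_mul gd hh1
      rw [mul_one] at k1
      rw [one_mul] at k2
      have := add_mem k1 k2
      simpa [Matrix.mul_apply] using this
    · have k1 := mem_mod_mul hg1 hb
      have e : c * diff F * ofIdeal n * c.star = ofIdeal n := by
        rw [FracId.star, ← mul_inv, mul_comm (c * diff F), mul_assoc, mul_inv_cancel, mul_one]
      rw [e] at k1
      have k2 := mem_mod_mul gd hh2
      rw [one_mul] at k2
      have := add_mem (add_mem k1 k2) hg2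
      simp only [Units.val_mul, Matrix.mul_apply, Fin.sum_univ_two]
      convert this using 1
      ring
  inv_mem' := by
    rintro g ⟨hg, hg1, hg2⟩
    obtain ⟨ha, hb, hc, hd⟩ := Gplus_base_entries (inv_mem hg)
    have e0 : g.1 * (g⁻¹).1 = 1 := by rw [← Units.val_mul, mul_inv_cancel, Units.val_one]
    have e1 := congrFun (congrFun e0 1) 0
    have e2 := congrFun (congrFun e0 1) 1
    simp only [Matrix.mul_apply, Fin.sum_univ_two, Matrix.one_apply_eq,
      Matrix.one_apply_ne (one_ne_zero : (1 : Fin 2) ≠ 0)] at e1 e2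
    refine ⟨inv_mem hg, ?_, ?_⟩
    · have k1 := mem_mod_mul hg1 ha
      have k2 := mem_mod_mul hc hg2
      rw [mul_one] at k1
      have := neg_mem (add_mem k1 k2)
      convert this using 1
      linear_combination e1
    · have k1 := mem_mod_mul hg1 hb
      have e : c * diff F * ofIdeal n * c.star = ofIdeal n := by
        rw [FracId.star, ← mul_inv, mul_comm (c * diff F), mul_assoc, mul_inv_cancel, mul_one]
      rw [e] at k1
      have k2 := mem_mod_mul hg2 hd
      rw [mul_one] at k2
      have := neg_mem (add_mem k1 k2)
      convert this using 1
      linear_combination e2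

end Groups

/-! ### `R`-cusps, `(R, n)`-cusps and `(R, n)`-components -/

section Cusps

variable {F : Type*} [Field F] [NumberField F]

/-- A sextuple `(a, b, L, i, j, lam)`: fractional ideals with `a^* b = c^*`, a lattice `L` of `F²`,
an exact sequence `0 → a^* → L → b → 0` of `𝓞 F`-modules (the maps `i`, `j` are recorded by their
unique `F`-linear extensions) and an isomorphism `lam : ⋀² L ≅ c^*`. -/
structure CuspDatum (c : FracId F) where
  a : FracId F
  b : FracId F
  star_mul : a.star * b = c.star
  L : Submodule (𝓞 F) (Fin 2 → F)
  isLattice : Submodule.IsLattice F L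
  i : F →ₗ[F] (Fin 2 → F)
  j : (Fin 2 → F) →ₗ[F] F
  i_mem : ∀ y ∈ a.star.mod, i y ∈ L
  i_inj : ∀ y ∈ a.star.mod, i y = 0 → y = 0
  exact : ∀ v ∈ L, j v = 0 ↔ ∃ y ∈ a.star.mod, i y = v
  j_mem : ∀ v ∈ L, j v ∈ b.mod
  j_surj : ∀ x ∈ b.mod, ∃ v ∈ L, j v = x
  lam : ⋀[𝓞 F]^2 L ≃ₗ[𝓞 F] c.star.mod

/-- A sextuple with a level structure `β : n⁻¹𝔡⁻¹/𝔡⁻¹ ↪ n⁻¹L/L`. -/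
structure LevelDatum (c : FracId F) (n : Ideal (𝓞 F)) extends CuspDatum c where
  β : Tors n (diff F)⁻¹.mod →ₗ[𝓞 F] Tors n L
  β_inj : Function.Injective β

/-- `f : L ≅ L'` extends to an isomorphism of the two exact sequences, and carries `lam` to `lam'`
up to multiplication by an element of `𝓞_{D+}^×`. -/
def CuspDatum.Compat (D : Subgroup Fˣ) {c : FracId F} (x x' : CuspDatum c)
    (f : LatIso x.L x'.L) : Prop :=
  (∃ q : LatIso x.a.star.mod x'.a.star.mod, ∀ y, f.toEquiv (x.i y) = x'.i (q.toEquiv y)) ∧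
  (∃ p : LatIso x.b.mod x'.b.mod, ∀ v, x'.j (f.toEquiv v) = p.toEquiv (x.j v)) ∧
  ∃ ε ∈ unitsDPlus D, ∀ w : ⋀[𝓞 F]^2 x.L,
    x'.lam (exteriorPower.map 2 f.onLat w) = (ε : 𝓞 F) • x.lam w

namespace LevelDatum

variable {c : FracId F} {n : Ideal (𝓞 F)}

/-- The equivalence relation whose classes are the `(R, n)`-cusps. -/
def CuspEquiv (D : Subgroup Fˣ) (x x' : LevelDatum c n) : Prop :=
  x.a = x'.a ∧ x.b = x'.b ∧ ∃ f : LatIso x.L x'.L,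
    x.toCuspDatum.Compat D x'.toCuspDatum f ∧ ∀ t, f.onTors n (x.β t) = x'.β t

/-- Isomorphism of `(R, n)`-cusps: `a = ξa'`, `b = ξb'` for some `ξ ∈ F^×`. -/
def CuspIso (D : Subgroup Fˣ) (x x' : LevelDatum c n) : Prop :=
  (∃ ξ : Fˣ, x.a = toPrincipalIdeal (𝓞 F) F ξ * x'.a ∧ x.b = toPrincipalIdeal (𝓞 F) F ξ * x'.b) ∧
  ∃ f : LatIso x.L x'.L,
    x.toCuspDatum.Compat D x'.toCuspDatum f ∧ ∀ t, f.onTors n (x.β t) = x'.β t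

/-- The automorphisms of an `(R, n)`-cusp: automorphisms of `L` compatible with all the data. -/
def automorphisms (D : Subgroup Fˣ) (x : LevelDatum c n) :
    Set ((Fin 2 → F) ≃ₗ[F] (Fin 2 → F)) :=
  {f | ∃ h : ∀ v, v ∈ x.L ↔ f v ∈ x.L,
    x.toCuspDatum.Compat D x.toCuspDatum ⟨f, h⟩ ∧
      ∀ t, (LatIso.mk f h).onTors n (x.β t) = x.β t}

theorem equiv_refl (D : Subgroup Fˣ) (x : LevelDatum c n) : CuspEquiv D x x := by
  refine ⟨rfl, rfl, LatIso.refl _, ⟨⟨LatIso.refl _, fun _ => rfl⟩, ⟨LatIso.refl _, fun _ => rfl⟩,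
    1, one_mem _, fun w => ?_⟩, fun t => ?_⟩
  · have : (LatIso.refl x.L).onLat = LinearMap.id := rfl
    rw [this, exteriorPower.map_id]
    simp
  · obtain ⟨v, hv⟩ := Submodule.Quotient.mk_surjective _ (x.β t)
    rw [← hv]
    rfl

theorem equiv_symm (D : Subgroup Fˣ) {x x' : LevelDatum c n} (h : CuspEquiv D x x') :
    CuspEquiv D x' x := by
  obtain ⟨ha, hb, f, ⟨⟨q, hq⟩, ⟨p, hp⟩, ε, hε, hl⟩, ht⟩ := h
  refine ⟨ha.symm, hb.symm, f.symm, ⟨⟨q.symm, fun y => ?_⟩, ⟨p.symm, fun v => ?_⟩,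
    ε⁻¹, inv_mem hε, fun w => ?_⟩, fun t => ?_⟩
  · have := hq (q.toEquiv.symm y)
    rw [LinearEquiv.apply_symm_apply] at this
    exact (LinearEquiv.symm_apply_eq _).2 this.symm
  · have := hp (f.toEquiv.symm v)
    rw [LinearEquiv.apply_symm_apply] at this
    exact (LinearEquiv.eq_symm_apply _).2 this.symm
  · have e : f.onLat ∘ₗ f.symm.onLat = LinearMap.id := by
      ext v
      change f.toEquiv (f.toEquiv.symm v) _ = _
      rw [LinearEquiv.apply_symm_apply]
      rfl
    have h1 := hl (exteriorPower.map 2 f.symm.onLat w)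
    rw [← LinearMap.comp_apply, ← exteriorPower.map_comp, e, exteriorPower.map_id,
      LinearMap.id_apply] at h1
    rw [h1, smul_smul, ← Units.val_mul, inv_mul_cancel, Units.val_one, one_smul]
  · rw [← ht]
    obtain ⟨v, hv⟩ := Submodule.Quotient.mk_surjective _ (x.β t)
    rw [← hv]
    change Submodule.Quotient.mk _ = Submodule.Quotient.mk _
    congr 1
    exact Subtype.ext (f.toEquiv.symm_apply_apply v.1)

theorem equiv_trans (D : Subgroup Fˣ) {x y z : LevelDatum c n} (h : CuspEquiv D x y)
    (h' : CuspEquiv D y z) : CuspEquiv D x z := by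
  obtain ⟨ha, hb, f, ⟨⟨q, hq⟩, ⟨p, hp⟩, ε, hε, hl⟩, ht⟩ := h
  obtain ⟨ha', hb', f', ⟨⟨q', hq'⟩, ⟨p', hp'⟩, ε', hε', hl'⟩, ht'⟩ := h'
  refine ⟨ha.trans ha', hb.trans hb', f.trans f', ⟨⟨q.trans q', fun w => ?_⟩,
    ⟨p.trans p', fun v => ?_⟩, ε' * ε, mul_mem hε' hε, fun w => ?_⟩, fun t => ?_⟩
  · change f'.toEquiv (f.toEquiv (x.i w)) = z.i (q'.toEquiv (q.toEquiv w))
    rw [hq, hq']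
  · change z.j (f'.toEquiv (f.toEquiv v)) = p'.toEquiv (p.toEquiv (x.j v))
    rw [hp', hp]
  · have e : (f.trans f').onLat = f'.onLat ∘ₗ f.onLat := rfl
    rw [e, exteriorPower.map_comp, LinearMap.comp_apply, hl', hl, smul_smul, Units.val_mul]
  · rw [← ht', ← ht]
    obtain ⟨v, hv⟩ := Submodule.Quotient.mk_surjective _ (x.β t)
    rw [← hv]
    rfl

/-- The fractional ideal `b' ⊇ b` with `b'/b = j(im β)` inside `n⁻¹b/b`, as a submodule of `F`. -/
def bPrimeMod (x : LevelDatum c n) : Submodule (𝓞 F) F :=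
  (((LinearMap.range (torsMap n x.j x.j_mem ∘ₗ x.β)).comap
    (Submodule.mkQ (x.b.mod.submoduleOf (divBy n x.b.mod)))).map (divBy n x.b.mod).subtype)

theorem b_le_bPrimeMod (x : LevelDatum c n) : x.b.mod ≤ x.bPrimeMod := by
  intro y hy
  refine ⟨⟨y, fun s _ => x.b.mod.smul_mem s hy⟩, ?_, rfl⟩
  have : Submodule.mkQ (x.b.mod.submoduleOf (divBy n x.b.mod))
      ⟨y, fun s _ => x.b.mod.smul_mem s hy⟩ = 0 := by
    rw [Submodule.mkQ_apply, Submodule.Quotient.mk_eq_zero]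
    exact hy
  rw [SetLike.mem_coe, Submodule.mem_comap, this]
  exact zero_mem _

theorem bPrimeMod_isFractional [NeZero n] (x : LevelDatum c n) :
    IsFractional (𝓞 F)⁰ x.bPrimeMod := by
  obtain ⟨s, hs, hs0⟩ := Submodule.exists_mem_ne_zero_of_ne_bot (NeZero.ne n)
  obtain ⟨r, hr, hrb⟩ := (x.b : FractionalIdeal (𝓞 F)⁰ F).isFractional
  refine ⟨r * s, mul_mem hr (mem_nonZeroDivisors_of_ne_zero hs0), ?_⟩
  rintro _ ⟨⟨y, hy⟩, -, rfl⟩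
  have := hrb _ (hy s hs)
  rwa [smul_smul] at this

/-- The fractional ideal `b'`. -/
def bPrime [NeZero n] (x : LevelDatum c n) : FracId F :=
  Units.mk0 ⟨x.bPrimeMod, x.bPrimeMod_isFractional⟩ (by
    intro h
    apply x.b.ne_zero
    rw [← FractionalIdeal.le_zero_iff, ← h]
    exact x.b_le_bPrimeMod)

/-- `β` factors through the natural map `n⁻¹a^*/a^* → n⁻¹L/L`. -/
def Unramified (x : LevelDatum c n) : Prop :=
  ∃ β' : Tors n (diff F)⁻¹.mod →ₗ[𝓞 F] Tors n x.a.star.mod, torsMap n x.i x.i_mem ∘ₗ β' = x.β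

/-- `x'` belongs to the same `(R, n)`-component as `x`: for some `abar ∈ (ℤ/e)^×`, with `e` the
exponent of `b'/b`, there are an isomorphism `f : L ≅ L'` respecting the underlying `R`-cusps and an
automorphism `φ` of `n⁻¹L/L`, equal to the identity on `n⁻¹a^*/a^*` and to multiplication by (an
integer `k` lifting) `abar` on `n⁻¹b/b`, with `f ∘ φ ∘ β = β'`. -/
def SameComponent [NeZero n] (D : Subgroup Fˣ) (x x' : LevelDatum c n) : Prop :=
  ∃ (abar : (ZMod (quotExponent x.b.mod x.bPrime.mod))ˣ) (k : ℤ)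
    (φ : Tors n x.L ≃ₗ[𝓞 F] Tors n x.L),
    (k : ZMod (quotExponent x.b.mod x.bPrime.mod)) = abar ∧
    (∀ y, φ (torsMap n x.i x.i_mem y) = torsMap n x.i x.i_mem y) ∧
    (∀ w, torsMap n x.j x.j_mem (φ w) = k • torsMap n x.j x.j_mem w) ∧
    x.a = x'.a ∧ x.b = x'.b ∧ ∃ f : LatIso x.L x'.L,
      x.toCuspDatum.Compat D x'.toCuspDatum f ∧ ∀ t, f.onTors n (φ (x.β t)) = x'.β t

end LevelDatum

/-- The equivalence relation whose classes are the `(R, n)`-cusps. -/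
def cuspSetoid (D : Subgroup Fˣ) (c : FracId F) (n : Ideal (𝓞 F)) : Setoid (LevelDatum c n) where
  r := LevelDatum.CuspEquiv D
  iseqv := ⟨LevelDatum.equiv_refl D, LevelDatum.equiv_symm D, LevelDatum.equiv_trans D⟩

/-- The set of `(R, n)`-cusps. -/
def Cusp (D : Subgroup Fˣ) (c : FracId F) (n : Ideal (𝓞 F)) : Type _ :=
  Quotient (cuspSetoid D c n)

def Cusp.mk (D : Subgroup Fˣ) {c : FracId F} {n : Ideal (𝓞 F)} (x : LevelDatum c n) :
    Cusp D c n := Quotient.mk (cuspSetoid D c n) x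

/-- The ideal `b` of an `(R, n)`-cusp. -/
def Cusp.b {D : Subgroup Fˣ} {c : FracId F} {n : Ideal (𝓞 F)} : Cusp D c n → FracId F :=
  Quotient.lift (fun x => x.b) (fun _ _ h => h.2.1)

/-- The set of `(R, n)`-components. -/
def Component (D : Subgroup Fˣ) (c : FracId F) (n : Ideal (𝓞 F)) [NeZero n] : Type _ :=
  Quot (LevelDatum.SameComponent (c := c) (n := n) D)

def Component.mk (D : Subgroup Fˣ) {c : FracId F} {n : Ideal (𝓞 F)} [NeZero n]
    (x : LevelDatum c n) : Component D c n := Quot.mk _ x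

/-- The ideal `b` of an `(R, n)`-component. -/
def Component.b {D : Subgroup Fˣ} {c : FracId F} {n : Ideal (𝓞 F)} [NeZero n] :
    Component D c n → FracId F :=
  Quot.lift (fun x => x.b) (by
    rintro x x' ⟨-, -, -, -, -, -, -, h, -⟩
    exact h)

/-- The sextuple of `x` is the standard one on its lattice: `i(y) = (0, y)`, `j(v) = v₀` and
`lam(v ∧ w) = v₀ w₁ - v₁ w₀`. -/
def CuspDatum.IsStandard {c : FracId F} (x : CuspDatum c) : Prop :=
  (∀ y, x.i y = ![0, y]) ∧ (∀ v, x.j v = v 0) ∧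
  ∀ v w : x.L, ((x.lam (exteriorPower.ιMulti (𝓞 F) 2 ![v, w]) : c.star.mod) : F) =
    v.1 0 * w.1 1 - v.1 1 * w.1 0

/-- `x` is the transform by `g` of `L₀ = 𝓞 ⊕ c^*` with its level structure `β₀(t) = (0, y₀ t)`. -/
def LevelDatum.IsTransform (y₀ : F) {c : FracId F} {n : Ideal (𝓞 F)} (g : GL (Fin 2) F)
    (x : LevelDatum c n) : Prop :=
  x.toCuspDatum.IsStandard ∧ (∀ v, v ∈ baseLat c ↔ rowAct g v ∈ x.L) ∧
  ∀ t : divBy n (diff F)⁻¹.mod, ∃ v : divBy n x.L, v.1 = rowAct g ![0, y₀ * t.1] ∧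
    x.β (Tors.mk t) = Tors.mk v

/-- The `(R, n)`-cusp `C` is the one attached to the double coset `T_ℤ U_ℚ g Γ`. -/
def Cusp.IsGivenBy (y₀ : F) {D : Subgroup Fˣ} {c : FracId F} {n : Ideal (𝓞 F)} (C : Cusp D c n)
    (g : GL (Fin 2) F) : Prop :=
  ∃ x : LevelDatum c n, x.IsTransform y₀ g ∧ Cusp.mk D x = C

/-- `γ` has its entries in `(b (bc)^*; bc𝔡 b⁻¹)`. -/
def IsNormalized (c b : FracId F) (γ : GL (Fin 2) F) : Prop :=
  γ.1 0 0 ∈ b.mod ∧ γ.1 0 1 ∈ (b * c).star.mod ∧ γ.1 1 0 ∈ (b * c * diff F).mod ∧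
    γ.1 1 1 ∈ b⁻¹.mod

/-- `γ⁻¹ Γ γ`. -/
def conjGam (D : Subgroup Fˣ) (c : FracId F) (n : Ideal (𝓞 F)) [NeZero n] (γ : GL (Fin 2) F) :
    Subgroup (GL (Fin 2) F) :=
  (Gam D c n).map (MulAut.conj γ⁻¹).toMonoidHom

/-- `G^+(b ⊕ (bc)^*) ∩ T_ℤ U_ℚ`, as a subgroup of `G^+(b ⊕ (bc)^*)`. -/
def fibreLeft (D : Subgroup Fˣ) (c b : FracId F) : Subgroup (Gplus D (prodLat b (b * c).star)) :=
  (TZUQ D).subgroupOf _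

/-- `γ⁻¹ Γ γ`, as a subgroup of `G^+(b ⊕ (bc)^*)` (it is contained in it when `γ` is normalized
with respect to `b`). -/
def fibreRight (D : Subgroup Fˣ) (c b : FracId F) (n : Ideal (𝓞 F)) [NeZero n]
    (γ : GL (Fin 2) F) : Subgroup (Gplus D (prodLat b (b * c).star)) :=
  (conjGam D c n γ).subgroupOf _

/-! ### Primitive vectors -/

/-- Primitive vectors of `n⁻¹L/L`: those generating a submodule isomorphic to `𝓞/n`. -/
def IsPrimitive {n : Ideal (𝓞 F)} {L : Submodule (𝓞 F) (Fin 2 → F)} (w : Tors n L) : Prop :=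
  ∀ r : 𝓞 F, r • w = 0 ↔ r ∈ n

/-- The set `(n⁻¹L/L)_prim` for `L = b ⊕ (bc)^*`. -/
abbrev Prim (c b : FracId F) (n : Ideal (𝓞 F)) : Type _ :=
  {w : Tors n (prodLat b (b * c).star) // IsPrimitive w}

/-- `x` is the standard sextuple on `L = b ⊕ (bc)^*`, with the level structure `β` sending the
generator `τ` of `n⁻¹𝔡⁻¹/𝔡⁻¹` to the vector `w`. -/
def LevelDatum.HasVector {c : FracId F} {n : Ideal (𝓞 F)} (b : FracId F)
    (τ : Tors n (diff F)⁻¹.mod) (x : LevelDatum c n) (w : Prim c b n) : Prop :=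
  x.toCuspDatum.IsStandard ∧ x.L = prodLat b (b * c).star ∧
  ∃ (v : divBy n x.L) (v' : divBy n (prodLat b (b * c).star)),
    v.1 = v'.1 ∧ x.β τ = Tors.mk v ∧ w.1 = Tors.mk v'

/-- `w'` is the transform of `w` by a matrix `(uε ξ; 0 u⁻¹)` with `u ∈ 𝓞^×`, `ε ∈ 𝓞_{D+}^×` and
`ξ ∈ (cb²)^*`. -/
def primRel (D : Subgroup Fˣ) (c b : FracId F) (n : Ideal (𝓞 F)) (w w' : Prim c b n) : Prop :=
  ∃ (u : (𝓞 F)ˣ) (ε : (𝓞 F)ˣ) (ξ : F) (v v' : divBy n (prodLat b (b * c).star)),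
    ε ∈ unitsDPlus D ∧ ξ ∈ (c * b ^ 2).star.mod ∧ w.1 = Tors.mk v ∧ w'.1 = Tors.mk v' ∧
    v'.1 = v.1 ᵥ* !![((u : 𝓞 F) : F) * ((ε : 𝓞 F) : F), ξ; 0, (((u⁻¹ : (𝓞 F)ˣ) : 𝓞 F) : F)]

/-- `w'` is the transform of `w` by a matrix `(āuε ξ; 0 u⁻¹)` with `u ∈ 𝓞^×`, `ε ∈ 𝓞_{D+}^×`,
`ξ ∈ (cb²)^*` and `ā ∈ (ℤ/e)^×` (acting through a lift `k ∈ ℤ`), where `e` is the exponent of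
`b'/b`, `b' = 𝓞 v₀ + b` being generated by `b` and the first coordinate of `w = [v]`. -/
def primRelBar (D : Subgroup Fˣ) (c b : FracId F) (n : Ideal (𝓞 F)) (w w' : Prim c b n) : Prop :=
  ∃ (u : (𝓞 F)ˣ) (ε : (𝓞 F)ˣ) (ξ : F) (v v' : divBy n (prodLat b (b * c).star))
    (abar : (ZMod (quotExponent b.mod (Submodule.span (𝓞 F) {v.1 0} ⊔ b.mod)))ˣ) (k : ℤ),
    ε ∈ unitsDPlus D ∧ ξ ∈ (c * b ^ 2).star.mod ∧ w.1 = Tors.mk v ∧ w'.1 = Tors.mk v' ∧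
    (k : ZMod (quotExponent b.mod (Submodule.span (𝓞 F) {v.1 0} ⊔ b.mod))) = abar ∧
    v'.1 = v.1 ᵥ* !![(k : F) * ((u : 𝓞 F) : F) * ((ε : 𝓞 F) : F), ξ;
      0, (((u⁻¹ : (𝓞 F)ˣ) : 𝓞 F) : F)]

end Cusps

end HilbertCusp

end

open HilbertCusp

/-! The argument reduces every cusp to one vector. Over a Dedekind domain the sequence `0 → a^* → L
→ b → 0` splits, because `b` is projective, and the relation `a^* b = c^*` forces `a = bc`. The
exterior square of `b ⊕ (bc)^*` is identified with `c^*` by the determinant, and two identifications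
differ by a unit, which a rescaling of the first coordinate removes. Hence every cusp has a standard
representative on `b ⊕ (bc)^*` (`exists_std_equiv`). An isomorphism between standard tuples
preserves the line `v₀ = 0`, acts by units on both graded pieces and has determinant in `𝓞_{D+}^×`,
so it is a matrix of `T_ℤ U_ℚ` (`compat_iff`). What remains of the tuple is `β`, and `β` is
determined by the primitive vector `β(τ)`, as `n⁻¹𝔡⁻¹/𝔡⁻¹` is cyclic.

The arithmetic input is strong approximation (`exists_normalized_lift`): every primitive vector of
`n⁻¹L/L` is the class of `(0, y₀t)γ` for a normalized `γ` of determinant `1`. Its bottom row is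
obtained by lifting the vector and correcting one entry modulo `n` until the row is unimodular, by
the stable range property of Dedekind domains (`exists_add_isCoprime`). So every cusp is a transform
`g · (L₀, β₀)` of one base datum. Because `n + y₀c = 𝓞`, the elements of `G^+(L₀)` fixing `β₀` are
exactly those of `Γ` (`mem_Gam_iff`). This gives the double cosets (`transform_equiv_iff`) and,
after conjugation by `γ`, the automorphism group `γ⁻¹Γγ ∩ B`.

For the finer statements put `A = (bc)^*` and let `v = (v₀, v₁)` represent the level vector. Then
`b' = b + 𝓞v₀`, and a shear `ξ ∈ Ab⁻¹` moves `v₁` by `ξv₀`, so modulo `A` it sweeps out `Ab'b⁻¹/A`.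
Primitivity says that `v₁` generates `n⁻¹A` modulo `Ab'b⁻¹` (`isPrimitive_iff`). Once `ξ` is
eliminated the two coordinates are independent: those with a given `b'` form a torsor under
`(𝓞/bb'⁻¹)^× × (𝓞/nb'b⁻¹)^×`, on which `(u, ε)` acts through `(uε, u⁻¹)`. The kernel of this
character is `𝓞_C^×`, which yields both the exact sequence and the count of cusps. For components
one also divides by the image of `(ℤ/n)^×` in the first factor, `n` being the exponent of `b'/b`;
that map is injective because `n` is the characteristic of `𝓞/bb'⁻¹`. -/

noncomputable section

namespace HilbertCusp

set_option linter.unusedSectionVars false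

/-! ### Arithmetic of fractional ideals, multipliers and the stable range property -/

section IdealTools

variable {F : Type*} [Field F] [NumberField F]

/-- The principal fractional ideal `x 𝓞`. -/
abbrev prin (x : F) : FractionalIdeal (𝓞 F)⁰ F := FractionalIdeal.spanSingleton (𝓞 F)⁰ x

theorem prin_le {x : F} {f : FractionalIdeal (𝓞 F)⁰ F} : prin x ≤ f ↔ x ∈ f :=
  FractionalIdeal.spanSingleton_le_iff_mem

theorem mem_prin_self (x : F) : x ∈ prin x := FractionalIdeal.mem_spanSingleton_self _ x

theorem prin_mul (x y : F) : prin (x * y) = prin x * prin y :=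
  (FractionalIdeal.spanSingleton_mul_spanSingleton x y).symm

theorem mem_mod {x : F} {f : FracId F} : x ∈ f.mod ↔ x ∈ (f : FractionalIdeal (𝓞 F)⁰ F) := Iff.rfl

theorem mod_le {f g : FracId F} :
    f.mod ≤ g.mod ↔ (f : FractionalIdeal (𝓞 F)⁰ F) ≤ (g : FractionalIdeal (𝓞 F)⁰ F) := Iff.rfl

theorem mod_injective : Function.Injective (FracId.mod : FracId F → Submodule (𝓞 F) F) := by
  intro f g h
  apply Units.ext
  exact FractionalIdeal.coeToSubmodule_injective h

/-- Nonzero fractional ideals are invertible, so `f g⁻¹` is the colon ideal. Most congruence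
conditions below pass to ideal arithmetic, and back, through this equivalence. -/
theorem mem_mul_inv_iff {f g : FracId F} {x : F} :
    x ∈ (f * g⁻¹).mod ↔ ∀ y ∈ g.mod, x * y ∈ f.mod := by
  refine ⟨fun h y hy => ?_, mem_mul_inv⟩
  have := mem_mod_mul h hy
  rwa [inv_mul_cancel_right] at this

theorem mem_add_prin {f : FractionalIdeal (𝓞 F)⁰ F} {x z : F} :
    z ∈ f + prin x ↔ ∃ y ∈ f, ∃ r : 𝓞 F, z = y + r * x := by
  rw [← FractionalIdeal.mem_coe, FractionalIdeal.coe_add, Submodule.add_eq_sup, Submodule.mem_sup]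
  constructor
  · rintro ⟨y, hy, w, hw, rfl⟩
    obtain ⟨r, rfl⟩ := (FractionalIdeal.mem_spanSingleton _).1 hw
    exact ⟨y, hy, r, by rw [Algebra.smul_def]⟩
  · rintro ⟨y, hy, r, rfl⟩
    exact ⟨y, hy, r * x, (FractionalIdeal.mem_spanSingleton _).2 ⟨r, by rw [Algebra.smul_def]⟩, rfl⟩

theorem mem_add_iff {f g : FractionalIdeal (𝓞 F)⁰ F} {z : F} :
    z ∈ f + g ↔ ∃ x ∈ f, ∃ y ∈ g, x + y = z := by
  rw [← FractionalIdeal.mem_coe, FractionalIdeal.coe_add, Submodule.add_eq_sup, Submodule.mem_sup]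
  rfl

theorem mem_prin_mul {f : FractionalIdeal (𝓞 F)⁰ F} {x z : F} :
    z ∈ prin x * f ↔ ∃ y ∈ f, z = x * y := FractionalIdeal.mem_singleton_mul

theorem le_add_left' (f g : FractionalIdeal (𝓞 F)⁰ F) : f ≤ f + g := by
  rw [← FractionalIdeal.sup_eq_add]; exact le_sup_left

theorem le_add_right' (f g : FractionalIdeal (𝓞 F)⁰ F) : g ≤ f + g := by
  rw [← FractionalIdeal.sup_eq_add]; exact le_sup_right

theorem fadd_le {f g h : FractionalIdeal (𝓞 F)⁰ F} : f + g ≤ h ↔ f ≤ h ∧ g ≤ h := by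
  rw [← FractionalIdeal.sup_eq_add]; exact sup_le_iff

theorem coe_ofIdeal (n : Ideal (𝓞 F)) [NeZero n] :
    ((ofIdeal n : FracId F) : FractionalIdeal (𝓞 F)⁰ F) = (n : FractionalIdeal (𝓞 F)⁰ F) := rfl

theorem mem_ofIdeal {n : Ideal (𝓞 F)} [NeZero n] {x : F} :
    x ∈ (ofIdeal n).mod ↔ ∃ s ∈ n, (s : F) = x := by
  rw [mem_mod, coe_ofIdeal, FractionalIdeal.mem_coeIdeal]

theorem int_mem_ofIdeal {n : Ideal (𝓞 F)} [NeZero n] {s : 𝓞 F} :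
    (s : F) ∈ (ofIdeal n).mod ↔ s ∈ n := by
  rw [mem_ofIdeal]
  constructor
  · rintro ⟨t, ht, h⟩
    rwa [← NumberField.RingOfIntegers.coe_injective h]
  · exact fun h => ⟨s, h, rfl⟩

theorem ofIdeal_le_one (n : Ideal (𝓞 F)) [NeZero n] : (ofIdeal n).mod ≤ (1 : FracId F).mod := by
  intro x hx
  obtain ⟨s, -, rfl⟩ := mem_ofIdeal.1 hx
  exact mem_mod_one.2 ⟨s, rfl⟩

theorem one_le_ofIdeal_inv (n : Ideal (𝓞 F)) [NeZero n] :
    (1 : FracId F).mod ≤ ((ofIdeal n)⁻¹ : FracId F).mod := by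
  intro x hx
  rw [← one_mul (ofIdeal n)⁻¹, mem_mul_inv_iff]
  intro y hy
  have := mem_mod_mul hx (ofIdeal_le_one n hy)
  rwa [one_mul] at this

theorem mod_mono_mul {f g h : FracId F} (H : f.mod ≤ g.mod) : (f * h).mod ≤ (g * h).mod := by
  rw [mod_le] at *
  rw [Units.val_mul, Units.val_mul]
  gcongr

theorem le_ofIdeal_inv_mul (n : Ideal (𝓞 F)) [NeZero n] (f : FracId F) :
    f.mod ≤ ((ofIdeal n)⁻¹ * f).mod := by
  have := mod_mono_mul (h := f) (one_le_ofIdeal_inv n)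
  rwa [one_mul] at this

theorem mem_ofIdeal_inv_mul {n : Ideal (𝓞 F)} [NeZero n] {f : FracId F} {x : F} :
    x ∈ ((ofIdeal n)⁻¹ * f).mod ↔ ∀ s ∈ n, (s : F) * x ∈ f.mod := by
  rw [mul_comm, mem_mul_inv_iff]
  constructor
  · intro h s hs
    rw [mul_comm]
    exact h _ (int_mem_ofIdeal.2 hs)
  · intro h y hy
    obtain ⟨s, hs, rfl⟩ := mem_ofIdeal.1 hy
    rw [mul_comm]
    exact h s hs

/-- Links the elementwise definition of `divBy` with the group of fractional ideals, where factors
can be cancelled. -/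
theorem divBy_mod (n : Ideal (𝓞 F)) [NeZero n] (f : FracId F) :
    divBy n f.mod = ((ofIdeal n)⁻¹ * f).mod := by
  ext x
  rw [mem_ofIdeal_inv_mul]
  refine forall₂_congr fun s _ => ?_
  rw [Algebra.smul_def]

theorem mem_divBy_mod {n : Ideal (𝓞 F)} [NeZero n] {f : FracId F} {x : F} :
    x ∈ divBy n f.mod ↔ x ∈ ((ofIdeal n)⁻¹ * f).mod := by rw [divBy_mod]

theorem mem_divBy_prodLat {n : Ideal (𝓞 F)} [NeZero n] {p q : FracId F} {v : Fin 2 → F} :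
    v ∈ divBy n (prodLat p q) ↔
      v 0 ∈ ((ofIdeal n)⁻¹ * p).mod ∧ v 1 ∈ ((ofIdeal n)⁻¹ * q).mod := by
  rw [mem_ofIdeal_inv_mul, mem_ofIdeal_inv_mul, ← forall₂_and]
  refine forall₂_congr fun s _ => ?_
  change (s • v) 0 ∈ p.mod ∧ (s • v) 1 ∈ q.mod ↔ _
  simp only [Pi.smul_apply, Algebra.smul_def]

theorem mod_ne_bot (f : FracId F) : ∃ x ∈ f.mod, x ≠ 0 := by
  by_contra! h
  apply f.ne_zero
  rw [← FractionalIdeal.le_zero_iff]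
  intro x hx
  rw [h x hx]
  exact FractionalIdeal.zero_mem _

/-- Any larger fractional ideal is generated by a smaller one and one more element. -/
theorem exists_add_prin_eq {f g : FracId F} (h : f.mod ≤ g.mod) :
    ∃ x : F, (f : FractionalIdeal (𝓞 F)⁰ F) + prin x = g := by
  obtain ⟨x, hx⟩ := IsDedekindDomain.exists_add_spanSingleton_mul_eq (mod_le.1 h) f.ne_zero
    (one_ne_zero (α := FractionalIdeal (𝓞 F)⁰ F))
  exact ⟨x, by simpa using hx⟩

/-- The fractional ideal `f + x 𝓞`. -/
def adjoin (f : FracId F) (x : F) : FracId F :=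
  Units.mk0 ((f : FractionalIdeal (𝓞 F)⁰ F) + prin x) (by
    intro h
    apply f.ne_zero
    rw [← FractionalIdeal.le_zero_iff, ← h]
    exact le_add_left' _ _)

theorem coe_adjoin (f : FracId F) (x : F) :
    (adjoin f x : FractionalIdeal (𝓞 F)⁰ F) = (f : FractionalIdeal (𝓞 F)⁰ F) + prin x := rfl

theorem adjoin_mod (f : FracId F) (x : F) :
    (adjoin f x).mod = Submodule.span (𝓞 F) {x} ⊔ f.mod := by
  rw [FracId.mod, coe_adjoin, FractionalIdeal.coe_add, Submodule.add_eq_sup, sup_comm,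
    FractionalIdeal.coe_spanSingleton]
  rfl

theorem le_adjoin (f : FracId F) (x : F) : f.mod ≤ (adjoin f x).mod := le_add_left' _ _

theorem mem_adjoin_self (f : FracId F) (x : F) : x ∈ (adjoin f x).mod :=
  le_add_right' _ _ (mem_prin_self x)

theorem mem_adjoin {f : FracId F} {x z : F} :
    z ∈ (adjoin f x).mod ↔ ∃ y ∈ f.mod, ∃ r : 𝓞 F, z = y + r * x := mem_add_prin

theorem adjoin_le {f g : FracId F} {x : F} (h : f.mod ≤ g.mod) (hx : x ∈ g.mod) :
    (adjoin f x).mod ≤ g.mod := by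
  rw [mod_le, coe_adjoin, fadd_le]
  exact ⟨h, prin_le.2 hx⟩

theorem smul_eq_coe_mul (s : 𝓞 F) (x : F) : s • x = (s : F) * x := Algebra.smul_def s x

/-- A linear map between submodules of `F` commutes with multiplication by elements of `F`. -/
theorem cross_mul {M N : Submodule (𝓞 F) F} (φ : M →ₗ[𝓞 F] N) (x y : M) :
    (x : F) * φ y = (y : F) * φ x := by
  obtain ⟨p, q, hq, hx⟩ := IsFractionRing.div_surjective (A := 𝓞 F) (x : F)
  obtain ⟨r, s, hs, hy⟩ := IsFractionRing.div_surjective (A := 𝓞 F) (y : F)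
  have hq0 : (q : F) ≠ 0 := by simpa using nonZeroDivisors.ne_zero hq
  have hs0 : (s : F) ≠ 0 := by simpa using nonZeroDivisors.ne_zero hs
  have hx' : (p : F) = x * q := (div_eq_iff hq0).1 hx
  have hy' : (r : F) = y * s := (div_eq_iff hs0).1 hy
  -- With `x = p/q` and `y = r/s`, both sides are `pr`: an integral relation that a linear map must
  -- respect.
  have e : (p * s) • y = (r * q) • x := by
    apply Subtype.ext
    simp only [Submodule.coe_smul, smul_eq_coe_mul, map_mul]
    linear_combination (s : F) * y * hx' - (q : F) * x * hy'
  have e2 := congrArg (fun z : N => (z : F)) (congrArg φ e)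
  simp only [map_smul, Submodule.coe_smul, smul_eq_coe_mul, map_mul] at e2
  have : (q : F) * s ≠ 0 := mul_ne_zero hq0 hs0
  apply mul_left_cancel₀ this
  linear_combination e2 - (s : F) * φ y * hx' + (q : F) * φ x * hy'

/-- A multiplier of a fractional ideal is an algebraic integer. -/
theorem exists_int_of_mul_mem {f : FracId F} {μ : F} (h : ∀ x ∈ f.mod, μ * x ∈ f.mod) :
    ∃ s : 𝓞 F, (s : F) = μ := by
  have := mem_mul_inv h
  rw [mul_inv_cancel] at this
  exact mem_mod_one.1 this

theorem exists_unit_of_mul_mem {f : FracId F} {μ ν : F} (hμν : μ * ν = 1)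
    (h : ∀ x ∈ f.mod, μ * x ∈ f.mod) (h' : ∀ x ∈ f.mod, ν * x ∈ f.mod) :
    ∃ u : (𝓞 F)ˣ, ((u : 𝓞 F) : F) = μ ∧ (((u⁻¹ : (𝓞 F)ˣ) : 𝓞 F) : F) = ν := by
  obtain ⟨s, rfl⟩ := exists_int_of_mul_mem h
  obtain ⟨t, rfl⟩ := exists_int_of_mul_mem h'
  have e : s * t = 1 := NumberField.RingOfIntegers.coe_injective (by simpa using hμν)
  exact ⟨⟨s, t, e, by rw [mul_comm, e]⟩, rfl, rfl⟩

theorem unit_mul_inv_coe (u : (𝓞 F)ˣ) :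
    ((u : 𝓞 F) : F) * (((u⁻¹ : (𝓞 F)ˣ) : 𝓞 F) : F) = 1 := by
  rw [← map_mul, Units.mul_inv, map_one]

theorem unit_coe_ne_zero (u : (𝓞 F)ˣ) : ((u : 𝓞 F) : F) ≠ 0 :=
  left_ne_zero_of_mul_eq_one (unit_mul_inv_coe u)

theorem unit_mul_mem_iff (f : FracId F) (u : (𝓞 F)ˣ) {x : F} :
    ((u : 𝓞 F) : F) * x ∈ f.mod ↔ x ∈ f.mod := by
  refine ⟨fun h => ?_, int_mul_mem f _⟩
  have := int_mul_mem f ((u⁻¹ : (𝓞 F)ˣ) : 𝓞 F) h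
  rwa [← mul_assoc, mul_comm (((u⁻¹ : (𝓞 F)ˣ) : 𝓞 F) : F), unit_mul_inv_coe, one_mul] at this

/-- A linear automorphism of a fractional ideal is multiplication by a unit. -/
theorem exists_unit_of_linearEquiv (f : FracId F) (φ : f.mod ≃ₗ[𝓞 F] f.mod) :
    ∃ u : (𝓞 F)ˣ, ∀ x, φ x = (u : 𝓞 F) • x := by
  obtain ⟨x₀, hx₀, h0⟩ := mod_ne_bot f
  -- By `cross_mul` an endomorphism is determined by its value at one nonzero element. Applied to
  -- the equivalence and to its inverse, this gives two multipliers with product `1`, both integral.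
  have key : ∀ ψ : f.mod →ₗ[𝓞 F] f.mod, ∀ x, ((ψ x : f.mod) : F) = (ψ ⟨x₀, hx₀⟩ : F) / x₀ * x := by
    intro ψ x
    have := cross_mul ψ x ⟨x₀, hx₀⟩
    field_simp
    linear_combination -this
  have k1 := key φ.toLinearMap
  have k2 := key φ.symm.toLinearMap
  obtain ⟨u, hu, -⟩ := exists_unit_of_mul_mem (f := f)
    (μ := ((φ ⟨x₀, hx₀⟩ : f.mod) : F) / x₀) (ν := ((φ.symm ⟨x₀, hx₀⟩ : f.mod) : F) / x₀) (by
      have := k1 (φ.symm ⟨x₀, hx₀⟩)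
      simp only [LinearEquiv.coe_coe, LinearEquiv.apply_symm_apply] at this
      field_simp at this ⊢
      linear_combination -this)
    (fun x hx => by rw [← LinearEquiv.coe_coe, ← k1 ⟨x, hx⟩]; exact Subtype.property _)
    (fun x hx => by rw [← LinearEquiv.coe_coe, ← k2 ⟨x, hx⟩]; exact Subtype.property _)
  refine ⟨u, fun x => Subtype.ext ?_⟩
  rw [Submodule.coe_smul, smul_eq_coe_mul, hu]
  exact k1 x

/-- A lattice isomorphism of fractional ideals is multiplication by a nonzero element of `F`. -/
theorem equiv_apply_eq (q : F ≃ₗ[F] F) (x : F) : q x = q 1 * x := by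
  rw [mul_comm, ← smul_eq_mul, ← map_smul, smul_eq_mul, mul_one]

theorem latIso_unit {f : FracId F} (q : LatIso f.mod f.mod) :
    ∃ u : (𝓞 F)ˣ, ∀ x, q.toEquiv x = ((u : 𝓞 F) : F) * x := by
  obtain ⟨u, hu, -⟩ := exists_unit_of_mul_mem (f := f) (μ := q.toEquiv 1) (ν := q.toEquiv.symm 1)
    (by rw [← equiv_apply_eq, LinearEquiv.apply_symm_apply])
    (fun x hx => by rw [← equiv_apply_eq]; exact (q.mem_iff x).1 hx)
    (fun x hx => by
      rw [← equiv_apply_eq, q.mem_iff, LinearEquiv.apply_symm_apply]; exact hx)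
  exact ⟨u, fun x => by rw [hu, ← equiv_apply_eq]⟩

/-- Multiplication by a unit, as an automorphism of a fractional ideal. -/
def unitLatIso (f : FracId F) (u : (𝓞 F)ˣ) : LatIso f.mod f.mod where
  toEquiv := LinearEquiv.smulOfNeZero F F ((u : 𝓞 F) : F) (unit_coe_ne_zero u)
  mem_iff _ := (unit_mul_mem_iff f u).symm

theorem unitLatIso_apply (f : FracId F) (u : (𝓞 F)ˣ) (x : F) :
    (unitLatIso f u).toEquiv x = ((u : 𝓞 F) : F) * x := by
  simp [unitLatIso]

theorem not_mul_prod_le {R : Type*} [CommRing R] (S : Finset (Ideal R))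
    (hS : ∀ Q ∈ S, Q.IsMaximal) {n P : Ideal R} (hP : P.IsMaximal) (h1 : ¬ n ≤ P) (h2 : P ∉ S) :
    ¬ n * S.prod id ≤ P := by
  intro hKP
  rcases (Ideal.IsPrime.mul_le hP.isPrime).1 hKP with h | h
  · exact h1 h
  · obtain ⟨Q, hQ, hQP⟩ := (Ideal.IsPrime.prod_le hP.isPrime).1 h
    exact h2 ((hS Q hQ).eq_of_le hP.ne_top hQP ▸ hQ)

/-- Prime avoidance: an ideal covered by finitely many primes lies in one of them. -/
theorem exists_mem_forall_notMem {R : Type*} [CommRing R] (S : Finset (Ideal R))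
    (hS : ∀ P ∈ S, P.IsPrime) {K : Ideal R} (h : ∀ P ∈ S, ¬ K ≤ P) :
    ∃ ν ∈ K, ∀ P ∈ S, ν ∉ P := by
  by_contra! hcon
  obtain ⟨P, hP, hKP⟩ := (Ideal.subset_union_prime (f := fun Q : Ideal R => Q) (I := K) ⊥ ⊥
    (fun P hP _ _ => hS P hP)).1 (fun ν hν => by
      obtain ⟨P, hP, hνP⟩ := hcon ν hν
      exact Set.mem_biUnion hP hνP)
  exact h P hP hKP

/-- Given a finite set of maximal ideals none of which contains `r` and `n` together, some element
of `n` can be added to `r` to avoid all of them. -/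
theorem exists_add_notMem {R : Type*} [CommRing R] (S : Finset (Ideal R))
    (hS : ∀ P ∈ S, P.IsMaximal) {n : Ideal R} {r : R} (h : ∀ P ∈ S, r ∈ P → ¬ n ≤ P) :
    ∃ ν ∈ n, ∀ P ∈ S, r + ν ∉ P := by
  classical
  -- The element `ν` is taken in `n` and in every `P` not containing `r`, where `r` already does the
  -- work, and outside every `P` containing `r`.
  obtain ⟨ν, hν', hνP⟩ := exists_mem_forall_notMem (S.filter (fun P => r ∈ P))
    (K := n * (S.filter (fun P => r ∉ P)).prod id)
    (fun P hP => (hS P (Finset.mem_filter.1 hP).1).isPrime)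
    (fun P hP => not_mul_prod_le _ (fun Q hQ => hS Q (Finset.mem_filter.1 hQ).1)
      (hS P (Finset.mem_filter.1 hP).1) (h P (Finset.mem_filter.1 hP).1 (Finset.mem_filter.1 hP).2)
      (fun h' => (Finset.mem_filter.1 h').2 (Finset.mem_filter.1 hP).2))
  have hν : ν ∈ n ⊓ (S.filter (fun P => r ∉ P)).prod id := Ideal.mul_le_inf hν'
  refine ⟨ν, hν.1, fun P hP hsum => ?_⟩
  by_cases hr : r ∈ P
  · exact hνP P (Finset.mem_filter.2 ⟨hP, hr⟩) ((Ideal.add_mem_iff_right P hr).1 hsum)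
  · have h1 : (S.filter (fun P => r ∉ P)).prod id ≤ P :=
      Ideal.prod_le_inf.trans (Finset.inf_le (f := id) (Finset.mem_filter.2 ⟨hP, hr⟩))
    exact hr ((Ideal.add_mem_iff_left P (h1 hν.2)).1 hsum)

/-- Stable range: an element generating the unit ideal modulo `J + n` can be changed by an
element of `n` so that it generates the unit ideal modulo `J`. -/
theorem exists_add_isCoprime {R : Type*} [CommRing R] [IsDedekindDomain R] {J n : Ideal R}
    (hJ : J ≠ ⊥) {r : R} (h : Ideal.span {r} ⊔ J ⊔ n = ⊤) :
    ∃ ν ∈ n, Ideal.span {r + ν} ⊔ J = ⊤ := by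
  -- Only maximal ideals containing `J` can obstruct coprimality with `J`, and a nonzero ideal has
  -- finitely many of them.
  have hfin : {P : Ideal R | P.IsMaximal ∧ J ≤ P}.Finite := by
    refine Set.Finite.subset ((Ideal.finite_factors hJ).image fun v => v.asIdeal) ?_
    rintro P ⟨hP, hJP⟩
    exact ⟨⟨P, hP.isPrime, fun e => hJ (le_bot_iff.1 (e ▸ hJP))⟩, Ideal.dvd_iff_le.2 hJP, rfl⟩
  obtain ⟨ν, hν, H⟩ := exists_add_notMem hfin.toFinset (n := n) (r := r)
    (fun P hP => (hfin.mem_toFinset.1 hP).1) (fun P hP hr hn => by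
      obtain ⟨hmax, hJP⟩ := hfin.mem_toFinset.1 hP
      apply hmax.ne_top
      rw [← top_le_iff, ← h]
      exact sup_le (sup_le ((Ideal.span_singleton_le_iff_mem _).2 hr) hJP) hn)
  refine ⟨ν, hν, ?_⟩
  by_contra hne
  obtain ⟨P, hP, hle⟩ := Ideal.exists_le_maximal _ hne
  exact H P (hfin.mem_toFinset.2 ⟨hP, le_sup_right.trans hle⟩)
    ((le_sup_left.trans hle) (Ideal.mem_span_singleton_self _))

end IdealTools

/-! ### The exterior square of a direct sum of two ideals -/

section Exterior

variable {F : Type*} [Field F] [NumberField F]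

/-- The wedge product `M × M → ⋀² M`. -/
def wedge {R M : Type*} [CommRing R] [AddCommGroup M] [Module R M] : M →ₗ[R] M →ₗ[R] ⋀[R]^2 M :=
  LinearMap.mk₂ R (fun v w => exteriorPower.ιMulti R 2 ![v, w])
    (fun v v' w => AlternatingMap.map_vecCons_add _ _ _ _)
    (fun r v w => AlternatingMap.map_vecCons_smul _ _ _ _)
    (fun v w w' => by
      have e : ∀ z : M, ![v, z] = Function.update ![v, 0] 1 z := fun z => by
        ext i; fin_cases i <;> simp
      have h := (exteriorPower.ιMulti R 2).map_update_add ![v, 0] 1 w w'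
      rwa [← e, ← e, ← e] at h)
    (fun r v w => by
      have e : ∀ z : M, ![v, z] = Function.update ![v, 0] 1 z := fun z => by
        ext i; fin_cases i <;> simp
      have h := (exteriorPower.ιMulti R 2).map_update_smul ![v, 0] 1 r w
      rwa [← e, ← e] at h)

theorem wedge_apply {R M : Type*} [CommRing R] [AddCommGroup M] [Module R M] (v w : M) :
    wedge (R := R) v w = exteriorPower.ιMulti R 2 ![v, w] := rfl

theorem wedge_self {R M : Type*} [CommRing R] [AddCommGroup M] [Module R M] (v : M) :
    wedge (R := R) v v = 0 :=
  (exteriorPower.ιMulti R 2).map_eq_zero_of_eq ![v, v] (i := 0) (j := 1) rfl (by simp)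

theorem wedge_swap {R M : Type*} [CommRing R] [AddCommGroup M] [Module R M] (v w : M) :
    wedge (R := R) v w = - wedge (R := R) w v := by
  have h := wedge_self (R := R) (v + w)
  simp only [map_add, LinearMap.add_apply, wedge_self, zero_add, add_zero] at h
  exact eq_neg_of_add_eq_zero_right h

/-- Linear maps on `⋀² M` agree if they agree on all `v ∧ w`. -/
theorem exterior_two_ext {R M N : Type*} [CommRing R] [AddCommGroup M] [Module R M]
    [AddCommGroup N] [Module R N] {f g : ⋀[R]^2 M →ₗ[R] N}
    (h : ∀ v w, f (exteriorPower.ιMulti R 2 ![v, w]) = g (exteriorPower.ιMulti R 2 ![v, w])) :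
    f = g := by
  apply exteriorPower.linearMap_ext
  ext a
  have : a = ![a 0, a 1] := by ext i; fin_cases i <;> rfl
  rw [this]
  exact h _ _

/-- Since `p⁻¹p = 𝓞`, the element `1` is a sum of products `ax`. The elements `r = ax` play the role
of a cover on which `p` becomes free, without any localization. -/
theorem span_inv_mul_eq_top (p : FracId F) :
    Ideal.span {r : 𝓞 F | ∃ a ∈ (p⁻¹).mod, ∃ x ∈ p.mod, (r : F) = a * x} = ⊤ := by
  rw [Ideal.eq_top_iff_one]
  have h1 : (1 : F) ∈ ((p⁻¹ * p : FracId F) : FractionalIdeal (𝓞 F)⁰ F) := by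
    rw [inv_mul_cancel]; exact mem_mod_one.2 ⟨1, map_one _⟩
  rw [Units.val_mul] at h1
  have key : ∃ s : 𝓞 F, (s : F) = 1 ∧
      s ∈ Ideal.span {r : 𝓞 F | ∃ a ∈ (p⁻¹).mod, ∃ x ∈ p.mod, (r : F) = a * x} := by
    refine FractionalIdeal.mul_induction_on h1 (C := fun z => ∃ s : 𝓞 F, (s : F) = z ∧
      s ∈ Ideal.span {r : 𝓞 F | ∃ a ∈ (p⁻¹).mod, ∃ x ∈ p.mod, (r : F) = a * x}) ?_ ?_
    · intro a ha x hx
      have : a * x ∈ (p⁻¹ * p).mod := mem_mod_mul ha hx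
      rw [inv_mul_cancel] at this
      obtain ⟨s, hs⟩ := mem_mod_one.1 this
      exact ⟨s, hs, Ideal.subset_span ⟨a, ha, x, hx, hs⟩⟩
    · rintro _ _ ⟨s, rfl, hs⟩ ⟨t, rfl, ht⟩
      exact ⟨s + t, map_add _ _ _, add_mem hs ht⟩
  obtain ⟨s, hs, h⟩ := key
  rwa [NumberField.RingOfIntegers.coe_injective (hs.trans (map_one _).symm)] at h

/-- An element killed by all products `a x` with `a ∈ p⁻¹`, `x ∈ p` vanishes. -/
theorem eq_zero_of_inv_mul_smul {M : Type*} [AddCommGroup M] [Module (𝓞 F) M] (p : FracId F)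
    {t : M} (k : ℕ) (h : ∀ (r : 𝓞 F), ∀ a ∈ (p⁻¹).mod, ∀ x ∈ p.mod, (r : F) = a * x →
      r ^ k • t = 0) : t = 0 := by
  -- Powers of generators of the unit ideal still generate it, so testing against `r ^ k` suffices.
  have h1 := Ideal.span_pow_eq_top _ (span_inv_mul_eq_top p) k
  have h2 : (1 : 𝓞 F) ∈ Ideal.torsionOf (𝓞 F) M t := by
    rw [← Ideal.eq_top_iff_one, ← top_le_iff, ← h1, Ideal.span_le]
    rintro _ ⟨r, ⟨a, ha, x, hx, hr⟩, rfl⟩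
    exact (Ideal.mem_torsionOf_iff t _).2 (h r a ha x hx hr)
  simpa using (Ideal.mem_torsionOf_iff t _).1 h2

/-- Multiplication by `r = ax` turns every element of `p` into a multiple of the single element `x`,
and `f x ∧ f x = 0`. Both factors need an `r`, whence the exponent `2`. -/
theorem wedge_rank_one {M : Type*} [AddCommGroup M] [Module (𝓞 F) M] (p : FracId F)
    (f : p.mod →ₗ[𝓞 F] M) (u u' : p.mod) : wedge (R := 𝓞 F) (f u) (f u') = 0 := by
  refine eq_zero_of_inv_mul_smul p 2 fun r a ha x hx hr => ?_
  have key : ∀ u : p.mod, ∃ s : 𝓞 F, r • u = s • (⟨x, hx⟩ : p.mod) := by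
    intro u
    have h1 : a * u ∈ (p⁻¹ * p).mod := mem_mod_mul ha u.2
    rw [inv_mul_cancel] at h1
    obtain ⟨s, hs⟩ := mem_mod_one.1 h1
    refine ⟨s, Subtype.ext ?_⟩
    rw [Submodule.coe_smul, Submodule.coe_smul, smul_eq_coe_mul, smul_eq_coe_mul, hs, hr]
    ring
  obtain ⟨s, hs⟩ := key u
  obtain ⟨s', hs'⟩ := key u'
  have : r ^ 2 • wedge (R := 𝓞 F) (f u) (f u') = wedge (R := 𝓞 F) (f (r • u)) (f (r • u')) := by
    simp only [map_smul, LinearMap.smul_apply, smul_smul, pow_two]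
  rw [this, hs, hs']
  simp only [map_smul, LinearMap.smul_apply, wedge_self, smul_zero]

/-- The inclusion of the first factor. -/
def inclFst (p q : FracId F) : p.mod →ₗ[𝓞 F] prodLat p q where
  toFun x := ⟨![(x : F), 0], x.2, q.mod.zero_mem⟩
  map_add' x y := by ext i; fin_cases i <;> simp
  map_smul' r x := by ext i; fin_cases i <;> simp

/-- The inclusion of the second factor. -/
def inclSnd (p q : FracId F) : q.mod →ₗ[𝓞 F] prodLat p q where
  toFun y := ⟨![0, (y : F)], p.mod.zero_mem, y.2⟩
  map_add' x y := by ext i; fin_cases i <;> simp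
  map_smul' r x := by ext i; fin_cases i <;> simp

theorem eq_inclFst_add_inclSnd {p q : FracId F} (v : prodLat p q) :
    v = inclFst p q ⟨v.1 0, v.2.1⟩ + inclSnd p q ⟨v.1 1, v.2.2⟩ := by
  ext i; fin_cases i <;> simp [inclFst, inclSnd]

/-- The terms with both factors in one summand vanish by `wedge_rank_one`. -/
theorem wedge_prodLat {p q : FracId F} (v w : prodLat p q) :
    wedge (R := 𝓞 F) v w = wedge (inclFst p q ⟨v.1 0, v.2.1⟩) (inclSnd p q ⟨w.1 1, w.2.2⟩) -
      wedge (inclFst p q ⟨w.1 0, w.2.1⟩) (inclSnd p q ⟨v.1 1, v.2.2⟩) := by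
  conv_lhs => rw [eq_inclFst_add_inclSnd v, eq_inclFst_add_inclSnd w]
  simp only [map_add, LinearMap.add_apply, wedge_rank_one]
  rw [wedge_swap (inclSnd p q _) (inclFst p q _)]
  abel

/-- The determinant `v ∧ w ↦ v₀ w₁ - v₁ w₀` on a lattice. -/
def detAlt (L : Submodule (𝓞 F) (Fin 2 → F)) (N : Submodule (𝓞 F) F)
    (h : ∀ v ∈ L, ∀ w ∈ L, v 0 * w 1 - v 1 * w 0 ∈ N) : L [⋀^Fin 2]→ₗ[𝓞 F] N where
  toFun a := ⟨(a 0).1 0 * (a 1).1 1 - (a 0).1 1 * (a 1).1 0, h _ (a 0).2 _ (a 1).2⟩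
  map_update_add' m i x y := by
    apply Subtype.ext
    fin_cases i
    · simp [Function.update_of_ne]; ring
    · simp [Function.update_of_ne]; ring
  map_update_smul' m i c x := by
    apply Subtype.ext
    fin_cases i
    · simp [Function.update_of_ne, smul_eq_coe_mul]; ring
    · simp [Function.update_of_ne, smul_eq_coe_mul]; ring
  map_eq_zero_of_eq' v i j hij hne := by
    have e : v 0 = v 1 := by
      fin_cases i <;> fin_cases j <;> simp_all
    apply Subtype.ext
    simp [e]; ring

theorem prodLat_det_mem (p q : FracId F) : ∀ v ∈ prodLat p q, ∀ w ∈ prodLat p q,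
    v 0 * w 1 - v 1 * w 0 ∈ (p * q).mod := by
  intro v hv w hw
  refine sub_mem (mem_mod_mul hv.1 hw.2) ?_
  rw [mul_comm (v 1)]
  exact mem_mod_mul hw.1 hv.2

/-- The determinant as a linear map on `⋀² (p ⊕ q)`. -/
def detLin (p q : FracId F) : ⋀[𝓞 F]^2 (prodLat p q) →ₗ[𝓞 F] (p * q).mod :=
  exteriorPower.alternatingMapLinearEquiv (detAlt _ _ (prodLat_det_mem p q))

theorem detLin_wedge {p q : FracId F} (v w : prodLat p q) :
    ((detLin p q (wedge v w) : (p * q).mod) : F) = v.1 0 * w.1 1 - v.1 1 * w.1 0 := by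
  rw [detLin, wedge_apply, exteriorPower.alternatingMapLinearEquiv_apply_ιMulti]
  rfl

/-- Multiplication by an element of `p⁻¹` as a map `p q → q`. -/
def mulInv (p q : FracId F) (a : F) (ha : a ∈ (p⁻¹).mod) : (p * q).mod →ₗ[𝓞 F] q.mod where
  toFun z := ⟨a * z, by
    have := mem_mod_mul ha z.2
    rwa [inv_mul_cancel_left] at this⟩
  map_add' x y := by ext; simp [mul_add]
  map_smul' r x := by ext; simp [smul_eq_coe_mul]; ring

theorem detLin_wedge_eq {p q : FracId F} (v w : prodLat p q) : detLin p q (wedge v w) =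
    ⟨v.1 0 * w.1 1, mem_mod_mul v.2.1 w.2.2⟩ - ⟨w.1 0 * v.1 1, mem_mod_mul w.2.1 v.2.2⟩ := by
  apply Subtype.ext
  rw [detLin_wedge]
  change _ = v.1 0 * w.1 1 - w.1 0 * v.1 1
  ring

/-- The map `p q → ⋀² (p ⊕ q)`, `z ↦ (x, 0) ∧ (0, a z)`. -/
def wedgeMulInv (p q : FracId F) (a : F) (ha : a ∈ (p⁻¹).mod) (x : p.mod) :
    (p * q).mod →ₗ[𝓞 F] ⋀[𝓞 F]^2 (prodLat p q) :=
  wedge (R := 𝓞 F) (inclFst p q x) ∘ₗ inclSnd p q ∘ₗ mulInv p q a ha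

/-- As `r • y = s • x` with `s = ay` integral, the scalar `s` can be moved across the wedge to the
second factor, where it produces `ayz`. -/
theorem smul_wedge_incl (p q : FracId F) {a : F} (ha : a ∈ (p⁻¹).mod) (x : p.mod) {r : 𝓞 F}
    (hr : (r : F) = a * x) (y : p.mod) (z : q.mod) :
    r • wedge (R := 𝓞 F) (inclFst p q y) (inclSnd p q z) =
      wedgeMulInv p q a ha x ⟨y * z, mem_mod_mul y.2 z.2⟩ := by
  have h1 : a * y ∈ (p⁻¹ * p).mod := mem_mod_mul ha y.2
  rw [inv_mul_cancel] at h1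
  obtain ⟨s, hs⟩ := mem_mod_one.1 h1
  have e1 : r • y = s • x := by
    apply Subtype.ext
    rw [Submodule.coe_smul, Submodule.coe_smul, smul_eq_coe_mul, smul_eq_coe_mul, hs, hr]
    ring
  have e2 : mulInv p q a ha ⟨y * z, mem_mod_mul y.2 z.2⟩ = s • z := by
    apply Subtype.ext
    rw [Submodule.coe_smul, smul_eq_coe_mul, hs]
    change a * (y * z) = _
    ring
  rw [wedgeMulInv, LinearMap.comp_apply, LinearMap.comp_apply, e2, ← LinearMap.smul_apply,
    ← map_smul, ← map_smul, e1, map_smul, map_smul, map_smul, map_smul, LinearMap.smul_apply]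

/-- A left inverse of the determinant up to the factor `r`. As the possible `r` generate the unit
ideal, this is what makes the determinant injective on the exterior square. -/
theorem smul_eq_wedgeMulInv_detLin (p q : FracId F) {a : F} (ha : a ∈ (p⁻¹).mod) (x : p.mod)
    {r : 𝓞 F} (hr : (r : F) = a * x) :
    r • (LinearMap.id : ⋀[𝓞 F]^2 (prodLat p q) →ₗ[𝓞 F] _) =
      wedgeMulInv p q a ha x ∘ₗ detLin p q := by
  apply exterior_two_ext
  intro v w
  rw [← wedge_apply, LinearMap.comp_apply, detLin_wedge_eq, map_sub, LinearMap.smul_apply,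
    LinearMap.id_apply, wedge_prodLat v w, smul_sub, smul_wedge_incl p q ha x hr,
    smul_wedge_incl p q ha x hr]

theorem detLin_injective (p q : FracId F) : Function.Injective (detLin p q) := by
  rw [← LinearMap.ker_eq_bot, LinearMap.ker_eq_bot']
  intro t ht
  refine eq_zero_of_inv_mul_smul p 1 fun r a ha x hx hr => ?_
  have := LinearMap.congr_fun (smul_eq_wedgeMulInv_detLin p q ha ⟨x, hx⟩ hr) t
  rwa [LinearMap.comp_apply, ht, map_zero, LinearMap.smul_apply, LinearMap.id_apply,
    ← pow_one r] at this

theorem detLin_surjective (p q : FracId F) : Function.Surjective (detLin p q) := by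
  rintro ⟨z, hz⟩
  have hz' : z ∈ (p : FractionalIdeal (𝓞 F)⁰ F) * (q : FractionalIdeal (𝓞 F)⁰ F) := hz
  suffices h : ∃ t, ((detLin p q t : (p * q).mod) : F) = z by
    obtain ⟨t, ht⟩ := h
    exact ⟨t, Subtype.ext ht⟩
  refine FractionalIdeal.mul_induction_on hz'
    (C := fun z => ∃ t, ((detLin p q t : (p * q).mod) : F) = z) ?_ ?_
  · intro x hx y hy
    exact ⟨wedge (inclFst p q ⟨x, hx⟩) (inclSnd p q ⟨y, hy⟩), by
      rw [detLin_wedge]; simp [inclFst, inclSnd]⟩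
  · rintro _ _ ⟨s, rfl⟩ ⟨t, rfl⟩
    exact ⟨s + t, by simp⟩

/-- A lattice isomorphism induces an isomorphism of exterior squares. -/
def extEquiv {V W : Type*} [AddCommGroup V] [Module F V] [Module (𝓞 F) V]
    [IsScalarTower (𝓞 F) F V] [AddCommGroup W] [Module F W] [Module (𝓞 F) W]
    [IsScalarTower (𝓞 F) F W] {M : Submodule (𝓞 F) V} {N : Submodule (𝓞 F) W} (f : LatIso M N) :
    ⋀[𝓞 F]^2 M ≃ₗ[𝓞 F] ⋀[𝓞 F]^2 N :=
  LinearEquiv.ofLinearMap (exteriorPower.map 2 f.onLat) (exteriorPower.map 2 f.symm.onLat)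
    (by
      rw [← exteriorPower.map_comp]
      have : f.onLat ∘ₗ f.symm.onLat = LinearMap.id := by
        ext v
        exact f.toEquiv.apply_symm_apply v.1
      rw [this, exteriorPower.map_id])
    (by
      rw [← exteriorPower.map_comp]
      have : f.symm.onLat ∘ₗ f.onLat = LinearMap.id := by
        ext v
        exact f.toEquiv.symm_apply_apply v.1
      rw [this, exteriorPower.map_id])

theorem extEquiv_apply {V W : Type*} [AddCommGroup V] [Module F V] [Module (𝓞 F) V]
    [IsScalarTower (𝓞 F) F V] [AddCommGroup W] [Module F W] [Module (𝓞 F) W]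
    [IsScalarTower (𝓞 F) F W] {M : Submodule (𝓞 F) V} {N : Submodule (𝓞 F) W} (f : LatIso M N)
    (t : ⋀[𝓞 F]^2 M) : extEquiv f t = exteriorPower.map 2 f.onLat t := rfl

theorem map_wedge {V W : Type*} [AddCommGroup V] [Module F V] [Module (𝓞 F) V]
    [IsScalarTower (𝓞 F) F V] [AddCommGroup W] [Module F W] [Module (𝓞 F) W]
    [IsScalarTower (𝓞 F) F W] {M : Submodule (𝓞 F) V} {N : Submodule (𝓞 F) W} (f : LatIso M N)
    (v w : M) : exteriorPower.map 2 f.onLat (exteriorPower.ιMulti (𝓞 F) 2 ![v, w]) =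
      exteriorPower.ιMulti (𝓞 F) 2 ![f.onLat v, f.onLat w] := by
  rw [exteriorPower.map_apply_ιMulti]
  congr 1
  ext i
  fin_cases i <;> rfl

/-- If a lattice is the image of `p ⊕ q` under a map of determinant `1`, the determinant
identifies its exterior square with `p q`. -/
theorem exists_lam {p q c' : FracId F} (hpq : p * q = c') {L : Submodule (𝓞 F) (Fin 2 → F)}
    (f : LatIso L (prodLat p q)) (hf : ∀ v w, f.toEquiv v 0 * f.toEquiv w 1 -
      f.toEquiv v 1 * f.toEquiv w 0 = v 0 * w 1 - v 1 * w 0) :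
    ∃ lam : ⋀[𝓞 F]^2 L ≃ₗ[𝓞 F] c'.mod, ∀ v w : L,
      ((lam (exteriorPower.ιMulti (𝓞 F) 2 ![v, w]) : c'.mod) : F) =
        v.1 0 * w.1 1 - v.1 1 * w.1 0 := by
  subst hpq
  have hbij : Function.Bijective (detLin p q) := ⟨detLin_injective p q, detLin_surjective p q⟩
  refine ⟨(extEquiv f).trans (LinearEquiv.ofBijective (detLin p q) hbij), fun v w => ?_⟩
  rw [LinearEquiv.trans_apply, extEquiv_apply, map_wedge]
  exact (detLin_wedge _ _).trans (hf v.1 w.1)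

end Exterior

/-! ### Row vectors, normalized matrices and the role of `y₀` -/

section Transforms

variable {F : Type*} [Field F] [NumberField F]

theorem rowAct_apply (g : GL (Fin 2) F) (v : Fin 2 → F) :
    rowAct g v = v ᵥ* (g⁻¹ : GL (Fin 2) F).1 := rfl

theorem rowAct_inv_apply (g : GL (Fin 2) F) (v : Fin 2 → F) : rowAct g⁻¹ v = v ᵥ* g.1 := by
  rw [rowAct_apply, inv_inv]

theorem rowAct_mul_apply (g h : GL (Fin 2) F) (v : Fin 2 → F) :
    rowAct (g * h) v = rowAct g (rowAct h v) := by
  rw [map_mul, LinearEquiv.mul_apply]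

theorem rowAct_inv_rowAct (g : GL (Fin 2) F) (v : Fin 2 → F) : rowAct g⁻¹ (rowAct g v) = v := by
  rw [← rowAct_mul_apply, inv_mul_cancel, map_one]; rfl

theorem rowAct_rowAct_inv (g : GL (Fin 2) F) (v : Fin 2 → F) : rowAct g (rowAct g⁻¹ v) = v := by
  rw [← rowAct_mul_apply, mul_inv_cancel, map_one]; rfl

theorem vecMul_zero_coord (v : Fin 2 → F) (M : Matrix (Fin 2) (Fin 2) F) :
    (v ᵥ* M) 0 = v 0 * M 0 0 + v 1 * M 1 0 := by
  simp [Matrix.vecMul, dotProduct]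

theorem vecMul_one_coord (v : Fin 2 → F) (M : Matrix (Fin 2) (Fin 2) F) :
    (v ᵥ* M) 1 = v 0 * M 0 1 + v 1 * M 1 1 := by
  simp [Matrix.vecMul, dotProduct]

theorem upperMat_val (p q : Fˣ) (ξ : F) : (upperMat p q ξ).1 = !![(p : F), ξ; 0, (q : F)] := rfl

theorem vec_ext {v w : Fin 2 → F} (h0 : v 0 = w 0) (h1 : v 1 = w 1) : v = w := by
  ext i; fin_cases i
  · exact h0
  · exact h1

theorem vecMul_upperMat (p q : Fˣ) (ξ : F) (v : Fin 2 → F) :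
    v ᵥ* (upperMat p q ξ).1 = ![v 0 * p, v 0 * ξ + v 1 * q] := by
  apply vec_ext
  · rw [vecMul_zero_coord]; simp [upperMat_val]
  · rw [vecMul_one_coord]; simp [upperMat_val]

theorem unitsToField_coe (u : (𝓞 F)ˣ) : ((unitsToField u : Fˣ) : F) = ((u : 𝓞 F) : F) := rfl

theorem unitsToField_inv_coe (u : (𝓞 F)ˣ) :
    (((unitsToField u)⁻¹ : Fˣ) : F) = (((u⁻¹ : (𝓞 F)ˣ) : 𝓞 F) : F) := by
  rw [← map_inv]; rfl

theorem triMat_val (u ε : (𝓞 F)ˣ) (ξ : F) : (triMat u ε ξ).1 =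
    !![((u : 𝓞 F) : F) * ((ε : 𝓞 F) : F), ξ; 0, (((u⁻¹ : (𝓞 F)ˣ) : 𝓞 F) : F)] := by
  rw [triMat, upperMat_val, unitsToField_inv_coe]
  rfl

theorem vecMul_triMat (u ε : (𝓞 F)ˣ) (ξ : F) (v : Fin 2 → F) :
    v ᵥ* (triMat u ε ξ).1 = ![((u : 𝓞 F) : F) * ((ε : 𝓞 F) : F) * v 0,
      ξ * v 0 + (((u⁻¹ : (𝓞 F)ˣ) : 𝓞 F) : F) * v 1] := by
  rw [triMat, vecMul_upperMat, unitsToField_inv_coe]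
  ext i
  fin_cases i
  · simp [unitsToField_coe]; ring
  · simp; ring

theorem det_val_eq (g : GL (Fin 2) F) : ((Matrix.GeneralLinearGroup.det g : Fˣ) : F) =
    g.1 0 0 * g.1 1 1 - g.1 0 1 * g.1 1 0 := by
  rw [Matrix.GeneralLinearGroup.val_det_apply, Matrix.det_fin_two]

theorem det_upperMat (p q : Fˣ) (ξ : F) : Matrix.GeneralLinearGroup.det (upperMat p q ξ) = p * q := by
  apply Units.ext
  rw [det_val_eq, upperMat_val]
  simp

theorem det_triMat (u ε : (𝓞 F)ˣ) (ξ : F) :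
    Matrix.GeneralLinearGroup.det (triMat u ε ξ) = unitsToField ε := by
  rw [triMat, det_upperMat, mul_comm, inv_mul_cancel_left]

theorem TZUQ_le_GDint (D : Subgroup Fˣ) : TZUQ D ≤ GDint D := by
  rintro _ ⟨u, ε, hε, ξ, rfl⟩
  rw [GDint, GD, Subgroup.mem_inf, Subgroup.mem_comap, Subgroup.mem_comap, det_triMat]
  exact ⟨hε.2, hε.1, ⟨ε, rfl⟩⟩

theorem triMat_mem {D : Subgroup Fˣ} (u : (𝓞 F)ˣ) {ε : (𝓞 F)ˣ} (hε : ε ∈ unitsDPlus D) (ξ : F) :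
    triMat u ε ξ ∈ TZUQ D := ⟨u, ε, hε, ξ, rfl⟩

theorem unip_eq_triMat (ξ : F) : unip ξ = triMat 1 1 ξ := by
  simp [unip, triMat]

theorem unip_mem_TZUQ (D : Subgroup Fˣ) (ξ : F) : unip ξ ∈ TZUQ D := by
  rw [unip_eq_triMat]; exact triMat_mem 1 (one_mem _) ξ

theorem GDint_le_GDplus (D : Subgroup Fˣ) : GDint D ≤ GDplus D := fun _ h => ⟨h.1, h.2.1⟩

theorem exists_det_unit {D : Subgroup Fˣ} {g : GL (Fin 2) F} (hg : g ∈ GDint D) :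
    ∃ ε ∈ unitsDPlus D, ((ε : 𝓞 F) : F) = g.1 0 0 * g.1 1 1 - g.1 0 1 * g.1 1 0 := by
  obtain ⟨ε, hε⟩ := hg.2.2
  refine ⟨ε, ⟨?_, ?_⟩, ?_⟩
  · change unitsToField ε ∈ totPos F
    rw [hε]; exact hg.2.1
  · change unitsToField ε ∈ D
    rw [hε]; exact hg.1
  · rw [← det_val_eq, ← hε]; rfl

/-- Division-free form of the action: the entries of the adjugate lie in known ideals, and a
determinant that is a unit can be cancelled afterwards. -/
theorem adj_vecMul (g : GL (Fin 2) F) (v : Fin 2 → F) :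
    (g.1 0 0 * g.1 1 1 - g.1 0 1 * g.1 1 0) • rowAct g v =
      ![v 0 * g.1 1 1 - v 1 * g.1 1 0, v 1 * g.1 0 0 - v 0 * g.1 0 1] := by
  set w := rowAct g v with hw
  have h : v = w ᵥ* g.1 := by rw [← rowAct_inv_apply, hw, rowAct_inv_rowAct]
  have h0 := congrFun h 0
  have h1 := congrFun h 1
  rw [vecMul_zero_coord] at h0
  rw [vecMul_one_coord] at h1
  apply vec_ext
  · simp only [Pi.smul_apply, smul_eq_mul, Matrix.cons_val_zero, h0, h1]; ring
  · simp only [Pi.smul_apply, smul_eq_mul, Matrix.cons_val_one, Matrix.cons_val_zero, h0, h1]; ring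

theorem smul_mem_prodLat_iff {p q : FracId F} (u : (𝓞 F)ˣ) (v : Fin 2 → F) :
    (((u : 𝓞 F) : F) • v) ∈ prodLat p q ↔ v ∈ prodLat p q := by
  change (((u : 𝓞 F) : F) * v 0 ∈ p.mod ∧ ((u : 𝓞 F) : F) * v 1 ∈ q.mod) ↔ _
  rw [unit_mul_mem_iff, unit_mul_mem_iff]
  rfl

theorem mem_prodLat {p q : FracId F} {v : Fin 2 → F} :
    v ∈ prodLat p q ↔ v 0 ∈ p.mod ∧ v 1 ∈ q.mod := Iff.rfl

/-- A normalized matrix carries `𝓞 ⊕ c^*` onto `b ⊕ (bc)^*`. -/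
theorem mem_baseLat_iff_normalized {D : Subgroup Fˣ} {c b : FracId F} {γ : GL (Fin 2) F}
    (hγ : γ ∈ GDint D) (hn : IsNormalized c b γ) (v : Fin 2 → F) :
    v ∈ baseLat c ↔ v ᵥ* γ.1 ∈ prodLat b (b * c).star := by
  obtain ⟨ha, hb, hc, hd⟩ := hn
  constructor
  · intro hv
    rw [mem_prodLat, vecMul_zero_coord, vecMul_one_coord]
    have h0 := hv.1
    have h1 := hv.2
    refine ⟨add_mem ?_ ?_, add_mem ?_ ?_⟩
    · simpa using mem_mod_mul h0 ha
    · have := mem_mod_mul h1 hc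
      have e : c.star * (b * c * diff F) = b := Additive.ofMul.injective (by
        simp only [FracId.star, ofMul_mul, ofMul_inv]; abel)
      rwa [e] at this
    · simpa using mem_mod_mul h0 hb
    · have := mem_mod_mul h1 hd
      have e : c.star * b⁻¹ = (b * c).star := Additive.ofMul.injective (by
        simp only [FracId.star, ofMul_mul, ofMul_inv]; abel)
      rwa [e] at this
  · intro hv
    -- For the converse the adjugate replaces the inverse. Its entries have the integrality needed
    -- to return to `𝓞 ⊕ c^*`, and the factor `ε` does not affect membership.
    obtain ⟨ε, -, hε⟩ := exists_det_unit hγ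
    have h := adj_vecMul γ (v ᵥ* γ.1)
    rw [← rowAct_inv_apply, rowAct_rowAct_inv, rowAct_inv_apply, ← hε] at h
    rw [baseLat, ← smul_mem_prodLat_iff ε, h, mem_prodLat]
    refine ⟨sub_mem ?_ ?_, sub_mem ?_ ?_⟩
    · have := mem_mod_mul hv.1 hd
      rwa [mul_inv_cancel] at this
    · have := mem_mod_mul hv.2 hc
      have e : (b * c).star * (b * c * diff F) = 1 := Additive.ofMul.injective (by
        simp only [FracId.star, ofMul_mul, ofMul_inv, ofMul_one]; abel)
      rwa [e] at this
    · have := mem_mod_mul hv.2 ha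
      have e : (b * c).star * b = c.star := Additive.ofMul.injective (by
        simp only [FracId.star, ofMul_mul, ofMul_inv]; abel)
      rwa [e] at this
    · have := mem_mod_mul hv.1 hb
      have e : b * (b * c).star = c.star := Additive.ofMul.injective (by
        simp only [FracId.star, ofMul_mul, ofMul_inv]; abel)
      rwa [e] at this

theorem mul_unip_entries (γ : GL (Fin 2) F) (ξ : F) :
    (γ * unip ξ).1 0 0 = γ.1 0 0 ∧ (γ * unip ξ).1 0 1 = γ.1 0 0 * ξ + γ.1 0 1 ∧
    (γ * unip ξ).1 1 0 = γ.1 1 0 ∧ (γ * unip ξ).1 1 1 = γ.1 1 0 * ξ + γ.1 1 1 := by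
  simp [unip, upperMat_val, Matrix.mul_apply]

/-- Every matrix is normalized by a unipotent matrix on the right. -/
theorem exists_unip_normalized {D : Subgroup Fˣ} {c b : FracId F} {γ : GL (Fin 2) F}
    (hγ : γ ∈ GDint D) (hb : (b : FractionalIdeal (𝓞 F)⁰ F) =
      prin (γ.1 0 0) + prin (γ.1 1 0) * (c.star : FractionalIdeal (𝓞 F)⁰ F)) :
    ∃ ξ : F, IsNormalized c b (γ * unip ξ) := by
  obtain ⟨ε, -, hε⟩ := exists_det_unit hγ
  -- Dividing the formula for `b` by `b` gives `1 = a p + c' q` with `p ∈ b⁻¹` and `q ∈ c^* b⁻¹`,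
  -- where `(a, c')` is the first column.
  have h1 : (1 : F) ∈ prin (γ.1 0 0) * ((b⁻¹ : FracId F) : FractionalIdeal (𝓞 F)⁰ F) +
      prin (γ.1 1 0) * ((c.star * b⁻¹ : FracId F) : FractionalIdeal (𝓞 F)⁰ F) := by
    rw [Units.val_mul, ← mul_assoc, ← add_mul, ← hb, ← Units.val_mul, mul_inv_cancel]
    exact mem_mod_one.2 ⟨1, map_one _⟩
  obtain ⟨_, h2, _, h3, h4⟩ := mem_add_iff.1 h1
  obtain ⟨p, hp, rfl⟩ := mem_prin_mul.1 h2
  obtain ⟨q, hq, rfl⟩ := mem_prin_mul.1 h3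
  -- This shear makes the second column `(-εq, εp)`, with `ε` the determinant, and these entries lie
  -- in the required ideals.
  refine ⟨-(γ.1 0 1 * p + γ.1 1 1 * q), ?_⟩
  obtain ⟨e0, e1, e2, e3⟩ := mul_unip_entries γ (-(γ.1 0 1 * p + γ.1 1 1 * q))
  unfold IsNormalized
  rw [e0, e1, e2, e3]
  refine ⟨?_, ?_, ?_, ?_⟩
  · rw [mem_mod, hb]
    exact le_add_left' _ _ (mem_prin_self _)
  · have : γ.1 0 0 * -(γ.1 0 1 * p + γ.1 1 1 * q) + γ.1 0 1 = -(((ε : 𝓞 F) : F) * q) := by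
      linear_combination q * hε - γ.1 0 1 * h4
    rw [this]
    have e : c.star * b⁻¹ = (b * c).star := Additive.ofMul.injective (by
        simp only [FracId.star, ofMul_mul, ofMul_inv]; abel)
    rw [← e]
    exact neg_mem (int_mul_mem (c.star * b⁻¹) _ hq)
  · have e : b * c * diff F = b * c.star⁻¹ := Additive.ofMul.injective (by
        simp only [FracId.star, ofMul_mul, ofMul_inv]; abel)
    rw [e, mem_mul_inv_iff]
    intro y hy
    rw [mem_mod, hb]
    exact le_add_right' _ _ (mem_prin_mul.2 ⟨y, hy, rfl⟩)
  · have : γ.1 1 0 * -(γ.1 0 1 * p + γ.1 1 1 * q) + γ.1 1 1 = ((ε : 𝓞 F) : F) * p := by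
      linear_combination (-p) * hε - γ.1 1 1 * h4
    rw [this]
    exact int_mul_mem b⁻¹ _ hp

/-! ### The auxiliary element `y₀` -/

section Aux

variable {c : FracId F} {n : Ideal (𝓞 F)} [NeZero n] {y₀ : F}

/-- If `n + y₀ c = 𝓞`, membership in `f` can be tested after multiplying by `n` and by `y₀ c`. -/
theorem mem_of_aux (hy₀ : (n : FractionalIdeal (𝓞 F)⁰ F) +
      FractionalIdeal.spanSingleton (𝓞 F)⁰ y₀ * (c : FractionalIdeal (𝓞 F)⁰ F) = 1)
    {f : FracId F} {z : F} (h1 : z ∈ ((ofIdeal n)⁻¹ * f).mod) (h2 : y₀ * z ∈ (c⁻¹ * f).mod) :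
    z ∈ f.mod := by
  have h : (1 : F) ∈ (n : FractionalIdeal (𝓞 F)⁰ F) + prin y₀ * (c : FractionalIdeal (𝓞 F)⁰ F) := by
    rw [hy₀]; exact mem_mod_one.2 ⟨1, map_one _⟩
  obtain ⟨ν, hν, _, h3, h4⟩ := mem_add_iff.1 h
  obtain ⟨κ, hκ, rfl⟩ := mem_prin_mul.1 h3
  have k1 : ν * z ∈ (ofIdeal n * ((ofIdeal n)⁻¹ * f)).mod := mem_mod_mul (f := ofIdeal n) hν h1
  have k2 := mem_mod_mul (f := c) hκ h2
  rw [mul_inv_cancel_left] at k1 k2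
  have := add_mem k1 k2
  convert this using 1
  linear_combination -z * h4

theorem aux_mem (hy₀ : (n : FractionalIdeal (𝓞 F)⁰ F) +
      FractionalIdeal.spanSingleton (𝓞 F)⁰ y₀ * (c : FractionalIdeal (𝓞 F)⁰ F) = 1) :
    y₀ ∈ (c⁻¹).mod := by
  have := mem_mul_inv (f := 1) (g := c) (x := y₀) fun y hy => by
    rw [mem_mod, Units.val_one, ← hy₀]
    exact le_add_right' _ _ (mem_prin_mul.2 ⟨y, hy, rfl⟩)
  rwa [one_mul] at this

theorem aux_mul_mem (hy₀ : (n : FractionalIdeal (𝓞 F)⁰ F) +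
      FractionalIdeal.spanSingleton (𝓞 F)⁰ y₀ * (c : FractionalIdeal (𝓞 F)⁰ F) = 1)
    {f : FracId F} {s : F} (hs : s ∈ f.mod) : y₀ * s ∈ (c⁻¹ * f).mod :=
  mem_mod_mul (aux_mem hy₀) hs

/-- For an element of `G^+(𝓞 ⊕ c^*)`, belonging to `Γ` means fixing the level structure. -/
theorem mem_Gam_iff (hy₀ : (n : FractionalIdeal (𝓞 F)⁰ F) +
      FractionalIdeal.spanSingleton (𝓞 F)⁰ y₀ * (c : FractionalIdeal (𝓞 F)⁰ F) = 1)
    {D : Subgroup Fˣ} {δ : GL (Fin 2) F} (hδ : δ ∈ Gplus D (baseLat c)) :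
    δ ∈ Gam D c n ↔ ∀ s ∈ divBy n (diff F)⁻¹.mod,
      (![0, y₀ * s] : Fin 2 → F) ᵥ* δ.1 - ![0, y₀ * s] ∈ baseLat c := by
  obtain ⟨-, -, hc, hd⟩ := Gplus_base_entries hδ
  have key : ∀ s, ((![0, y₀ * s] : Fin 2 → F) ᵥ* δ.1 - ![0, y₀ * s] ∈ baseLat c ↔
      y₀ * δ.1 1 0 * s ∈ (1 : FracId F).mod ∧ y₀ * (δ.1 1 1 - 1) * s ∈ c.star.mod) := by
    intro s
    rw [baseLat, mem_prodLat, Pi.sub_apply, Pi.sub_apply, vecMul_zero_coord, vecMul_one_coord]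
    simp only [Matrix.cons_val_zero, Matrix.cons_val_one, zero_mul, zero_add, sub_zero]
    rw [show y₀ * s * δ.1 1 0 = y₀ * δ.1 1 0 * s by ring,
      show y₀ * s * δ.1 1 1 - y₀ * s = y₀ * (δ.1 1 1 - 1) * s by ring]
  simp only [key, mem_divBy_mod]
  constructor
  · rintro ⟨-, h1, h2⟩ s hs
    constructor
    · have := mem_mod_mul (aux_mul_mem hy₀ h1) hs
      have e : c⁻¹ * (c * diff F * ofIdeal n) * ((ofIdeal n)⁻¹ * (diff F)⁻¹) = 1 :=
        Additive.ofMul.injective (by simp only [ofMul_mul, ofMul_inv, ofMul_one]; abel)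
      rwa [e] at this
    · have := mem_mod_mul (aux_mul_mem hy₀ h2) hs
      have e : c⁻¹ * ofIdeal n * ((ofIdeal n)⁻¹ * (diff F)⁻¹) = c.star :=
        Additive.ofMul.injective (by simp only [FracId.star, ofMul_mul, ofMul_inv]; abel)
      rwa [e] at this
  · intro h
    -- Both congruences follow from `mem_of_aux`. Up to a factor `n⁻¹` they are the integrality of
    -- the entries; after multiplication by `y₀` they are the fixing condition, imposed on all of
    -- `n⁻¹𝔡⁻¹` and hence a colon ideal.
    refine ⟨hδ, ?_, ?_⟩
    · apply mem_of_aux hy₀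
      · have e : (ofIdeal n)⁻¹ * (c * diff F * ofIdeal n) = c * diff F :=
          Additive.ofMul.injective (by simp only [ofMul_mul, ofMul_inv]; abel)
        rwa [e]
      · have := mem_mul_inv fun s hs => (h s hs).1
        have e : 1 * ((ofIdeal n)⁻¹ * (diff F)⁻¹)⁻¹ = c⁻¹ * (c * diff F * ofIdeal n) :=
          Additive.ofMul.injective (by simp only [ofMul_mul, ofMul_inv, ofMul_one]; abel)
        rwa [e] at this
    · apply mem_of_aux hy₀
      · rw [inv_mul_cancel]
        exact sub_mem hd (mem_mod_one.2 ⟨1, map_one _⟩)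
      · have := mem_mul_inv fun s hs => (h s hs).2
        have e : c.star * ((ofIdeal n)⁻¹ * (diff F)⁻¹)⁻¹ = c⁻¹ * ofIdeal n :=
          Additive.ofMul.injective (by simp only [FracId.star, ofMul_mul, ofMul_inv]; abel)
        rwa [e] at this

end Aux

end Transforms

/-! ### Standard tuples and the isomorphisms between them -/

section Data

variable {F : Type*} [Field F] [NumberField F]

theorem Tors.mk_eq_mk_iff {V : Type*} [AddCommGroup V] [Module (𝓞 F) V] {n : Ideal (𝓞 F)}
    {M : Submodule (𝓞 F) V} {v w : divBy n M} : Tors.mk v = Tors.mk w ↔ v.1 - w.1 ∈ M :=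
  Submodule.Quotient.eq _

theorem Tors.mk_eq_zero_iff {V : Type*} [AddCommGroup V] [Module (𝓞 F) V] {n : Ideal (𝓞 F)}
    {M : Submodule (𝓞 F) V} {v : divBy n M} : Tors.mk v = 0 ↔ v.1 ∈ M :=
  Submodule.Quotient.mk_eq_zero _

theorem Tors.exists_mk {V : Type*} [AddCommGroup V] [Module (𝓞 F) V] {n : Ideal (𝓞 F)}
    {M : Submodule (𝓞 F) V} (w : Tors n M) : ∃ v : divBy n M, w = Tors.mk v := by
  obtain ⟨v, hv⟩ := Submodule.Quotient.mk_surjective _ w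
  exact ⟨v, hv.symm⟩

theorem le_divBy {V : Type*} [AddCommGroup V] [Module (𝓞 F) V] (n : Ideal (𝓞 F))
    (M : Submodule (𝓞 F) V) : M ≤ divBy n M := fun _ hv s _ => M.smul_mem s hv

namespace CuspDatum

variable {c : FracId F}

/-- Both `a^* a` and `c^* c` are the inverse different, so `star_mul` can be solved for `a`.
Comparing two cusps then only requires matching `b`. -/
theorem a_eq (x : CuspDatum c) : x.a = x.b * c := by
  have h := x.star_mul
  have e2 : c.star * c = (diff F)⁻¹ := Additive.ofMul.injective (by
    simp only [FracId.star, ofMul_mul, ofMul_inv]; abel)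
  have e3 : x.a.star * x.a = (diff F)⁻¹ := Additive.ofMul.injective (by
    simp only [FracId.star, ofMul_mul, ofMul_inv]; abel)
  have : x.a.star * x.a = x.a.star * (x.b * c) := by rw [e3, ← e2, ← h, mul_assoc]
  exact mul_left_cancel this

theorem a_star_eq (x : CuspDatum c) : x.a.star = (x.b * c).star := by rw [a_eq]

theorem mem_b_iff (x : CuspDatum c) (y : F) : y ∈ x.b.mod ↔ ∃ v ∈ x.L, x.j v = y :=
  ⟨x.j_surj y, by rintro ⟨v, hv, rfl⟩; exact x.j_mem v hv⟩

/-- An `F`-linear map out of `F` is injective as soon as one value is nonzero, so injectivity on the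
ideal `a^*` extends to all of `F`. -/
theorem i_injective (x : CuspDatum c) : Function.Injective x.i := by
  obtain ⟨y, hy, h0⟩ := mod_ne_bot x.a.star
  have hi : ∀ z, x.i z = z • x.i 1 := fun z => by rw [← map_smul, smul_eq_mul, mul_one]
  have h1 : x.i 1 ≠ 0 := fun h => h0 (x.i_inj y hy (by rw [hi, h, smul_zero]))
  intro z w h
  rw [hi z, hi w] at h
  exact smul_left_injective F h1 h

theorem j_comp_i (x : CuspDatum c) (z : F) : x.j (x.i z) = 0 := by
  obtain ⟨y, hy, h0⟩ := mod_ne_bot x.a.star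
  have h := (x.exact _ (x.i_mem y hy)).2 ⟨y, hy, rfl⟩
  have e : z = (z * y⁻¹) • y := by rw [smul_eq_mul, inv_mul_cancel_right₀ h0]
  rw [e, map_smul, map_smul, h, smul_zero]

theorem i_mem_iff (x : CuspDatum c) (y : F) : x.i y ∈ x.L ↔ y ∈ x.a.star.mod := by
  refine ⟨fun h => ?_, x.i_mem y⟩
  obtain ⟨y', hy', h'⟩ := (x.exact _ h).1 (x.j_comp_i y)
  rwa [← x.i_injective h']

/-- An `𝓞`-linear section of `j`. -/
theorem exists_section (x : CuspDatum c) : ∃ σ : Fin 2 → F, x.j σ = 1 ∧ ∀ y ∈ x.b.mod, y • σ ∈ x.L := by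
  have h1 : (1 : F) ∈ ((x.b⁻¹ * x.b : FracId F) : FractionalIdeal (𝓞 F)⁰ F) := by
    rw [inv_mul_cancel]; exact mem_mod_one.2 ⟨1, map_one _⟩
  rw [Units.val_mul] at h1
  -- Projectivity of `b`: write `1` as a sum of products `pz` with `p ∈ b⁻¹`, `z ∈ b`. A lift of `z`
  -- multiplied by `p` is a partial section, and these add up to a section.
  refine FractionalIdeal.mul_induction_on h1
    (C := fun z => ∃ σ : Fin 2 → F, x.j σ = z ∧ ∀ y ∈ x.b.mod, y • σ ∈ x.L) ?_ ?_
  · intro p hp z hz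
    obtain ⟨v, hv, rfl⟩ := x.j_surj z hz
    refine ⟨p • v, by rw [map_smul, smul_eq_mul], fun y hy => ?_⟩
    have : y * p ∈ (x.b * x.b⁻¹).mod := mem_mod_mul hy hp
    rw [mul_inv_cancel] at this
    obtain ⟨s, hs⟩ := mem_mod_one.1 this
    rw [smul_smul, ← hs]
    have := x.L.smul_mem s hv
    rwa [← algebraMap_smul F s v] at this
  · rintro _ _ ⟨σ, rfl, hσ⟩ ⟨τ, rfl, hτ⟩
    refine ⟨σ + τ, map_add _ _ _, fun y hy => ?_⟩
    rw [smul_add]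
    exact add_mem (hσ y hy) (hτ y hy)

theorem IsStandard.mem_a_star {x : CuspDatum c} (h : x.IsStandard) (y : F) :
    y ∈ x.a.star.mod ↔ ![0, y] ∈ x.L := by rw [← h.1, i_mem_iff]

theorem IsStandard.mem_b {x : CuspDatum c} (h : x.IsStandard) (y : F) :
    y ∈ x.b.mod ↔ ∃ v ∈ x.L, v 0 = y := by
  rw [mem_b_iff]
  simp only [h.2.1]

/-- The standard sextuple on a lattice. -/
def std (c b : FracId F) (L : Submodule (𝓞 F) (Fin 2 → F)) (ξ : F)
    (hL : ∀ v, v ∈ L ↔ v ᵥ* (unip ξ).1 ∈ prodLat b (b * c).star)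
    (lam : ⋀[𝓞 F]^2 L ≃ₗ[𝓞 F] c.star.mod) (lat : Submodule.IsLattice F L) : CuspDatum c where
  a := b * c
  b := b
  star_mul := Additive.ofMul.injective (by simp only [FracId.star, ofMul_mul, ofMul_inv]; abel)
  L := L
  isLattice := lat
  i := LinearMap.pi ![0, LinearMap.id]
  j := LinearMap.proj 0
  i_mem y hy := by
    rw [hL, unip, vecMul_upperMat, mem_prodLat]
    simpa using hy
  i_inj y _ h := by simpa using congrFun h 1
  exact v hv := by
    rw [hL, unip, vecMul_upperMat, mem_prodLat] at hv
    constructor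
    · intro h
      replace h : v 0 = 0 := h
      refine ⟨v 1, by simpa [h] using hv.2, vec_ext ?_ ?_⟩
      · simp [h]
      · simp
    · rintro ⟨y, -, rfl⟩
      simp
  j_mem v hv := by
    rw [hL, unip, vecMul_upperMat, mem_prodLat] at hv
    simpa using hv.1
  j_surj y hy := ⟨![y, -(y * ξ)], by
    rw [hL, unip, vecMul_upperMat, mem_prodLat]
    simpa using hy, by simp⟩
  lam := lam

end CuspDatum

theorem fracId_fg (p : FracId F) : p.mod.FG := FractionalIdeal.fg_unit p

theorem prodLat_isLattice (p q : FracId F) : Submodule.IsLattice F (prodLat p q) where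
  fg := by
    have e : prodLat p q = p.mod.map (LinearMap.single (𝓞 F) (fun _ : Fin 2 => F) 0) ⊔
        q.mod.map (LinearMap.single (𝓞 F) (fun _ : Fin 2 => F) 1) := by
      ext v
      rw [Submodule.mem_sup]
      constructor
      · intro hv
        refine ⟨_, ⟨v 0, hv.1, rfl⟩, _, ⟨v 1, hv.2, rfl⟩, vec_ext ?_ ?_⟩ <;> simp
      · rintro ⟨_, ⟨x, hx, rfl⟩, _, ⟨y, hy, rfl⟩, rfl⟩
        exact ⟨by simpa using hx, by simpa using hy⟩
    rw [e]
    exact ((fracId_fg p).map _).sup ((fracId_fg q).map _)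
  span_eq_top := by
    rw [eq_top_iff]
    intro v _
    obtain ⟨x, hx, hx0⟩ := mod_ne_bot p
    obtain ⟨y, hy, hy0⟩ := mod_ne_bot q
    have e : v = (v 0 * x⁻¹) • ![x, 0] + (v 1 * y⁻¹) • ![0, y] := by
      apply vec_ext <;> simp [hx0, hy0]
    rw [e]
    refine add_mem (Submodule.smul_mem _ _ (Submodule.subset_span ?_))
      (Submodule.smul_mem _ _ (Submodule.subset_span ?_))
    · exact ⟨hx, q.mod.zero_mem⟩
    · exact ⟨p.mod.zero_mem, hy⟩

theorem isLattice_of_latIso {L M : Submodule (𝓞 F) (Fin 2 → F)} (f : LatIso L M)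
    (h : Submodule.IsLattice F M) : Submodule.IsLattice F L where
  fg := by
    have e : L = M.map (f.toEquiv.symm.toLinearMap.restrictScalars (𝓞 F)) := by
      ext v
      constructor
      · intro hv
        exact ⟨f.toEquiv v, (f.mem_iff v).1 hv, f.toEquiv.symm_apply_apply v⟩
      · rintro ⟨w, hw, rfl⟩
        rw [f.mem_iff]
        change f.toEquiv (f.toEquiv.symm w) ∈ M
        rwa [f.toEquiv.apply_symm_apply]
    rw [e]
    exact h.fg.map _
  span_eq_top := by
    have e : (L : Set (Fin 2 → F)) = f.toEquiv.symm.toLinearMap '' M := by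
      ext v
      constructor
      · intro hv
        exact ⟨f.toEquiv v, (f.mem_iff v).1 hv, f.toEquiv.symm_apply_apply v⟩
      · rintro ⟨w, hw, rfl⟩
        rw [SetLike.mem_coe, f.mem_iff]
        change f.toEquiv (f.toEquiv.symm w) ∈ M
        rwa [f.toEquiv.apply_symm_apply]
    rw [e, Submodule.span_image, h.span_eq_top, Submodule.map_top, LinearEquiv.range]

/-- A sheared direct sum carries a standard sextuple. -/
theorem exists_std (c b : FracId F) (L : Submodule (𝓞 F) (Fin 2 → F)) (ξ : F)
    (hL : ∀ v, v ∈ L ↔ v ᵥ* (unip ξ).1 ∈ prodLat b (b * c).star) :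
    ∃ lam lat, (CuspDatum.std c b L ξ hL lam lat).IsStandard := by
  let f : LatIso L (prodLat b (b * c).star) := ⟨rowAct (unip ξ)⁻¹, fun v => by
    rw [hL, rowAct_inv_apply]⟩
  have hf : ∀ v, f.toEquiv v = v ᵥ* (unip ξ).1 := fun v => rowAct_inv_apply _ v
  obtain ⟨lam, hlam⟩ := exists_lam (c' := c.star) (Additive.ofMul.injective (by
    simp only [FracId.star, ofMul_mul, ofMul_inv]; abel)) f (fun v w => by
    rw [hf, hf, unip, vecMul_upperMat, vecMul_upperMat]
    simp
    ring)
  refine ⟨lam, isLattice_of_latIso f (prodLat_isLattice _ _), fun y => ?_, fun v => rfl, hlam⟩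
  apply vec_ext
  · simp [CuspDatum.std]
  · simp [CuspDatum.std]

theorem latIso_unit' {f g : FracId F} (h : f = g) (q : LatIso f.mod g.mod) :
    ∃ u : (𝓞 F)ˣ, ∀ x, q.toEquiv x = ((u : 𝓞 F) : F) * x := by
  subst h; exact latIso_unit q

theorem exists_unitLatIso {f g : FracId F} (h : f = g) (u : (𝓞 F)ˣ) :
    ∃ q : LatIso f.mod g.mod, ∀ x, q.toEquiv x = ((u : 𝓞 F) : F) * x := by
  subst h; exact ⟨unitLatIso f u, unitLatIso_apply f u⟩

theorem linear_two (f : (Fin 2 → F) →ₗ[F] (Fin 2 → F)) (v : Fin 2 → F) :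
    f v = v 0 • f ![1, 0] + f ![0, v 1] := by
  rw [← map_smul, ← map_add]
  congr 1
  apply vec_ext <;> simp

/-- Between standard sextuples, the isomorphisms of cusps are the matrices of `T_ℤ U_ℚ`. -/
theorem compat_iff {D : Subgroup Fˣ} {c : FracId F} {x x' : CuspDatum c} (hx : x.IsStandard)
    (hx' : x'.IsStandard) (ha : x.a = x'.a) (hb : x.b = x'.b) (f : LatIso x.L x'.L) :
    x.Compat D x' f ↔ ∃ (u : (𝓞 F)ˣ), ∃ ε ∈ unitsDPlus D, ∃ ξ : F,
      ∀ v, f.toEquiv v = v ᵥ* (triMat u ε ξ).1 := by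
  constructor
  · rintro ⟨⟨q, hq⟩, ⟨p, hp⟩, ε, hε, hl⟩
    obtain ⟨u, hu⟩ := latIso_unit' (by rw [ha]) q
    obtain ⟨w, hw⟩ := latIso_unit' hb p
    have e0 : ∀ v, (f.toEquiv v) 0 = ((w : 𝓞 F) : F) * v 0 := fun v => by
      have := hp v
      rwa [hx'.2.1, hx.2.1, hw] at this
    have e1 : ∀ v, (f.toEquiv v) 1 = (f.toEquiv ![1, 0]) 1 * v 0 + ((u : 𝓞 F) : F) * v 1 := by
      intro v
      have := linear_two f.toEquiv.toLinearMap v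
      simp only [LinearEquiv.coe_coe] at this
      rw [this, ← hx.1, hq, hu, hx'.1]
      simp
      ring
    -- The compatibility with `lam` is evaluated at `v ∧ i(y)` with `v₀y ≠ 0`. There it reads off
    -- the determinant of the triangular matrix of `f`.
    have hdet : ((w : 𝓞 F) : F) * ((u : 𝓞 F) : F) = ((ε : 𝓞 F) : F) := by
      obtain ⟨y, hy, hy0⟩ := mod_ne_bot x.a.star
      obtain ⟨z, hz, hz0⟩ := mod_ne_bot x.b
      obtain ⟨v, hv, rfl⟩ := (hx.mem_b z).1 hz
      have hy' := (hx.mem_a_star y).1 hy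
      have := congrArg (fun t : c.star.mod => (t : F))
        (hl (exteriorPower.ιMulti (𝓞 F) 2 ![⟨v, hv⟩, ⟨_, hy'⟩]))
      simp only [map_wedge, hx'.2.2, Submodule.coe_smul, hx.2.2, smul_eq_coe_mul] at this
      change (f.toEquiv v) 0 * (f.toEquiv ![0, y]) 1 - (f.toEquiv v) 1 * (f.toEquiv ![0, y]) 0
        = _ at this
      rw [e0, e0, e1, e1] at this
      simp only [Matrix.cons_val_zero, Matrix.cons_val_one] at this
      have hne : v 0 * y ≠ 0 := mul_ne_zero hz0 hy0
      apply mul_right_cancel₀ hne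
      linear_combination this
    -- Here `u` is the action on `a^*`, that is, the lower right entry, which `triMat` records as
    -- the inverse of its first parameter.
    refine ⟨u⁻¹, ε, hε, (f.toEquiv ![1, 0]) 1, fun v => ?_⟩
    rw [vecMul_triMat, inv_inv]
    apply vec_ext
    · rw [e0]
      simp only [Matrix.cons_val_zero]
      rw [← hdet]
      linear_combination (-((w : 𝓞 F) : F) * v 0) * unit_mul_inv_coe u
    · rw [e1]
      simp
  · rintro ⟨u, ε, hε, ξ, hf⟩
    have hf' : ∀ v, f.toEquiv v = _ := fun v => (hf v).trans (vecMul_triMat u ε ξ v)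
    obtain ⟨q, hq⟩ := exists_unitLatIso (f := x.a.star) (g := x'.a.star) (by rw [ha]) u⁻¹
    obtain ⟨p, hp⟩ := exists_unitLatIso hb (u * ε)
    refine ⟨⟨q, fun y => ?_⟩, ⟨p, fun v => ?_⟩, ε, hε, fun w => ?_⟩
    · rw [hf', hx.1, hx'.1, hq]
      apply vec_ext <;> simp
    · rw [hx'.2.1, hp, hx.2.1, hf']
      simp
    · have : x'.lam.toLinearMap ∘ₗ exteriorPower.map 2 f.onLat = (ε : 𝓞 F) • x.lam.toLinearMap := by
        apply exterior_two_ext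
        intro v w
        apply Subtype.ext
        rw [LinearMap.comp_apply, map_wedge, LinearEquiv.coe_coe, hx'.2.2, LinearMap.smul_apply,
          Submodule.coe_smul, LinearEquiv.coe_coe, hx.2.2, smul_eq_coe_mul]
        change (f.toEquiv v.1) 0 * (f.toEquiv w.1) 1 - (f.toEquiv v.1) 1 * (f.toEquiv w.1) 0 = _
        rw [hf', hf']
        simp only [Matrix.cons_val_zero, Matrix.cons_val_one]
        linear_combination ((ε : 𝓞 F) : F) * (v.1 0 * w.1 1 - v.1 1 * w.1 0) * unit_mul_inv_coe u
      exact LinearMap.congr_fun this w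

end Data

/-! ### Splittings, transforms of the base datum and double cosets -/

section TransformData

variable {F : Type*} [Field F] [NumberField F]

theorem LatIso.onTors_mk {V W : Type*} [AddCommGroup V] [Module F V] [Module (𝓞 F) V]
    [IsScalarTower (𝓞 F) F V] [AddCommGroup W] [Module F W] [Module (𝓞 F) W]
    [IsScalarTower (𝓞 F) F W] {M : Submodule (𝓞 F) V} {N : Submodule (𝓞 F) W} (n : Ideal (𝓞 F))
    (f : LatIso M N) (v : divBy n M) : f.onTors n (Tors.mk v) =
      Tors.mk ⟨f.toEquiv v.1, divBy_map n f.toEquiv.toLinearMap (fun v hv => (f.mem_iff v).1 hv) _ v.2⟩ :=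
  rfl

theorem torsMap_mk {V W : Type*} [AddCommGroup V] [Module F V] [Module (𝓞 F) V]
    [IsScalarTower (𝓞 F) F V] [AddCommGroup W] [Module F W] [Module (𝓞 F) W]
    [IsScalarTower (𝓞 F) F W] {M : Submodule (𝓞 F) V} {N : Submodule (𝓞 F) W} (n : Ideal (𝓞 F))
    (f : V →ₗ[F] W) (hf : ∀ v ∈ M, f v ∈ N) (v : divBy n M) :
    torsMap n f hf (Tors.mk v) = Tors.mk ⟨f v.1, divBy_map n f hf _ v.2⟩ := rfl

theorem torsMap_injective {V W : Type*} [AddCommGroup V] [Module F V] [Module (𝓞 F) V]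
    [IsScalarTower (𝓞 F) F V] [AddCommGroup W] [Module F W] [Module (𝓞 F) W]
    [IsScalarTower (𝓞 F) F W] {M : Submodule (𝓞 F) V} {N : Submodule (𝓞 F) W} (n : Ideal (𝓞 F))
    (f : V →ₗ[F] W) (hf : ∀ v ∈ M, f v ∈ N) (h : ∀ v ∈ divBy n M, f v ∈ N → v ∈ M) :
    Function.Injective (torsMap n f hf) := by
  rw [← LinearMap.ker_eq_bot, LinearMap.ker_eq_bot']
  intro t ht
  obtain ⟨v, rfl⟩ := Tors.exists_mk t
  rw [torsMap_mk, Tors.mk_eq_zero_iff] at ht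
  exact Tors.mk_eq_zero_iff.2 (h v.1 v.2 ht)

theorem LatIso.onTors_injective {V W : Type*} [AddCommGroup V] [Module F V] [Module (𝓞 F) V]
    [IsScalarTower (𝓞 F) F V] [AddCommGroup W] [Module F W] [Module (𝓞 F) W]
    [IsScalarTower (𝓞 F) F W] {M : Submodule (𝓞 F) V} {N : Submodule (𝓞 F) W} (n : Ideal (𝓞 F))
    (f : LatIso M N) : Function.Injective (f.onTors n) :=
  torsMap_injective n _ _ (fun v _ h => (f.mem_iff v).2 h)

variable {c : FracId F} {n : Ideal (𝓞 F)}

theorem vecMul_unip_zero (v : Fin 2 → F) : v ᵥ* (unip (0 : F)).1 = v := by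
  rw [unip, vecMul_upperMat]
  apply vec_ext <;> simp

/-- Multiplication of the first coordinate by a unit. -/
def scaleFst (p q : FracId F) (u : (𝓞 F)ˣ) : LatIso (prodLat p q) (prodLat p q) where
  toEquiv := rowAct (upperMat (unitsToField u) 1 0)⁻¹
  mem_iff v := by
    rw [rowAct_inv_apply, vecMul_upperMat, mem_prodLat, mem_prodLat, unitsToField_coe]
    simp only [Matrix.cons_val_zero, Matrix.cons_val_one, mul_zero, zero_add, Units.val_one, mul_one]
    rw [mul_comm, unit_mul_mem_iff]

theorem scaleFst_apply (p q : FracId F) (u : (𝓞 F)ˣ) (v : Fin 2 → F) :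
    (scaleFst p q u).toEquiv v = ![((u : 𝓞 F) : F) * v 0, v 1] := by
  change rowAct (upperMat (unitsToField u) 1 0)⁻¹ v = _
  rw [rowAct_inv_apply, vecMul_upperMat, unitsToField_coe]
  apply vec_ext
  · simp [mul_comm]
  · simp

/-- A splitting of the exact sequence of a sextuple. -/
theorem exists_splitting (x : CuspDatum c) : ∃ f : LatIso x.L (prodLat x.b (x.b * c).star),
    (∀ v, f.toEquiv v 0 = x.j v) ∧ ∀ y, f.toEquiv (x.i y) = ![0, y] := by
  obtain ⟨σ, hσ, hb⟩ := x.exists_section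
  -- The inverse of the splitting is explicit in terms of a section and `i`; it is an equivalence
  -- because an injective endomorphism of `F²` is bijective.
  let G : (Fin 2 → F) →ₗ[F] (Fin 2 → F) :=
    (LinearMap.proj 0).smulRight σ + x.i ∘ₗ LinearMap.proj 1
  have hG : ∀ w, G w = w 0 • σ + x.i (w 1) := fun w => rfl
  have hjG : ∀ w, x.j (G w) = w 0 := fun w => by
    rw [hG, map_add, map_smul, hσ, x.j_comp_i]; simp
  have hinj : Function.Injective G := by
    intro v w h
    have h0 : v 0 = w 0 := by rw [← hjG v, h, hjG]
    rw [hG, hG, h0, add_right_inj] at h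
    exact vec_ext h0 (x.i_injective h)
  let e := LinearEquiv.ofInjectiveEndo G hinj
  have he : ∀ w, e w = G w := fun w => rfl
  have hmem : ∀ w, e w ∈ x.L ↔ w ∈ prodLat x.b (x.b * c).star := by
    intro w
    rw [he]
    constructor
    · intro h
      have h0 : w 0 ∈ x.b.mod := by rw [← hjG w]; exact x.j_mem _ h
      refine ⟨h0, ?_⟩
      rw [← x.a_star_eq, ← x.i_mem_iff]
      have := sub_mem h (hb _ h0)
      rwa [hG, add_sub_cancel_left] at this
    · rintro ⟨h0, h1⟩
      rw [hG]
      rw [← x.a_star_eq] at h1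
      exact add_mem (hb _ h0) (x.i_mem _ h1)
  refine ⟨⟨e.symm, fun v => by rw [← hmem, e.apply_symm_apply]⟩, fun v => ?_, fun y => ?_⟩
  · have := hjG (e.symm v)
    rw [← he, e.apply_symm_apply] at this
    exact this.symm
  · change e.symm (x.i y) = _
    rw [LinearEquiv.symm_apply_eq, he, hG]
    simp

/-- Every cusp is represented by a standard sextuple on `b ⊕ (bc)^*`. -/
theorem exists_std_equiv (D : Subgroup Fˣ) (x : LevelDatum c n) : ∃ x' : LevelDatum c n,
    LevelDatum.CuspEquiv D x x' ∧ x'.toCuspDatum.IsStandard ∧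
      x'.L = prodLat x.b (x.b * c).star := by
  obtain ⟨f, hf0, hf1⟩ := exists_splitting x.toCuspDatum
  obtain ⟨lam, lat, hstd⟩ := exists_std c x.b (prodLat x.b (x.b * c).star) 0
    (fun v => by rw [vecMul_unip_zero])
  set s := CuspDatum.std c x.b (prodLat x.b (x.b * c).star) 0 (fun v => by rw [vecMul_unip_zero])
    lam lat with hs
  -- The transported `lam` and the determinant differ by an automorphism of `c^*`, hence by a unit
  -- `u`. It need not be totally positive nor lie in `D`, so it is removed by scaling the first
  -- coordinate by `u⁻¹`, which only changes the identification with `b`.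
  obtain ⟨u, hu⟩ := exists_unit_of_linearEquiv c.star (x.lam.symm.trans ((extEquiv f).trans lam))
  have hu' : ∀ w, lam (exteriorPower.map 2 f.onLat w) = (u : 𝓞 F) • x.lam w := fun w => by
    rw [← hu, LinearEquiv.trans_apply, LinearEquiv.trans_apply, LinearEquiv.symm_apply_apply,
      extEquiv_apply]
  let g := f.trans (scaleFst x.b (x.b * c).star u⁻¹)
  have hg : ∀ v, g.toEquiv v = ![(((u⁻¹ : (𝓞 F)ˣ) : 𝓞 F) : F) * f.toEquiv v 0, f.toEquiv v 1] :=
    fun v => scaleFst_apply x.b (x.b * c).star u⁻¹ (f.toEquiv v)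
  let β : Tors n (diff F)⁻¹.mod →ₗ[𝓞 F] Tors n s.L := g.onTors n ∘ₗ x.β
  have hβ : Function.Injective β := (g.onTors_injective n).comp x.β_inj
  refine ⟨⟨s, β, hβ⟩, ⟨x.a_eq, rfl, g, ⟨?_, ?_, 1, one_mem _, ?_⟩, fun t => rfl⟩, hstd, rfl⟩
  · obtain ⟨q, hq⟩ := exists_unitLatIso x.a_star_eq 1
    refine ⟨q, fun y => ?_⟩
    rw [hg, hf1]
    refine Eq.trans ?_ (hstd.1 _).symm
    rw [hq]
    simp
  · obtain ⟨p, hp⟩ := exists_unitLatIso (rfl : x.b = x.b) u⁻¹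
    refine ⟨p, fun v => ?_⟩
    refine (hstd.2.1 _).trans ?_
    rw [hp, hg, hf0]
    simp
  · intro w
    have h1 : lam.toLinearMap ∘ₗ exteriorPower.map 2 (scaleFst x.b (x.b * c).star u⁻¹).onLat =
        ((u⁻¹ : (𝓞 F)ˣ) : 𝓞 F) • lam.toLinearMap := by
      apply exterior_two_ext
      intro v w
      apply Subtype.ext
      rw [LinearMap.comp_apply, map_wedge, LinearMap.smul_apply, Submodule.coe_smul, smul_eq_coe_mul]
      refine (hstd.2.2 _ _).trans ?_
      refine Eq.trans ?_ (congrArg _ (hstd.2.2 _ _).symm)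
      change ((scaleFst x.b (x.b * c).star u⁻¹).toEquiv v.1) 0 *
        ((scaleFst x.b (x.b * c).star u⁻¹).toEquiv w.1) 1 -
        ((scaleFst x.b (x.b * c).star u⁻¹).toEquiv v.1) 1 *
        ((scaleFst x.b (x.b * c).star u⁻¹).toEquiv w.1) 0 = _
      rw [scaleFst_apply, scaleFst_apply]
      simp only [Matrix.cons_val_zero, Matrix.cons_val_one]
      ring
    have h2 : exteriorPower.map 2 g.onLat w = exteriorPower.map 2
        (scaleFst x.b (x.b * c).star u⁻¹).onLat (exteriorPower.map 2 f.onLat w) := by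
      rw [← LinearMap.comp_apply, ← exteriorPower.map_comp]; rfl
    change lam (exteriorPower.map 2 g.onLat w) = _
    rw [h2]
    refine (LinearMap.congr_fun h1 _).trans ?_
    rw [LinearMap.smul_apply, LinearEquiv.coe_coe, hu', smul_smul, ← Units.val_mul, inv_mul_cancel]

variable [NeZero n] {y₀ : F}

/-- The map `t ↦ g · (0, y₀ t)`. -/
def levelMap (y₀ : F) (g : GL (Fin 2) F) : F →ₗ[F] (Fin 2 → F) :=
  (rowAct g).toLinearMap ∘ₗ LinearMap.pi ![0, LinearMap.lsmul F F y₀]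

theorem levelMap_apply (y₀ : F) (g : GL (Fin 2) F) (t : F) :
    levelMap y₀ g t = rowAct g ![0, y₀ * t] := by
  change rowAct g _ = _
  congr 1
  apply vec_ext <;> simp

theorem aux_vec_mem_iff (hy₀ : (n : FractionalIdeal (𝓞 F)⁰ F) +
      FractionalIdeal.spanSingleton (𝓞 F)⁰ y₀ * (c : FractionalIdeal (𝓞 F)⁰ F) = 1) {t : F}
    (ht : t ∈ divBy n (diff F)⁻¹.mod) :
    (![0, y₀ * t] : Fin 2 → F) ∈ baseLat c ↔ t ∈ (diff F)⁻¹.mod := by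
  rw [baseLat, mem_prodLat]
  simp only [Matrix.cons_val_zero, Matrix.cons_val_one]
  constructor
  · rintro ⟨-, h⟩
    exact mem_of_aux hy₀ (mem_divBy_mod.1 ht) h
  · intro h
    exact ⟨Submodule.zero_mem _, aux_mul_mem hy₀ h⟩

theorem levelMap_mem (hy₀ : (n : FractionalIdeal (𝓞 F)⁰ F) +
      FractionalIdeal.spanSingleton (𝓞 F)⁰ y₀ * (c : FractionalIdeal (𝓞 F)⁰ F) = 1)
    {g : GL (Fin 2) F} {L : Submodule (𝓞 F) (Fin 2 → F)}
    (hL : ∀ v, v ∈ baseLat c ↔ rowAct g v ∈ L) : ∀ t ∈ (diff F)⁻¹.mod, levelMap y₀ g t ∈ L := by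
  intro t ht
  rw [levelMap_apply, ← hL]
  exact (aux_vec_mem_iff hy₀ (le_divBy n _ ht)).2 ht

theorem levelMap_tors_injective (hy₀ : (n : FractionalIdeal (𝓞 F)⁰ F) +
      FractionalIdeal.spanSingleton (𝓞 F)⁰ y₀ * (c : FractionalIdeal (𝓞 F)⁰ F) = 1)
    {g : GL (Fin 2) F} {L : Submodule (𝓞 F) (Fin 2 → F)}
    (hL : ∀ v, v ∈ baseLat c ↔ rowAct g v ∈ L) :
    Function.Injective (torsMap n (levelMap y₀ g) (levelMap_mem hy₀ hL)) := by
  apply torsMap_injective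
  intro t ht h
  rw [levelMap_apply, ← hL] at h
  exact (aux_vec_mem_iff hy₀ ht).1 h

theorem isTransform_iff (hy₀ : (n : FractionalIdeal (𝓞 F)⁰ F) +
      FractionalIdeal.spanSingleton (𝓞 F)⁰ y₀ * (c : FractionalIdeal (𝓞 F)⁰ F) = 1)
    {g : GL (Fin 2) F} (x : LevelDatum c n) : x.IsTransform y₀ g ↔ x.toCuspDatum.IsStandard ∧
      ∃ hL : ∀ v, v ∈ baseLat c ↔ rowAct g v ∈ x.L,
        x.β = torsMap n (levelMap y₀ g) (levelMap_mem hy₀ hL) := by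
  constructor
  · rintro ⟨h1, h2, h3⟩
    refine ⟨h1, h2, LinearMap.ext fun t => ?_⟩
    obtain ⟨t, rfl⟩ := Tors.exists_mk t
    obtain ⟨v, hv, h⟩ := h3 t
    rw [h, torsMap_mk, Tors.mk_eq_mk_iff, hv]
    simp only [levelMap_apply, sub_self]
    exact zero_mem _
  · rintro ⟨h1, h2, h3⟩
    refine ⟨h1, h2, fun t => ⟨⟨levelMap y₀ g t, divBy_map n _ (levelMap_mem hy₀ h2) _ t.2⟩,
      levelMap_apply _ _ _, ?_⟩⟩
    rw [h3, torsMap_mk]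

/-- The ideal `a 𝓞 + c' c^*` attached to a matrix with first column `(a, c')`. -/
theorem exists_colIdeal (c : FracId F) (γ : GL (Fin 2) F) : ∃ b : FracId F,
    (b : FractionalIdeal (𝓞 F)⁰ F) =
      prin (γ.1 0 0) + prin (γ.1 1 0) * (c.star : FractionalIdeal (𝓞 F)⁰ F) := by
  refine ⟨Units.mk0 _ fun h => ?_, rfl⟩
  have h0 : γ.1 0 0 = 0 := by
    have := le_add_left' _ _ (mem_prin_self (γ.1 0 0)) |> (h ▸ ·)
    exact (FractionalIdeal.mem_zero_iff _).1 this
  have h1 : γ.1 1 0 = 0 := by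
    obtain ⟨y, hy, hy0⟩ := mod_ne_bot c.star
    have : γ.1 1 0 * y ∈ (0 : FractionalIdeal (𝓞 F)⁰ F) := by
      rw [← h]
      exact le_add_right' _ _ (mem_prin_mul.2 ⟨y, hy, rfl⟩)
    exact (mul_eq_zero.1 ((FractionalIdeal.mem_zero_iff _).1 this)).resolve_right hy0
  have := (Matrix.GeneralLinearGroup.det γ).ne_zero
  rw [det_val_eq, h0, h1] at this
  simp at this

/-- The point is that `g · L₀` is an extension of `b` by `(bc)^*`. Right multiplication by a
unipotent matrix normalizes `g⁻¹`, so `g · L₀` is a shear of `b ⊕ (bc)^*`, and such a lattice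
carries a standard tuple. -/
theorem exists_transform (hy₀ : (n : FractionalIdeal (𝓞 F)⁰ F) +
      FractionalIdeal.spanSingleton (𝓞 F)⁰ y₀ * (c : FractionalIdeal (𝓞 F)⁰ F) = 1)
    {D : Subgroup Fˣ} {g : GL (Fin 2) F} (hg : g ∈ GDint D) :
    ∃ x : LevelDatum c n, x.IsTransform y₀ g := by
  obtain ⟨b, hb⟩ := exists_colIdeal c g⁻¹
  obtain ⟨ξ, hξ⟩ := exists_unip_normalized (inv_mem hg) hb
  have hγ : g⁻¹ * unip ξ ∈ GDint D := mul_mem (inv_mem hg) (TZUQ_le_GDint D (unip_mem_TZUQ D ξ))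
  let L : Submodule (𝓞 F) (Fin 2 → F) :=
    (baseLat c).comap ((rowAct g⁻¹).toLinearMap.restrictScalars (𝓞 F))
  have hL : ∀ v, v ∈ baseLat c ↔ rowAct g v ∈ L := fun v => by
    change _ ↔ rowAct g⁻¹ (rowAct g v) ∈ baseLat c
    rw [rowAct_inv_rowAct]
  have hL' : ∀ v, v ∈ L ↔ v ᵥ* (unip ξ).1 ∈ prodLat b (b * c).star := by
    intro v
    change rowAct g⁻¹ v ∈ baseLat c ↔ _
    rw [mem_baseLat_iff_normalized hγ hξ, Units.val_mul, ← Matrix.vecMul_vecMul,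
      ← rowAct_inv_apply g⁻¹, inv_inv, rowAct_rowAct_inv]
  obtain ⟨lam, lat, hstd⟩ := exists_std c b L ξ hL'
  exact ⟨⟨CuspDatum.std c b L ξ hL' lam lat, torsMap n (levelMap y₀ g) (levelMap_mem hy₀ hL),
    levelMap_tors_injective hy₀ hL⟩, (isTransform_iff hy₀ _).2 ⟨hstd, hL, rfl⟩⟩

theorem LevelDatum.IsTransform.mem_L {x : LevelDatum c n} {g : GL (Fin 2) F}
    (h : x.IsTransform y₀ g) (v : Fin 2 → F) : v ∈ x.L ↔ rowAct g⁻¹ v ∈ baseLat c := by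
  rw [h.2.1, rowAct_rowAct_inv]

/-- The ideal `b` of the transform by `γ⁻¹`. -/
theorem LevelDatum.IsTransform.b_eq {x : LevelDatum c n} {γ : GL (Fin 2) F}
    (h : x.IsTransform y₀ γ⁻¹) : (x.b : FractionalIdeal (𝓞 F)⁰ F) =
      prin (γ.1 0 0) + prin (γ.1 1 0) * (c.star : FractionalIdeal (𝓞 F)⁰ F) := by
  ext y
  rw [mem_add_iff]
  refine (h.1.mem_b y).trans ?_
  constructor
  · rintro ⟨v, hv, rfl⟩
    rw [h.mem_L, inv_inv] at hv
    set w := rowAct γ v with hw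
    have : v = w ᵥ* γ.1 := by rw [← rowAct_inv_apply, hw, rowAct_inv_rowAct]
    obtain ⟨s, hs⟩ := mem_mod_one.1 hv.1
    refine ⟨(s : F) * γ.1 0 0, (FractionalIdeal.mem_spanSingleton _).2 ⟨s, smul_eq_coe_mul _ _⟩,
      γ.1 1 0 * w 1, mem_prin_mul.2 ⟨w 1, hv.2, rfl⟩, ?_⟩
    rw [this, vecMul_zero_coord, hs]
    ring
  · rintro ⟨_, h1, _, h2, rfl⟩
    obtain ⟨s, rfl⟩ := (FractionalIdeal.mem_spanSingleton _).1 h1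
    obtain ⟨z, hz, rfl⟩ := mem_prin_mul.1 h2
    refine ⟨(![(s : F), z] : Fin 2 → F) ᵥ* γ.1, ?_, ?_⟩
    · rw [h.mem_L, inv_inv, ← rowAct_inv_apply, rowAct_rowAct_inv]
      exact ⟨mem_mod_one.2 ⟨s, rfl⟩, hz⟩
    · rw [vecMul_zero_coord, smul_eq_coe_mul]
      simp
      ring

/-- Elements of `Γ` fix the level structure of `𝓞 ⊕ c^*`. -/
theorem Gam_fix (hy₀ : (n : FractionalIdeal (𝓞 F)⁰ F) +
      FractionalIdeal.spanSingleton (𝓞 F)⁰ y₀ * (c : FractionalIdeal (𝓞 F)⁰ F) = 1)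
    {D : Subgroup Fˣ} {δ : GL (Fin 2) F} (hδ : δ ∈ Gplus D (baseLat c)) :
    δ ∈ Gam D c n ↔ ∀ s ∈ divBy n (diff F)⁻¹.mod,
      rowAct δ ![0, y₀ * s] - ![0, y₀ * s] ∈ baseLat c := by
  rw [← inv_mem_iff, mem_Gam_iff hy₀ (inv_mem hδ)]
  rfl

/-- The correspondence between double cosets and classes of transforms. -/
theorem transform_equiv_iff (hy₀ : (n : FractionalIdeal (𝓞 F)⁰ F) +
      FractionalIdeal.spanSingleton (𝓞 F)⁰ y₀ * (c : FractionalIdeal (𝓞 F)⁰ F) = 1)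
    {D : Subgroup Fˣ} {g g' : GL (Fin 2) F} (hg : g ∈ GDint D) (hg' : g' ∈ GDint D)
    {x x' : LevelDatum c n} (hx : x.IsTransform y₀ g) (hx' : x'.IsTransform y₀ g') :
    LevelDatum.CuspEquiv D x x' ↔ ∃ t ∈ TZUQ D, ∃ δ ∈ Gam D c n, g' = t * g * δ := by
  obtain ⟨hs, hL, hβ⟩ := (isTransform_iff hy₀ x).1 hx
  obtain ⟨hs', hL', hβ'⟩ := (isTransform_iff hy₀ x').1 hx'
  constructor
  · rintro ⟨ha, hb, f, hf, ht⟩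
    obtain ⟨u, ε, hε, ξ, hfv⟩ := (compat_iff hs hs' ha hb f).1 hf
    have htm : (triMat u ε ξ)⁻¹ ∈ TZUQ D := inv_mem (triMat_mem u hε ξ)
    have hf' : ∀ v, f.toEquiv v = rowAct (triMat u ε ξ)⁻¹ v := fun v => by
      rw [hfv, rowAct_inv_apply]
    generalize (triMat u ε ξ)⁻¹ = t at htm hf'
    -- Both `tg` and `g'` carry `L₀` onto the lattice of `x'`, so their quotient stabilizes `L₀`;
    -- equality of the level structures then places it in `Γ`.
    have hδ : (t * g)⁻¹ * g' ∈ Gplus D (baseLat c) := by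
      refine ⟨GDint_le_GDplus D (mul_mem (inv_mem (mul_mem (TZUQ_le_GDint D htm) hg)) hg'),
        fun v => ?_⟩
      rw [mul_inv_rev, rowAct_mul_apply, rowAct_mul_apply, hL', hL, rowAct_rowAct_inv,
        f.mem_iff, hf', rowAct_rowAct_inv]
    refine ⟨t, htm, (t * g)⁻¹ * g', (Gam_fix hy₀ hδ).2 fun s hs => ?_, by group⟩
    have h := ht (Tors.mk ⟨s, hs⟩)
    rw [hβ, hβ', torsMap_mk, LatIso.onTors_mk, torsMap_mk, Tors.mk_eq_mk_iff] at h
    simp only [levelMap_apply] at h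
    rw [hf', ← rowAct_mul_apply] at h
    rw [hL, ← neg_mem_iff, f.mem_iff, hf', map_neg, ← rowAct_mul_apply, ← map_neg, map_neg,
      map_sub, ← rowAct_mul_apply, mul_inv_cancel_left, neg_sub]
    exact h
  · rintro ⟨t, ht, δ, hδ, rfl⟩
    have hmul : ∀ w, rowAct (t * g * δ) (rowAct δ⁻¹ w) = rowAct t (rowAct g w) := fun w => by
      rw [← rowAct_mul_apply, mul_inv_cancel_right, rowAct_mul_apply]
    have hLt : ∀ w, w ∈ baseLat c ↔ rowAct t (rowAct g w) ∈ x'.L := fun w => by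
      rw [← hmul, ← hL', ← (inv_mem hδ.1).2]
    have hmem : ∀ v, v ∈ x.L ↔ rowAct t v ∈ x'.L := fun v => by
      rw [← rowAct_rowAct_inv g v, ← hL, hLt]
    -- `rowAct t` multiplies on the right by `t⁻¹`, so it is `t⁻¹` that has to be written in
    -- triangular form.
    obtain ⟨u, ε, hε, ξ, hte⟩ := inv_mem ht
    have htv : ∀ v, rowAct t v = v ᵥ* (triMat u ε ξ).1 := fun v => by rw [rowAct_apply, hte]
    have hb : x.b = x'.b := by
      apply mod_injective
      ext y
      rw [← unit_mul_mem_iff x'.b (u * ε), hs.mem_b, hs'.mem_b]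
      constructor
      · rintro ⟨v, hv, rfl⟩
        exact ⟨rowAct t v, (hmem v).1 hv, by rw [htv, vecMul_triMat]; simp⟩
      · rintro ⟨v, hv, h⟩
        refine ⟨rowAct t⁻¹ v, ?_, ?_⟩
        · rwa [hmem, rowAct_rowAct_inv]
        · apply mul_left_cancel₀ (unit_coe_ne_zero (u * ε))
          rw [← h]
          conv_rhs => rw [← rowAct_rowAct_inv t v, htv, vecMul_triMat]
          simp
    have ha : x.a = x'.a := by rw [x.a_eq, x'.a_eq, hb]
    refine ⟨ha, hb, ⟨rowAct t, hmem⟩, (compat_iff hs hs' ha hb _).2 ⟨u, ε, hε, ξ, htv⟩, fun s => ?_⟩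
    obtain ⟨s, rfl⟩ := Tors.exists_mk s
    rw [hβ, hβ', torsMap_mk, LatIso.onTors_mk, torsMap_mk, Tors.mk_eq_mk_iff]
    simp only [levelMap_apply]
    rw [← neg_mem_iff, neg_sub, rowAct_mul_apply, rowAct_mul_apply, ← map_sub, ← map_sub, ← hLt]
    exact (Gam_fix hy₀ hδ.1).1 hδ s.1 s.2

end TransformData

/-! ### Primitive vectors, cyclic torsion modules and lifting modulo `n` -/

section Approximation

variable {F : Type*} [Field F] [NumberField F]
variable {c b : FracId F} {n : Ideal (𝓞 F)} [NeZero n] {y₀ : F}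

theorem one_mem_frac : (1 : F) ∈ (1 : FractionalIdeal (𝓞 F)⁰ F) := mem_mod_one.2 ⟨1, map_one _⟩

theorem add_prin_congr {f : FractionalIdeal (𝓞 F)⁰ F} {x y : F} (h : x - y ∈ f) :
    f + prin x = f + prin y := by
  apply le_antisymm
  · rw [fadd_le, prin_le]
    exact ⟨le_add_left' _ _, mem_add_prin.2 ⟨x - y, h, 1, by simp⟩⟩
  · rw [fadd_le, prin_le]
    exact ⟨le_add_left' _ _, mem_add_prin.2 ⟨-(x - y), neg_mem (S := Submodule (𝓞 F) F) h, 1, by simp⟩⟩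

theorem adjoin_congr {f : FracId F} {x y : F} (h : x - y ∈ f.mod) : adjoin f x = adjoin f y :=
  Units.ext (add_prin_congr h)

/-- `r (v₀, v₁) ∈ b ⊕ A` in terms of fractional ideals. -/
theorem mem_div_adjoin_iff {A : FracId F} {r : 𝓞 F} {v₀ v₁ : F} :
    (r : F) ∈ (A * (adjoin (A * adjoin b v₀ * b⁻¹) v₁)⁻¹).mod ↔
      (r : F) * v₀ ∈ b.mod ∧ (r : F) * v₁ ∈ A.mod := by
  rw [mem_mul_inv_iff]
  constructor
  · intro h
    refine ⟨?_, h _ (mem_adjoin_self _ _)⟩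
    have e : b = A * (A * b⁻¹)⁻¹ := by rw [mul_inv, inv_inv, mul_inv_cancel_left]
    rw [e, mem_mul_inv_iff]
    intro z hz
    have h1 := mem_mod_mul hz (mem_adjoin_self b v₀)
    rw [mul_right_comm] at h1
    have := h _ (le_adjoin _ v₁ h1)
    convert this using 1
    ring
  · rintro ⟨h0, h1⟩ y hy
    obtain ⟨y', hy', s, rfl⟩ := mem_adjoin.1 hy
    have h2 : (r : F) ∈ (b * (adjoin b v₀)⁻¹).mod := by
      rw [mem_mul_inv_iff]
      intro z hz
      obtain ⟨z', hz', t, rfl⟩ := mem_adjoin.1 hz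
      have := add_mem (int_mul_mem b r hz') (int_mul_mem b t h0)
      convert this using 1
      ring
    have h3 := mem_mod_mul h2 hy'
    have e : b * (adjoin b v₀)⁻¹ * (A * adjoin b v₀ * b⁻¹) = A := Additive.ofMul.injective (by
      simp only [ofMul_mul, ofMul_inv]; abel)
    rw [e] at h3
    have := add_mem h3 (int_mul_mem A s h1)
    convert this using 1
    ring

theorem ofIdeal_ext {f : FracId F} (hf : f.mod ≤ (1 : FracId F).mod)
    (h : ∀ r : 𝓞 F, (r : F) ∈ f.mod ↔ r ∈ n) : f = ofIdeal n := by
  apply mod_injective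
  ext x
  constructor
  · intro hx
    obtain ⟨r, rfl⟩ := mem_mod_one.1 (hf hx)
    exact int_mem_ofIdeal.2 ((h r).1 hx)
  · intro hx
    obtain ⟨r, hr, rfl⟩ := mem_ofIdeal.1 hx
    exact (h r).2 hr

/-- Primitive vectors in terms of fractional ideals. -/
theorem isPrimitive_iff {A : FracId F} {L : Submodule (𝓞 F) (Fin 2 → F)} (hL : L = prodLat b A)
    (v : divBy n L) : IsPrimitive (Tors.mk v) ↔
      adjoin (A * adjoin b (v.1 0) * b⁻¹) (v.1 1) = (ofIdeal n)⁻¹ * A := by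
  subst hL
  -- The annihilator of `v` is `A (A + Ab⁻¹v₀ + 𝓞v₁)⁻¹`, and this equals `n` exactly when the ideal
  -- in brackets is `n⁻¹A`.
  have key : ∀ r : 𝓞 F, r • (Tors.mk v : Tors n (prodLat b A)) = 0 ↔
      (r : F) ∈ (A * (adjoin (A * adjoin b (v.1 0) * b⁻¹) (v.1 1))⁻¹).mod := by
    intro r
    rw [mem_div_adjoin_iff, ← Submodule.Quotient.mk_smul]
    refine Tors.mk_eq_zero_iff.trans ?_
    rw [mem_prodLat]
    simp only [Submodule.coe_smul, Pi.smul_apply, smul_eq_coe_mul]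
  unfold IsPrimitive
  simp only [key]
  constructor
  · intro h
    have := ofIdeal_ext (f := A * (adjoin (A * adjoin b (v.1 0) * b⁻¹) (v.1 1))⁻¹) ?_ h
    · rw [← this, mul_inv, inv_inv, mul_comm A⁻¹, inv_mul_cancel_right]
    · have h1 : A.mod ≤ (adjoin (A * adjoin b (v.1 0) * b⁻¹) (v.1 1)).mod := by
        refine le_trans ?_ (le_adjoin _ _)
        have := mod_mono_mul (h := A * b⁻¹) (le_adjoin b (v.1 0))
        have e1 : b * (A * b⁻¹) = A := Additive.ofMul.injective (by
          simp only [ofMul_mul, ofMul_inv]; abel)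
        have e2 : adjoin b (v.1 0) * (A * b⁻¹) = A * adjoin b (v.1 0) * b⁻¹ :=
          Additive.ofMul.injective (by simp only [ofMul_mul, ofMul_inv]; abel)
        rwa [e1, e2] at this
      have := mod_mono_mul (h := (adjoin (A * adjoin b (v.1 0) * b⁻¹) (v.1 1))⁻¹) h1
      rwa [mul_inv_cancel] at this
  · intro h r
    rw [h, mul_inv, inv_inv, mul_comm (ofIdeal n), mul_inv_cancel_left, int_mem_ofIdeal]

/-- Generators of `n⁻¹f/f`. -/
theorem span_mk_eq_top_iff {f : FracId F} (t : divBy n f.mod) :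
    Submodule.span (𝓞 F) {(Tors.mk t : Tors n f.mod)} = ⊤ ↔ adjoin f t.1 = (ofIdeal n)⁻¹ * f := by
  rw [Submodule.eq_top_iff']
  have key : ∀ s : divBy n f.mod, (Tors.mk s : Tors n f.mod) ∈ Submodule.span (𝓞 F)
      {(Tors.mk t : Tors n f.mod)} ↔ s.1 ∈ (adjoin f t.1).mod := by
    intro s
    rw [Submodule.mem_span_singleton, mem_adjoin]
    constructor
    · rintro ⟨r, hr⟩
      rw [← Submodule.Quotient.mk_smul] at hr
      have := Tors.mk_eq_mk_iff.1 hr.symm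
      exact ⟨_, this, r, by rw [Submodule.coe_smul, smul_eq_coe_mul]; ring⟩
    · rintro ⟨y, hy, r, h⟩
      refine ⟨r, ?_⟩
      rw [← Submodule.Quotient.mk_smul]
      refine Eq.symm (Tors.mk_eq_mk_iff.2 ?_)
      rw [Submodule.coe_smul, smul_eq_coe_mul, h, add_sub_cancel_right]
      exact hy
  constructor
  · intro h
    apply mod_injective
    apply le_antisymm
    · exact adjoin_le (le_ofIdeal_inv_mul n f) (mem_divBy_mod.1 t.2)
    · intro x hx
      exact (key ⟨x, mem_divBy_mod.2 hx⟩).1 (h _)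
  · intro h w
    obtain ⟨s, rfl⟩ := Tors.exists_mk w
    rw [key, h]
    exact mem_divBy_mod.1 s.2

/-- In a Dedekind domain a larger fractional ideal needs only one generator over a smaller one; this
is applied to `f ⊆ n⁻¹f`. -/
theorem exists_generator (n : Ideal (𝓞 F)) [NeZero n] (f : FracId F) : ∃ t : divBy n f.mod,
    Submodule.span (𝓞 F) {(Tors.mk t : Tors n f.mod)} = ⊤ := by
  obtain ⟨x, hx⟩ := exists_add_prin_eq (le_ofIdeal_inv_mul n f)
  have hx' : adjoin f x = (ofIdeal n)⁻¹ * f := Units.ext hx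
  refine ⟨⟨x, mem_divBy_mod.2 ?_⟩, (span_mk_eq_top_iff _).2 hx'⟩
  rw [← hx']
  exact mem_adjoin_self f x

/-- The annihilator of the class of `t` is `f (f + 𝓞t)⁻¹ = f (n⁻¹f)⁻¹ = n`. Through the injectivity
of `β` this makes `β(τ)` primitive. -/
theorem isPrimitive_of_generator {f : FracId F} {t : divBy n f.mod}
    (ht : adjoin f t.1 = (ofIdeal n)⁻¹ * f) (r : 𝓞 F) :
    r • (Tors.mk t : Tors n f.mod) = 0 ↔ r ∈ n := by
  rw [← Submodule.Quotient.mk_smul]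
  refine Tors.mk_eq_zero_iff.trans ?_
  rw [Submodule.coe_smul, smul_eq_coe_mul]
  constructor
  · intro h
    have : (r : F) ∈ (f * (adjoin f t.1)⁻¹).mod := by
      rw [mem_mul_inv_iff]
      intro y hy
      obtain ⟨z, hz, s, rfl⟩ := mem_adjoin.1 hy
      have := add_mem (int_mul_mem f r hz) (int_mul_mem f s h)
      convert this using 1
      ring
    rw [ht, mul_inv, inv_inv, mul_comm (ofIdeal n), mul_inv_cancel_left, int_mem_ofIdeal] at this
    exact this
  · intro h
    exact mem_ofIdeal_inv_mul.1 (mem_divBy_mod.1 t.2) r h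

section Lift

variable {t : F}

theorem frac_inv_mul (f : FracId F) : ((f⁻¹ : FracId F) : FractionalIdeal (𝓞 F)⁰ F) *
    (f : FractionalIdeal (𝓞 F)⁰ F) = 1 := by
  rw [← Units.val_mul, inv_mul_cancel, Units.val_one]

/-- `𝓞 + y₀ t c𝔡 = n⁻¹`. -/
theorem one_add_aux (hy₀ : (n : FractionalIdeal (𝓞 F)⁰ F) +
      FractionalIdeal.spanSingleton (𝓞 F)⁰ y₀ * (c : FractionalIdeal (𝓞 F)⁰ F) = 1)
    (ht : adjoin (diff F)⁻¹ t = (ofIdeal n)⁻¹ * (diff F)⁻¹) :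
    1 + prin (y₀ * t) * ((c * diff F : FracId F) : FractionalIdeal (𝓞 F)⁰ F) =
      (((ofIdeal n)⁻¹ : FracId F) : FractionalIdeal (𝓞 F)⁰ F) := by
  have hT : 1 + prin t * (diff F : FractionalIdeal (𝓞 F)⁰ F) =
      (((ofIdeal n)⁻¹ : FracId F) : FractionalIdeal (𝓞 F)⁰ F) := by
    have := congrArg (fun f : FracId F => ((f * diff F : FracId F) : FractionalIdeal (𝓞 F)⁰ F)) ht
    simp only [inv_mul_cancel_right] at this
    rwa [Units.val_mul, coe_adjoin, add_mul, frac_inv_mul] at this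
  have hY : prin y₀ * (c : FractionalIdeal (𝓞 F)⁰ F) ≤ 1 := by
    rw [← hy₀]; exact le_add_right' _ _
  have hN : ((n : Ideal (𝓞 F)) : FractionalIdeal (𝓞 F)⁰ F) *
      (((ofIdeal n)⁻¹ : FracId F) : FractionalIdeal (𝓞 F)⁰ F) = 1 := by
    rw [mul_comm]; exact frac_inv_mul (ofIdeal n)
  have e : prin (y₀ * t) * ((c * diff F : FracId F) : FractionalIdeal (𝓞 F)⁰ F) =
      prin y₀ * (c : FractionalIdeal (𝓞 F)⁰ F) * (prin t * (diff F : FractionalIdeal (𝓞 F)⁰ F)) := by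
    rw [prin_mul, Units.val_mul]; ring
  -- Multiply `n + y₀c = 𝓞` by `n⁻¹`, then expand the remaining `n⁻¹` as `𝓞 + t𝔡`. The term `y₀c ⊆
  -- 𝓞` that appears is absorbed by `𝓞`.
  have key : (((ofIdeal n)⁻¹ : FracId F) : FractionalIdeal (𝓞 F)⁰ F) = 1 +
      (prin y₀ * (c : FractionalIdeal (𝓞 F)⁰ F) +
        prin y₀ * (c : FractionalIdeal (𝓞 F)⁰ F) * (prin t * (diff F : FractionalIdeal (𝓞 F)⁰ F))) := by
    calc (((ofIdeal n)⁻¹ : FracId F) : FractionalIdeal (𝓞 F)⁰ F) =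
        ((n : FractionalIdeal (𝓞 F)⁰ F) + prin y₀ * (c : FractionalIdeal (𝓞 F)⁰ F)) *
          (((ofIdeal n)⁻¹ : FracId F) : FractionalIdeal (𝓞 F)⁰ F) := by rw [hy₀, one_mul]
      _ = 1 + prin y₀ * (c : FractionalIdeal (𝓞 F)⁰ F) *
          (((ofIdeal n)⁻¹ : FracId F) : FractionalIdeal (𝓞 F)⁰ F) := by rw [add_mul, hN]
      _ = _ := by rw [← hT, mul_add, mul_one]
  rw [e, key, ← add_assoc]
  congr 1
  rw [← FractionalIdeal.sup_eq_add, sup_eq_left.2 hY]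

theorem aux_mul_gen_mem (hy₀ : (n : FractionalIdeal (𝓞 F)⁰ F) +
      FractionalIdeal.spanSingleton (𝓞 F)⁰ y₀ * (c : FractionalIdeal (𝓞 F)⁰ F) = 1)
    (ht : adjoin (diff F)⁻¹ t = (ofIdeal n)⁻¹ * (diff F)⁻¹) :
    y₀ * t ∈ (c⁻¹ * ((ofIdeal n)⁻¹ * (diff F)⁻¹)).mod := by
  apply aux_mul_mem hy₀
  rw [← ht]
  exact mem_adjoin_self _ _

/-- Multiplication by `y₀ t` is onto `n⁻¹f/f`. -/
theorem exists_lift (hy₀ : (n : FractionalIdeal (𝓞 F)⁰ F) +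
      FractionalIdeal.spanSingleton (𝓞 F)⁰ y₀ * (c : FractionalIdeal (𝓞 F)⁰ F) = 1)
    (ht : adjoin (diff F)⁻¹ t = (ofIdeal n)⁻¹ * (diff F)⁻¹) (f : FracId F) {z : F}
    (hz : z ∈ ((ofIdeal n)⁻¹ * f).mod) : ∃ w ∈ (f * c * diff F).mod, y₀ * t * w - z ∈ f.mod := by
  rw [mem_mod, Units.val_mul, ← one_add_aux hy₀ ht, add_mul, one_mul, mul_assoc] at hz
  obtain ⟨x, hx, _, h1, h2⟩ := mem_add_iff.1 hz
  obtain ⟨w, hw, rfl⟩ := mem_prin_mul.1 h1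
  refine ⟨w, ?_, ?_⟩
  · have e : f * c * diff F = c * diff F * f := Additive.ofMul.injective (by
      simp only [ofMul_mul]; abel)
    rw [e]
    exact hw
  · rw [← h2]
    have := neg_mem (S := Submodule (𝓞 F) F) (s := f.mod) hx
    convert this using 1
    ring

/-- The ideal generated by a lift of a primitive vector is prime to `n`. -/
theorem lift_coprime (hy₀ : (n : FractionalIdeal (𝓞 F)⁰ F) +
      FractionalIdeal.spanSingleton (𝓞 F)⁰ y₀ * (c : FractionalIdeal (𝓞 F)⁰ F) = 1)
    (ht : adjoin (diff F)⁻¹ t = (ofIdeal n)⁻¹ * (diff F)⁻¹) {v₀ v₁ p q : F}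
    (hv : adjoin ((b * c).star * adjoin b v₀ * b⁻¹) v₁ = (ofIdeal n)⁻¹ * (b * c).star)
    (hp : y₀ * t * p - v₀ ∈ b.mod) (hq : y₀ * t * q - v₁ ∈ (b * c).star.mod) :
    (1 : FractionalIdeal (𝓞 F)⁰ F) ≤ prin q * (b : FractionalIdeal (𝓞 F)⁰ F) +
      prin p * (((b * c * diff F)⁻¹ : FracId F) : FractionalIdeal (𝓞 F)⁰ F) + n := by
  set A := (b * c).star with hA
  set I : FractionalIdeal (𝓞 F)⁰ F := prin q * (b : FractionalIdeal (𝓞 F)⁰ F) +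
      prin p * (((b * c * diff F)⁻¹ : FracId F) : FractionalIdeal (𝓞 F)⁰ F) with hI
  have hN : ((n : Ideal (𝓞 F)) : FractionalIdeal (𝓞 F)⁰ F) *
      (((ofIdeal n)⁻¹ : FracId F) : FractionalIdeal (𝓞 F)⁰ F) = 1 := by
    rw [mul_comm]; exact frac_inv_mul (ofIdeal n)
  rw [← adjoin_congr hp] at hv
  have hA' : A.mod ≤ (A * adjoin b (y₀ * t * p) * b⁻¹).mod := by
    have := mod_mono_mul (h := A * b⁻¹) (le_adjoin b (y₀ * t * p))
    have e1 : b * (A * b⁻¹) = A := Additive.ofMul.injective (by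
      simp only [ofMul_mul, ofMul_inv]; abel)
    have e2 : adjoin b (y₀ * t * p) * (A * b⁻¹) = A * adjoin b (y₀ * t * p) * b⁻¹ :=
      Additive.ofMul.injective (by simp only [ofMul_mul, ofMul_inv]; abel)
    rwa [e1, e2] at this
  rw [← adjoin_congr (hA' hq)] at hv
  have h1 := congrArg (fun f : FracId F => ((f * A⁻¹ : FracId F) : FractionalIdeal (𝓞 F)⁰ F)) hv
  simp only [mul_inv_cancel_right] at h1
  have e3 : (((adjoin (A * adjoin b (y₀ * t * p) * b⁻¹) (y₀ * t * q)) * A⁻¹ : FracId F) :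
      FractionalIdeal (𝓞 F)⁰ F) =
      1 + prin (y₀ * t) * ((c * diff F : FracId F) : FractionalIdeal (𝓞 F)⁰ F) * I := by
    have k1 : A⁻¹ = c * diff F * b := Additive.ofMul.injective (by
      simp only [hA, FracId.star, ofMul_mul, ofMul_inv]; abel)
    have k2 : b⁻¹ = c * diff F * (b * c * diff F)⁻¹ := Additive.ofMul.injective (by
      simp only [ofMul_mul, ofMul_inv]; abel)
    have k3 : A * adjoin b (y₀ * t * p) * b⁻¹ * A⁻¹ = adjoin b (y₀ * t * p) * b⁻¹ :=
      Additive.ofMul.injective (by simp only [ofMul_mul, ofMul_inv]; abel)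
    have k4 : (b : FractionalIdeal (𝓞 F)⁰ F) * ((b⁻¹ : FracId F) : FractionalIdeal (𝓞 F)⁰ F) = 1 := by
      rw [mul_comm, frac_inv_mul]
    rw [Units.val_mul, coe_adjoin, add_mul, ← Units.val_mul, k3, Units.val_mul, coe_adjoin, add_mul,
      k4, k1, k2, hI, Units.val_mul (c * diff F), Units.val_mul (c * diff F), prin_mul (y₀ * t) p,
      prin_mul (y₀ * t) q]
    ring
  rw [e3] at h1
  -- Write `W = y₀t c𝔡`, so that primitivity has become `𝓞 + WI = n⁻¹`. Multiplying by `n` gives `n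
  -- + nWI = 𝓞`, and `nW ⊆ 𝓞` bounds the second term by `I`.
  have hW : (n : FractionalIdeal (𝓞 F)⁰ F) *
      (prin (y₀ * t) * ((c * diff F : FracId F) : FractionalIdeal (𝓞 F)⁰ F)) ≤ 1 := by
    have h2 := congrArg (fun f => (n : FractionalIdeal (𝓞 F)⁰ F) * f) (one_add_aux hy₀ ht)
    simp only [hN, mul_add] at h2
    rw [← h2]
    exact le_add_right' _ _
  have h3 := congrArg (fun f => (n : FractionalIdeal (𝓞 F)⁰ F) * f) h1
  simp only [hN, mul_add, mul_one] at h3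
  rw [← h3, fadd_le]
  refine ⟨le_add_right' _ _, le_trans ?_ (le_add_left' _ _)⟩
  rw [← mul_assoc]
  calc _ ≤ 1 * I := by gcongr
    _ = I := one_mul I

end Lift

end Approximation

/-! ### Strong approximation: primitive vectors as bottom rows -/

section Normalized

variable {F : Type*} [Field F] [NumberField F]
variable {c b : FracId F} {n : Ideal (𝓞 F)} [NeZero n] {y₀ : F}

theorem coeIdeal_span (r : 𝓞 F) :
    ((Ideal.span {r} : Ideal (𝓞 F)) : FractionalIdeal (𝓞 F)⁰ F) = prin (r : F) :=
  FractionalIdeal.coeIdeal_span_singleton r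

theorem sup_eq_top_iff {I J : Ideal (𝓞 F)} : I ⊔ J = ⊤ ↔
    (1 : FractionalIdeal (𝓞 F)⁰ F) ≤ (I : FractionalIdeal (𝓞 F)⁰ F) + J := by
  rw [← FractionalIdeal.coeIdeal_sup, ← FractionalIdeal.coeIdeal_top,
    FractionalIdeal.coeIdeal_le_coeIdeal, top_le_iff]

/-- An element `q` of `b⁻¹` generating `b⁻¹` modulo `J b⁻¹` and `n b⁻¹` together is congruent
modulo `n b⁻¹` to a generator modulo `J b⁻¹`. -/
theorem exists_congr_coprime {J : FracId F} (hJ : J.mod ≤ (1 : FracId F).mod) {q : F}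
    (hq : q ∈ (b⁻¹).mod) (h : (1 : FractionalIdeal (𝓞 F)⁰ F) ≤
      prin q * (b : FractionalIdeal (𝓞 F)⁰ F) + J + n) :
    ∃ q' : F, q' - q ∈ (ofIdeal n * b⁻¹).mod ∧
      (1 : FractionalIdeal (𝓞 F)⁰ F) ≤ prin q' * (b : FractionalIdeal (𝓞 F)⁰ F) + J := by
  have hJ' : (J : FractionalIdeal (𝓞 F)⁰ F) ≤ 1 := hJ
  have hn' : (n : FractionalIdeal (𝓞 F)⁰ F) ≤ 1 := FractionalIdeal.coeIdeal_le_one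
  -- Modulo `nJb⁻¹` the ideal `b⁻¹` is generated by one element `x`. Writing `q ≡ rx` with `r ∈ 𝓞`
  -- reduces the claim to the stable range property for `r`, `J` and `n`.
  obtain ⟨x, hx⟩ := exists_add_prin_eq (f := ofIdeal n * J * b⁻¹) (g := b⁻¹) (by
    have h1 := mod_mono_mul (h := J * b⁻¹) (ofIdeal_le_one n)
    have h2 := mod_mono_mul (h := b⁻¹) hJ
    rw [one_mul] at h1 h2
    rw [mul_assoc]
    exact h1.trans h2)
  have hq2 : q ∈ ((ofIdeal n * J * b⁻¹ : FracId F) : FractionalIdeal (𝓞 F)⁰ F) + prin x := by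
    rw [hx]; exact hq
  obtain ⟨z, hz, r, rfl⟩ := mem_add_prin.1 hq2
  have hxb : (n : FractionalIdeal (𝓞 F)⁰ F) * J + prin x * (b : FractionalIdeal (𝓞 F)⁰ F) = 1 := by
    have := congrArg (fun f => f * (b : FractionalIdeal (𝓞 F)⁰ F)) hx
    simp only [frac_inv_mul, add_mul] at this
    rwa [← Units.val_mul, inv_mul_cancel_right, Units.val_mul] at this
  have hxb1 : prin x * (b : FractionalIdeal (𝓞 F)⁰ F) ≤ 1 := by
    rw [← hxb]; exact le_add_right' _ _
  have hnJ : (n : FractionalIdeal (𝓞 F)⁰ F) * J ≤ J := by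
    calc _ ≤ 1 * (J : FractionalIdeal (𝓞 F)⁰ F) := by gcongr
      _ = _ := one_mul _
  obtain ⟨J0, hJ0⟩ := FractionalIdeal.le_one_iff_exists_coeIdeal.1 hJ'
  have hJ0ne : J0 ≠ ⊥ := by
    rintro rfl
    apply J.ne_zero
    rw [← hJ0, FractionalIdeal.coeIdeal_bot]
  have hr : Ideal.span {r} ⊔ J0 ⊔ n = ⊤ := by
    rw [sup_eq_top_iff, FractionalIdeal.coeIdeal_sup, hJ0, coeIdeal_span]
    refine h.trans ?_
    have h1 : prin (z + (r : F) * x) * (b : FractionalIdeal (𝓞 F)⁰ F) ≤ prin (r : F) + J := by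
      calc prin (z + (r : F) * x) * (b : FractionalIdeal (𝓞 F)⁰ F)
          ≤ (((ofIdeal n * J * b⁻¹ : FracId F) : FractionalIdeal (𝓞 F)⁰ F) + prin ((r : F) * x)) *
            (b : FractionalIdeal (𝓞 F)⁰ F) := by
            gcongr
            rw [prin_le]
            exact mem_add_iff.2 ⟨z, hz, _, mem_prin_self _, rfl⟩
        _ = (n : FractionalIdeal (𝓞 F)⁰ F) * J +
            prin (r : F) * (prin x * (b : FractionalIdeal (𝓞 F)⁰ F)) := by
            rw [add_mul, ← Units.val_mul, inv_mul_cancel_right, Units.val_mul, prin_mul, mul_assoc]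
            rfl
        _ ≤ J + prin (r : F) * 1 := by gcongr
        _ = _ := by rw [mul_one, add_comm]
    rw [fadd_le, fadd_le]
    refine ⟨⟨h1.trans (le_add_left' _ _), le_trans (le_add_right' _ _) (le_add_left' _ _)⟩,
      le_add_right' _ _⟩
  obtain ⟨ν, hν, hrν⟩ := exists_add_isCoprime hJ0ne hr
  refine ⟨((r + ν : 𝓞 F) : F) * x, ?_, ?_⟩
  · have hx1 : x ∈ (b⁻¹).mod := by
      rw [mem_mod, ← hx]; exact le_add_right' _ _ (mem_prin_self x)
    have h1 := mem_mod_mul (int_mem_ofIdeal.2 hν) hx1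
    have h2 : z ∈ (ofIdeal n * b⁻¹).mod := by
      have := mod_mono_mul (h := ofIdeal n * b⁻¹) hJ
      rw [one_mul] at this
      have e : ofIdeal n * J * b⁻¹ = J * (ofIdeal n * b⁻¹) := Additive.ofMul.injective (by
        simp only [ofMul_mul, ofMul_inv]; abel)
      apply this
      rw [← e]
      exact hz
    have := sub_mem h1 h2
    have e : ((r + ν : 𝓞 F) : F) = (r : F) + (ν : F) := map_add _ _ _
    rw [e]
    convert this using 1
    ring
  · rw [sup_eq_top_iff, hJ0, coeIdeal_span] at hrν
    -- Multiply the two comaximality relations `(r + ν) + J = 𝓞` and `nJ + xb = 𝓞`. Every product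
    -- other than `(r + ν)xb` lies in `J`.
    calc (1 : FractionalIdeal (𝓞 F)⁰ F) = 1 * 1 := (one_mul 1).symm
      _ ≤ (prin ((r + ν : 𝓞 F) : F) + J) *
          ((n : FractionalIdeal (𝓞 F)⁰ F) * J + prin x * (b : FractionalIdeal (𝓞 F)⁰ F)) := by
          rw [hxb]; gcongr
      _ = prin (((r + ν : 𝓞 F) : F) * x) * (b : FractionalIdeal (𝓞 F)⁰ F) +
          (prin ((r + ν : 𝓞 F) : F) * ((n : FractionalIdeal (𝓞 F)⁰ F) * J) + (J : FractionalIdeal (𝓞 F)⁰ F) *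
          ((n : FractionalIdeal (𝓞 F)⁰ F) * J + prin x * (b : FractionalIdeal (𝓞 F)⁰ F))) := by
          rw [prin_mul]; ring
      _ ≤ _ := by
          rw [hxb, mul_one, fadd_le, fadd_le]
          refine ⟨le_add_left' _ _, ?_, le_add_right' _ _⟩
          refine le_trans ?_ (le_add_right' _ _)
          have : prin ((r + ν : 𝓞 F) : F) ≤ 1 := prin_le.2 (mem_mod_one.2 ⟨_, rfl⟩)
          calc _ ≤ 1 * ((n : FractionalIdeal (𝓞 F)⁰ F) * J) := by gcongr
            _ ≤ _ := by rw [one_mul]; exact hnJ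

/-- The matrix with given entries and determinant `1`. -/
theorem exists_matrix {D : Subgroup Fˣ} (p q r s : F) (h : p * s - q * r = 1) :
    ∃ γ ∈ GDint D, γ.1 = !![p, q; r, s] := by
  have hdet : Matrix.det !![p, q; r, s] ≠ 0 := by rw [Matrix.det_fin_two_of, h]; exact one_ne_zero
  refine ⟨Matrix.GeneralLinearGroup.mkOfDetNeZero !![p, q; r, s] hdet, ?_, rfl⟩
  have : Matrix.GeneralLinearGroup.det
      (Matrix.GeneralLinearGroup.mkOfDetNeZero !![p, q; r, s] hdet) = 1 := by
    apply Units.ext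
    rw [det_val_eq]
    exact h
  rw [GDint, GD, Subgroup.mem_inf, Subgroup.mem_comap, Subgroup.mem_comap, this]
  exact ⟨one_mem _, one_mem _⟩

/-- Strong approximation: primitive vectors of `n⁻¹L/L`, `L = b ⊕ (bc)^*`, are the second rows of
normalized matrices. -/
theorem exists_normalized_lift (hy₀ : (n : FractionalIdeal (𝓞 F)⁰ F) +
      FractionalIdeal.spanSingleton (𝓞 F)⁰ y₀ * (c : FractionalIdeal (𝓞 F)⁰ F) = 1)
    (D : Subgroup Fˣ) {t : F} (ht : adjoin (diff F)⁻¹ t = (ofIdeal n)⁻¹ * (diff F)⁻¹) {v : Fin 2 → F}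
    (hv0 : v 0 ∈ ((ofIdeal n)⁻¹ * b).mod)
    (hv : adjoin ((b * c).star * adjoin b (v 0) * b⁻¹) (v 1) = (ofIdeal n)⁻¹ * (b * c).star) :
    ∃ γ ∈ GDint D, IsNormalized c b γ ∧
      (![0, y₀ * t] : Fin 2 → F) ᵥ* γ.1 - v ∈ prodLat b (b * c).star := by
  have haux := aux_mul_gen_mem hy₀ ht
  -- This `p` becomes the lower left entry. It must be nonzero for the ideal `J` below to be
  -- invertible; a zero lift is replaced by a nonzero element of `n bc𝔡`, which `y₀t` multiplies
  -- into `b`.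
  obtain ⟨p, hp, hpv, hp0⟩ : ∃ p ∈ (b * c * diff F).mod, y₀ * t * p - v 0 ∈ b.mod ∧ p ≠ 0 := by
    obtain ⟨p, hp, hpv⟩ := exists_lift hy₀ ht b hv0
    by_cases h0 : p = 0
    · obtain ⟨e, he, he0⟩ := mod_ne_bot (ofIdeal n * (b * c * diff F))
      have h1 := mod_mono_mul (h := b * c * diff F) (ofIdeal_le_one n)
      rw [one_mul] at h1
      refine ⟨e, h1 he, ?_, he0⟩
      have h2 := mem_mod_mul haux he
      have k : c⁻¹ * ((ofIdeal n)⁻¹ * (diff F)⁻¹) * (ofIdeal n * (b * c * diff F)) = b :=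
        Additive.ofMul.injective (by simp only [ofMul_mul, ofMul_inv]; abel)
      rw [k] at h2
      rw [h0, mul_zero] at hpv
      have := add_mem h2 hpv
      convert this using 1
      ring
    · exact ⟨p, hp, hpv, h0⟩
  have hv1 : v 1 ∈ ((ofIdeal n)⁻¹ * (b * c).star).mod := by
    rw [← hv]; exact mem_adjoin_self _ _
  obtain ⟨q, hq, hqv⟩ := exists_lift hy₀ ht (b * c).star hv1
  have hq' : q ∈ (b⁻¹).mod := by
    convert hq using 2
    exact Additive.ofMul.injective (by simp only [FracId.star, ofMul_mul, ofMul_inv]; abel)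
  have hco := lift_coprime hy₀ ht hv hpv hqv
  -- Unimodularity of the bottom row `(p, q')` in the normalized sense means `q'b + J = 𝓞`; a
  -- solution of the corresponding equation is the top row.
  set J : FracId F := Units.mk0 (prin p * (((b * c * diff F)⁻¹ : FracId F) :
    FractionalIdeal (𝓞 F)⁰ F)) (mul_ne_zero (FractionalIdeal.spanSingleton_ne_zero_iff.2 hp0)
      (Units.ne_zero _)) with hJdef
  have hJ : J.mod ≤ (1 : FracId F).mod := by
    intro z hz
    obtain ⟨y, hy, rfl⟩ := mem_prin_mul.1 hz
    have := mem_mod_mul hp hy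
    rwa [mul_inv_cancel] at this
  -- Changing `q` by an element of `nb⁻¹` changes `y₀tq` only by an element of `(bc)^*`, so the
  -- class of the vector is preserved.
  obtain ⟨q', hq'q, h1⟩ := exists_congr_coprime hJ hq' hco
  have hone := h1 one_mem_frac
  obtain ⟨_, h2, _, h3, h4⟩ := mem_add_iff.1 hone
  obtain ⟨x, hx, rfl⟩ := mem_prin_mul.1 h2
  obtain ⟨y, hy, rfl⟩ := mem_prin_mul.1 h3
  obtain ⟨γ, hγ, hval⟩ := exists_matrix (D := D) x (-y) p q' (by linear_combination h4)
  have hq'mem : q' ∈ (b⁻¹).mod := by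
    have h5 := mod_mono_mul (h := b⁻¹) (ofIdeal_le_one n)
    rw [one_mul] at h5
    have := add_mem (h5 hq'q) hq'
    rwa [sub_add_cancel] at this
  refine ⟨γ, hγ, ?_, ?_⟩
  · unfold IsNormalized
    rw [hval]
    refine ⟨hx, ?_, hp, hq'mem⟩
    have k : (b * c * diff F)⁻¹ = (b * c).star := Additive.ofMul.injective (by
      simp only [FracId.star, ofMul_mul, ofMul_inv]; abel)
    rw [← k]
    exact neg_mem (S := Submodule (𝓞 F) F) hy
  · rw [mem_prodLat, Pi.sub_apply, Pi.sub_apply, vecMul_zero_coord, vecMul_one_coord, hval]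
    simp only [Matrix.cons_val_zero, Matrix.cons_val_one, Matrix.of_apply, Matrix.cons_val', zero_mul,
      zero_add]
    refine ⟨hpv, ?_⟩
    have h6 := mem_mod_mul haux hq'q
    have k : c⁻¹ * ((ofIdeal n)⁻¹ * (diff F)⁻¹) * (ofIdeal n * b⁻¹) = (b * c).star :=
      Additive.ofMul.injective (by simp only [FracId.star, ofMul_mul, ofMul_inv]; abel)
    rw [k] at h6
    have := add_mem h6 hqv
    convert this using 1
    ring

theorem adjoin_zero (f : FracId F) : adjoin f 0 = f := by
  apply Units.ext
  rw [coe_adjoin, prin, FractionalIdeal.spanSingleton_zero, add_zero]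

/-- Some primitive vector always exists, for instance `(0, y)` with `y` generating `n⁻¹(bc)^*` over
`(bc)^*`; any of its lifts will do. -/
theorem exists_normalized (hy₀ : (n : FractionalIdeal (𝓞 F)⁰ F) +
      FractionalIdeal.spanSingleton (𝓞 F)⁰ y₀ * (c : FractionalIdeal (𝓞 F)⁰ F) = 1)
    (D : Subgroup Fˣ) (b : FracId F) : ∃ γ ∈ GDint D, IsNormalized c b γ := by
  obtain ⟨t, ht⟩ := exists_generator n (diff F)⁻¹
  obtain ⟨y, hy⟩ := exists_add_prin_eq (le_ofIdeal_inv_mul n (b * c).star)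
  obtain ⟨γ, hγ, h, -⟩ := exists_normalized_lift (b := b) hy₀ D ((span_mk_eq_top_iff t).1 ht)
    (v := ![0, y]) (zero_mem _) (by
      rw [Matrix.cons_val_zero, adjoin_zero, mul_inv_cancel_right]
      exact Units.ext hy)
  exact ⟨γ, hγ, h⟩

theorem linearMap_eq_of_span {M N : Type*} [AddCommGroup M] [Module (𝓞 F) M] [AddCommGroup N]
    [Module (𝓞 F) N] {τ : M} (hτ : Submodule.span (𝓞 F) {τ} = ⊤) {f g : M →ₗ[𝓞 F] N}
    (h : f τ = g τ) : f = g :=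
  LinearMap.ext_on hτ (by rintro _ rfl; exact h)

/-- The level structure sends a generator to a primitive vector. -/
theorem LevelDatum.isPrimitive_β (x : LevelDatum c n) {τ : Tors n (diff F)⁻¹.mod}
    (hτ : Submodule.span (𝓞 F) {τ} = ⊤) : IsPrimitive (x.β τ) := by
  intro r
  rw [← map_smul, ← map_zero x.β, x.β_inj.eq_iff]
  obtain ⟨t, rfl⟩ := Tors.exists_mk τ
  exact isPrimitive_of_generator ((span_mk_eq_top_iff t).1 hτ) r

/-- A standard datum on `b ⊕ (bc)^*` is the transform by the inverse of a normalized matrix. -/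
theorem exists_isTransform (hy₀ : (n : FractionalIdeal (𝓞 F)⁰ F) +
      FractionalIdeal.spanSingleton (𝓞 F)⁰ y₀ * (c : FractionalIdeal (𝓞 F)⁰ F) = 1)
    (D : Subgroup Fˣ) (x : LevelDatum c n) (hx : x.toCuspDatum.IsStandard)
    (hL : x.L = prodLat b (b * c).star) :
    ∃ γ ∈ GDint D, IsNormalized c b γ ∧ x.IsTransform y₀ γ⁻¹ := by
  obtain ⟨t, ht⟩ := exists_generator n (diff F)⁻¹
  obtain ⟨v, hv⟩ := Tors.exists_mk (x.β (Tors.mk t))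
  have hprim := x.isPrimitive_β ht
  rw [hv, isPrimitive_iff hL] at hprim
  have hv0 : v.1 0 ∈ ((ofIdeal n)⁻¹ * b).mod := by
    exact (mem_divBy_prodLat.1 ((congrArg (divBy n) hL).le v.2)).1
  obtain ⟨γ, hγ, hn, hγv⟩ := exists_normalized_lift hy₀ D ((span_mk_eq_top_iff t).1 ht) hv0 hprim
  have hbase : ∀ v, v ∈ baseLat c ↔ rowAct γ⁻¹ v ∈ x.L := fun v => by
    rw [hL, rowAct_inv_apply, ← mem_baseLat_iff_normalized hγ hn]
  refine ⟨γ, hγ, hn, (isTransform_iff hy₀ x).2 ⟨hx, hbase, linearMap_eq_of_span ht ?_⟩⟩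
  rw [hv, torsMap_mk, Tors.mk_eq_mk_iff, ← neg_mem_iff, neg_sub]
  simp only [levelMap_apply]
  rw [rowAct_inv_apply]
  exact hL.ge hγv

end Normalized

/-! ### The ideal `b'`, ideal classes and ramification -/

section BPrime

variable {F : Type*} [Field F] [NumberField F]
variable {c : FracId F} {n : Ideal (𝓞 F)} [NeZero n] {y₀ : F}

theorem LevelDatum.mem_bPrimeMod (x : LevelDatum c n) (y : F) : y ∈ x.bPrimeMod ↔
    ∃ s, ∃ v : divBy n x.L, x.β s = Tors.mk v ∧ y - x.j v.1 ∈ x.b.mod := by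
  constructor
  · rintro ⟨⟨y, hy⟩, h, rfl⟩
    rw [SetLike.mem_coe, Submodule.mem_comap, LinearMap.mem_range] at h
    obtain ⟨s, hs⟩ := h
    obtain ⟨v, hv⟩ := Tors.exists_mk (x.β s)
    refine ⟨s, v, hv, ?_⟩
    rw [LinearMap.comp_apply, hv, torsMap_mk, Submodule.mkQ_apply] at hs
    exact Tors.mk_eq_mk_iff.1 hs.symm
  · rintro ⟨s, v, hv, h⟩
    have hj : x.j v.1 ∈ divBy n x.b.mod := divBy_map n x.j x.j_mem _ v.2
    have hy : y ∈ divBy n x.b.mod := by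
      have := add_mem (le_divBy n _ h) hj
      rwa [sub_add_cancel] at this
    refine ⟨⟨y, hy⟩, ?_, rfl⟩
    rw [SetLike.mem_coe, Submodule.mem_comap, LinearMap.mem_range]
    refine ⟨s, ?_⟩
    rw [LinearMap.comp_apply, hv, torsMap_mk, Submodule.mkQ_apply]
    exact (Tors.mk_eq_mk_iff.2 h).symm

/-- `b'` is generated by `b` and the first coordinate of `β(τ)`. -/
theorem LevelDatum.bPrime_eq (x : LevelDatum c n) {τ : Tors n (diff F)⁻¹.mod}
    (hτ : Submodule.span (𝓞 F) {τ} = ⊤) {v : divBy n x.L} (hv : x.β τ = Tors.mk v) :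
    x.bPrime = adjoin x.b (x.j v.1) := by
  apply mod_injective
  ext y
  refine (x.mem_bPrimeMod y).trans ?_
  rw [mem_adjoin]
  constructor
  · rintro ⟨s, w, hw, h⟩
    have hs : s ∈ Submodule.span (𝓞 F) {τ} := by rw [hτ]; trivial
    obtain ⟨r, rfl⟩ := Submodule.mem_span_singleton.1 hs
    rw [map_smul, hv, ← Submodule.Quotient.mk_smul] at hw
    have h1 := x.j_mem _ (Tors.mk_eq_mk_iff.1 hw)
    rw [Submodule.coe_smul, map_sub, map_int_smul, smul_eq_coe_mul] at h1
    exact ⟨_, sub_mem h h1, r, by ring⟩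
  · rintro ⟨z, hz, r, rfl⟩
    refine ⟨r • τ, r • v, ?_, ?_⟩
    · rw [map_smul, hv]; rfl
    · rw [Submodule.coe_smul, map_int_smul, smul_eq_coe_mul, add_sub_cancel_right]
      exact hz

theorem LevelDatum.bPrime_le (x : LevelDatum c n) : x.bPrime.mod ≤ ((ofIdeal n)⁻¹ * x.b).mod := by
  obtain ⟨t, ht⟩ := exists_generator n (diff F)⁻¹
  obtain ⟨v, hv⟩ := Tors.exists_mk (x.β (Tors.mk t))
  rw [x.bPrime_eq ht hv]
  exact adjoin_le (le_ofIdeal_inv_mul n x.b) (mem_divBy_mod.1 (divBy_map n x.j x.j_mem _ v.2))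

/-- The ideal `b'` is generated by `b` and `j(v)` for a representative `v` of `β(τ)`, and `p`
respects both. The two ideals `b` need not coincide, so this serves isomorphic as well as equivalent
cusps. -/
theorem LevelDatum.mem_bPrime_iff (x x' : LevelDatum c n) (f : LatIso x.L x'.L)
    (p : LatIso x.b.mod x'.b.mod) (hp : ∀ v, x'.j (f.toEquiv v) = p.toEquiv (x.j v))
    (hβ : ∀ t, f.onTors n (x.β t) = x'.β t) (y : F) :
    y ∈ x.bPrime.mod ↔ p.toEquiv y ∈ x'.bPrime.mod := by
  obtain ⟨t, ht⟩ := exists_generator n (diff F)⁻¹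
  obtain ⟨v, hv⟩ := Tors.exists_mk (x.β (Tors.mk t))
  have hv' := hβ (Tors.mk t)
  rw [hv, LatIso.onTors_mk] at hv'
  rw [x.bPrime_eq ht hv, x'.bPrime_eq ht hv'.symm, hp, mem_adjoin, mem_adjoin]
  constructor
  · rintro ⟨z, hz, r, rfl⟩
    exact ⟨p.toEquiv z, (p.mem_iff z).1 hz, r, by
      rw [map_add, ← smul_eq_mul, map_smul, smul_eq_mul]⟩
  · rintro ⟨z, hz, r, h⟩
    refine ⟨p.toEquiv.symm z, ?_, r, ?_⟩
    · rwa [p.mem_iff, LinearEquiv.apply_symm_apply]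
    · apply p.toEquiv.injective
      rw [h, map_add, LinearEquiv.apply_symm_apply, ← smul_eq_mul, ← smul_eq_mul, map_smul]

theorem LevelDatum.bPrime_eq_of_equiv {D : Subgroup Fˣ} {x x' : LevelDatum c n}
    (h : LevelDatum.CuspEquiv D x x') : x.bPrime = x'.bPrime := by
  obtain ⟨-, hb, f, ⟨-, ⟨p, hp⟩, -⟩, hβ⟩ := h
  obtain ⟨u, hu⟩ := latIso_unit' hb p
  apply mod_injective
  ext y
  rw [LevelDatum.mem_bPrime_iff x x' f p hp hβ, hu, unit_mul_mem_iff]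

/-- A linear automorphism of `F` is multiplication by `q 1`, so the two ideals differ by a principal
one. -/
theorem classGroup_mk_eq_of_scale {f g : FracId F} (q : F ≃ₗ[F] F)
    (h : ∀ y, y ∈ f.mod ↔ q y ∈ g.mod) : ClassGroup.mk F f = ClassGroup.mk F g := by
  have h1 : q 1 ≠ 0 := fun h => one_ne_zero (q.map_eq_zero_iff.1 h)
  have e : g = toPrincipalIdeal (𝓞 F) F (Units.mk0 (q 1) h1) * f := by
    apply mod_injective
    ext y
    rw [mem_mod, mem_mod, Units.val_mul, coe_toPrincipalIdeal, Units.val_mk0, mem_prin_mul]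
    constructor
    · intro hy
      refine ⟨q.symm y, ?_, ?_⟩
      · rw [← mem_mod, h, LinearEquiv.apply_symm_apply]; exact hy
      · rw [← equiv_apply_eq, LinearEquiv.apply_symm_apply]
    · rintro ⟨z, hz, rfl⟩
      rw [← equiv_apply_eq]
      exact (h z).1 hz
  have hp : ClassGroup.mk F (toPrincipalIdeal (𝓞 F) F (Units.mk0 (q 1) h1)) = 1 := by
    rw [ClassGroup.mk_eq_one_iff, coe_toPrincipalIdeal]
    exact ⟨⟨_, FractionalIdeal.coe_spanSingleton _ _⟩⟩
  rw [e, map_mul, hp, one_mul]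

theorem LevelDatum.classes_of_iso {D : Subgroup Fˣ} {x x' : LevelDatum c n} (h : x.CuspIso D x') :
    ClassGroup.mk F x.b = ClassGroup.mk F x'.b ∧
      ClassGroup.mk F x.bPrime = ClassGroup.mk F x'.bPrime := by
  obtain ⟨-, f, ⟨-, ⟨p, hp⟩, -⟩, hβ⟩ := h
  exact ⟨classGroup_mk_eq_of_scale p.toEquiv p.mem_iff,
    classGroup_mk_eq_of_scale p.toEquiv (LevelDatum.mem_bPrime_iff x x' f p hp hβ)⟩

/-- The kernel of `j` is the image of `i`. -/
theorem CuspDatum.exists_i_eq (x : CuspDatum c) {v : Fin 2 → F} (h : x.j v = 0) :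
    ∃ y, x.i y = v := by
  obtain ⟨f, h0, h1⟩ := exists_splitting x
  refine ⟨f.toEquiv v 1, f.toEquiv.injective ?_⟩
  rw [h1]
  apply vec_ext
  · simp [h0, h]
  · simp

/-- If `j(v) ∈ b`, a lattice vector can be subtracted from `v` to reach `ker j = im i`. Then `β`
takes values in the image of the injection `n⁻¹a^*/a^* → n⁻¹L/L`, which can be inverted there.
Conversely `j` kills that image. -/
theorem LevelDatum.unramified_iff (x : LevelDatum c n) : x.Unramified ↔ x.bPrime = x.b := by
  obtain ⟨t, ht⟩ := exists_generator n (diff F)⁻¹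
  obtain ⟨v, hv⟩ := Tors.exists_mk (x.β (Tors.mk t))
  rw [x.bPrime_eq ht hv]
  constructor
  · rintro ⟨β', hβ'⟩
    obtain ⟨w, hw⟩ := Tors.exists_mk (β' (Tors.mk t))
    have h := LinearMap.congr_fun hβ' (Tors.mk t)
    rw [LinearMap.comp_apply, hw, torsMap_mk, hv, Tors.mk_eq_mk_iff] at h
    have h1 := x.j_mem _ h
    rw [map_sub, x.j_comp_i] at h1
    exact (adjoin_congr h1).symm.trans (adjoin_zero x.b)
  · intro h
    have h1 : x.j v.1 ∈ x.b.mod := by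
      have := mem_adjoin_self x.b (x.j v.1)
      rwa [h] at this
    obtain ⟨l, hl, hlj⟩ := x.j_surj _ h1
    obtain ⟨y, hy⟩ := x.exists_i_eq (v := v.1 - l) (by rw [map_sub, hlj, sub_self])
    have hyd : y ∈ divBy n x.a.star.mod := by
      intro s hs
      rw [← x.i_mem_iff, map_int_smul, hy]
      exact sub_mem v.2 (le_divBy n _ hl) s hs
    have hτ : x.β (Tors.mk t) = torsMap n x.i x.i_mem (Tors.mk ⟨y, hyd⟩) := by
      rw [hv, torsMap_mk, Tors.mk_eq_mk_iff]
      change v.1 - x.i y ∈ x.L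
      rwa [hy, sub_sub_cancel]
    have hinj : Function.Injective (torsMap n x.i x.i_mem) :=
      torsMap_injective n _ _ (fun y _ h => (x.i_mem_iff y).1 h)
    have hrange : ∀ s, x.β s ∈ LinearMap.range (torsMap n x.i x.i_mem) := by
      intro s
      have hs : s ∈ Submodule.span (𝓞 F) {(Tors.mk t : Tors n (diff F)⁻¹.mod)} := by
        rw [ht]; trivial
      obtain ⟨r, rfl⟩ := Submodule.mem_span_singleton.1 hs
      rw [map_smul, hτ]
      exact Submodule.smul_mem _ _ (LinearMap.mem_range_self _ _)
    refine ⟨(LinearEquiv.ofInjective _ hinj).symm.toLinearMap ∘ₗ x.β.codRestrict _ hrange, ?_⟩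
    refine LinearMap.ext fun s => ?_
    have := (LinearEquiv.ofInjective _ hinj).apply_symm_apply (x.β.codRestrict _ hrange s)
    exact congrArg Subtype.val this

end BPrime

/-! ### Cusps given by matrices -/

section CuspLevel

variable {F : Type*} [Field F] [NumberField F]
variable {c : FracId F} {n : Ideal (𝓞 F)} [NeZero n] {y₀ : F}

theorem Cusp.mk_eq_iff {D : Subgroup Fˣ} {x x' : LevelDatum c n} :
    Cusp.mk D x = Cusp.mk D x' ↔ LevelDatum.CuspEquiv D x x' := Quotient.eq (r := cuspSetoid D c n)

theorem Cusp.exists_mk {D : Subgroup Fˣ} (C : Cusp D c n) : ∃ x, Cusp.mk D x = C :=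
  Quotient.exists_rep C

variable {D : Subgroup Fˣ}

theorem Cusp.isGivenBy_iff (hy₀ : (n : FractionalIdeal (𝓞 F)⁰ F) +
      FractionalIdeal.spanSingleton (𝓞 F)⁰ y₀ * (c : FractionalIdeal (𝓞 F)⁰ F) = 1)
    {C : Cusp D c n} {g g' : GL (Fin 2) F} (hg : g ∈ GDint D)
    (hg' : g' ∈ GDint D) (hC : C.IsGivenBy y₀ g) :
    C.IsGivenBy y₀ g' ↔ ∃ t ∈ TZUQ D, ∃ δ ∈ Gam D c n, g' = t * g * δ := by
  obtain ⟨x, hx, rfl⟩ := hC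
  constructor
  · rintro ⟨x', hx', h⟩
    exact (transform_equiv_iff hy₀ hg hg' hx hx').1 (Cusp.mk_eq_iff.1 h.symm)
  · intro h
    obtain ⟨x', hx'⟩ := exists_transform (c := c) hy₀ hg'
    exact ⟨x', hx', (Cusp.mk_eq_iff.2 ((transform_equiv_iff hy₀ hg hg' hx hx').2 h)).symm⟩

theorem Cusp.existsUnique_isGivenBy (hy₀ : (n : FractionalIdeal (𝓞 F)⁰ F) +
      FractionalIdeal.spanSingleton (𝓞 F)⁰ y₀ * (c : FractionalIdeal (𝓞 F)⁰ F) = 1)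
    {g : GL (Fin 2) F} (hg : g ∈ GDint D) :
    ∃! C : Cusp D c n, C.IsGivenBy y₀ g := by
  obtain ⟨x, hx⟩ := exists_transform (c := c) hy₀ hg
  refine ⟨Cusp.mk D x, ⟨x, hx, rfl⟩, ?_⟩
  rintro _ ⟨x', hx', rfl⟩
  exact Cusp.mk_eq_iff.2 ((transform_equiv_iff hy₀ hg hg hx' hx).2
    ⟨1, one_mem _, 1, one_mem _, by simp⟩)

/-- Surjectivity of the double coset map: splitting the sequence makes the tuple standard, and
strong approximation then realizes its level vector. -/
theorem Cusp.exists_normalized_isGivenBy (hy₀ : (n : FractionalIdeal (𝓞 F)⁰ F) +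
      FractionalIdeal.spanSingleton (𝓞 F)⁰ y₀ * (c : FractionalIdeal (𝓞 F)⁰ F) = 1)
    (C : Cusp D c n) :
    ∃ γ ∈ GDint D, IsNormalized c C.b γ ∧ C.IsGivenBy y₀ γ⁻¹ := by
  obtain ⟨x, rfl⟩ := C.exists_mk
  obtain ⟨x', hxx', hs, hL⟩ := exists_std_equiv D x
  obtain ⟨γ, hγ, hn, ht⟩ := exists_isTransform hy₀ D x' hs hL
  exact ⟨γ, hγ, hn, x', ht, (Cusp.mk_eq_iff.2 hxx').symm⟩

theorem Cusp.b_eq {C : Cusp D c n} {γ : GL (Fin 2) F} (h : C.IsGivenBy y₀ γ⁻¹) :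
    (C.b : FractionalIdeal (𝓞 F)⁰ F) =
      prin (γ.1 0 0) + prin (γ.1 1 0) * (c.star : FractionalIdeal (𝓞 F)⁰ F) := by
  obtain ⟨x, hx, rfl⟩ := h
  exact hx.b_eq

theorem Cusp.isGivenBy_mul_unip (hy₀ : (n : FractionalIdeal (𝓞 F)⁰ F) +
      FractionalIdeal.spanSingleton (𝓞 F)⁰ y₀ * (c : FractionalIdeal (𝓞 F)⁰ F) = 1)
    {C : Cusp D c n} {γ : GL (Fin 2) F} (hγ : γ ∈ GDint D)
    (hC : C.IsGivenBy y₀ γ⁻¹) (ξ : F) : C.IsGivenBy y₀ (γ * unip ξ)⁻¹ := by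
  have hu := TZUQ_le_GDint D (unip_mem_TZUQ D ξ)
  refine (Cusp.isGivenBy_iff hy₀ (inv_mem hγ) (inv_mem (mul_mem hγ hu)) hC).2
    ⟨(unip ξ)⁻¹, inv_mem (unip_mem_TZUQ D ξ), 1, one_mem _, ?_⟩
  rw [mul_inv_rev, mul_one]

/-- The ideal `b'` of the transform by `γ⁻¹`. -/
theorem LevelDatum.IsTransform.bPrime_eq (hy₀ : (n : FractionalIdeal (𝓞 F)⁰ F) +
      FractionalIdeal.spanSingleton (𝓞 F)⁰ y₀ * (c : FractionalIdeal (𝓞 F)⁰ F) = 1)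
    {x : LevelDatum c n} {γ : GL (Fin 2) F}
    (h : x.IsTransform y₀ γ⁻¹) : (x.bPrime : FractionalIdeal (𝓞 F)⁰ F) =
      prin (γ.1 0 0) + prin (γ.1 1 0) * ((c * ofIdeal n).star : FractionalIdeal (𝓞 F)⁰ F) := by
  obtain ⟨t, ht⟩ := exists_generator n (diff F)⁻¹
  obtain ⟨v, hv, hβ⟩ := h.2.2 t
  have ht' := (span_mk_eq_top_iff t).1 ht
  rw [LevelDatum.bPrime_eq x ht hβ, coe_adjoin, h.1.2.1, h.b_eq, hv, rowAct_inv_apply,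
    vecMul_zero_coord]
  simp only [Matrix.cons_val_zero, Matrix.cons_val_one, zero_mul, zero_add]
  have e : (c * ofIdeal n).star = (ofIdeal n)⁻¹ * c.star := Additive.ofMul.injective (by
    simp only [FracId.star, ofMul_mul, ofMul_inv]; abel)
  have e2 : ((c * diff F : FracId F) : FractionalIdeal (𝓞 F)⁰ F) *
      (c.star : FractionalIdeal (𝓞 F)⁰ F) = 1 := by
    rw [← Units.val_mul, ← Units.val_one]
    exact congrArg _ (Additive.ofMul.injective (by
      simp only [FracId.star, ofMul_mul, ofMul_inv, ofMul_one]; abel))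
  -- Multiplying `𝓞 + y₀t c𝔡 = n⁻¹` by `c^*` gives `(cn)^* = c^* + y₀t𝓞`, since `c𝔡 c^* = 𝓞`.
  rw [e, Units.val_mul, ← one_add_aux hy₀ ht', add_mul, one_mul, mul_assoc (prin (y₀ * t.1)), e2,
    mul_one, mul_add, add_assoc, mul_comm _ (prin (y₀ * t.1)), prin_mul]

end CuspLevel

/-! ### Automorphism groups and the exact sequence -/

section Stabilizers

variable {F : Type*} [Field F] [NumberField F]
variable {D : Subgroup Fˣ} {c b p q : FracId F} {n : Ideal (𝓞 F)} [NeZero n] {y₀ : F}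

/-- An integral multiplier preserves `f` anyway, so carrying `f + 𝓞z` into `f` only has to be tested
on `z`. -/
theorem int_mul_mem_iff_adjoin {f : FracId F} {z : F} {r : F}
    (hr : r ∈ (1 : FracId F).mod) : r * z ∈ f.mod ↔ r ∈ (f * (adjoin f z)⁻¹).mod := by
  obtain ⟨s, rfl⟩ := mem_mod_one.1 hr
  rw [mem_mul_inv_iff]
  constructor
  · intro h y hy
    obtain ⟨y', hy', k, rfl⟩ := mem_adjoin.1 hy
    have := add_mem (int_mul_mem f s hy') (int_mul_mem f k h)
    convert this using 1
    ring
  · intro h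
    exact h _ (mem_adjoin_self f z)

/-- `A b'b⁻¹ = A + A b⁻¹v₀` for `b' = b + 𝓞 v₀`. -/
theorem mem_mul_adjoin_iff {A : FracId F} {v₀ z : F} :
    z ∈ (A * adjoin b v₀ * b⁻¹).mod ↔ ∃ ξ ∈ (A * b⁻¹).mod, ξ * v₀ + z ∈ A.mod := by
  have e : ((A * adjoin b v₀ * b⁻¹ : FracId F) : FractionalIdeal (𝓞 F)⁰ F) =
      A + prin v₀ * (A * b⁻¹ : FracId F) := by
    have e1 : (A * adjoin b v₀ * b⁻¹ : FracId F) = adjoin b v₀ * (A * b⁻¹) := by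
      rw [mul_comm A, mul_assoc]
    rw [e1, Units.val_mul, coe_adjoin, add_mul, ← Units.val_mul, mul_left_comm, mul_inv_cancel,
      mul_one]
  rw [mem_mod, e, mem_add_iff]
  constructor
  · rintro ⟨x, hx, _, hy, rfl⟩
    obtain ⟨ξ, hξ, rfl⟩ := mem_prin_mul.1 hy
    refine ⟨-ξ, neg_mem (S := Submodule (𝓞 F) F) hξ, ?_⟩
    rw [show -ξ * v₀ + (x + v₀ * ξ) = x by ring]
    exact hx
  · rintro ⟨ξ, hξ, h⟩
    exact ⟨_, h, _, mem_prin_mul.2 ⟨-ξ, neg_mem (S := Submodule (𝓞 F) F) hξ, rfl⟩, by ring⟩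

theorem triMat_inj {u ε u' ε' : (𝓞 F)ˣ} {ξ ξ' : F} (h : triMat u ε ξ = triMat u' ε' ξ') :
    u = u' ∧ ε = ε' ∧ ξ = ξ' := by
  have h' : (triMat u ε ξ).1 = (triMat u' ε' ξ').1 := congrArg _ h
  rw [triMat_val, triMat_val] at h'
  have h00 := congrFun (congrFun h' 0) 0
  have h01 := congrFun (congrFun h' 0) 1
  have h11 := congrFun (congrFun h' 1) 1
  simp only [Matrix.of_apply, Matrix.cons_val_zero, Matrix.cons_val_one] at h00 h01 h11
  have hu : u = u' := inv_injective (Units.ext (NumberField.RingOfIntegers.ext h11))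
  subst hu
  exact ⟨rfl, Units.ext (NumberField.RingOfIntegers.ext (mul_left_cancel₀ (unit_coe_ne_zero u) h00)), h01⟩

theorem TZUQ_le_borelQ (D : Subgroup Fˣ) : TZUQ D ≤ borelQ D := by
  rintro _ ⟨u, ε, hε, ξ, rfl⟩
  refine ⟨(TZUQ_le_GDint D (triMat_mem u hε ξ)).1, ?_⟩
  rw [triMat_val]
  simp

theorem Gplus_vecMul_mem {L : Submodule (𝓞 F) (Fin 2 → F)} {g : GL (Fin 2) F}
    (hg : g ∈ Gplus D L) (v : Fin 2 → F) : v ∈ L ↔ v ᵥ* g.1 ∈ L := by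
  rw [← rowAct_inv_apply]
  exact (inv_mem hg).2 v

theorem mem_Gplus_of_vecMul {L : Submodule (𝓞 F) (Fin 2 → F)} {g : GL (Fin 2) F}
    (hg : g ∈ GDplus D) (h : ∀ v : Fin 2 → F, v ∈ L ↔ v ᵥ* g.1 ∈ L) : g ∈ Gplus D L := by
  refine ⟨hg, fun v => ?_⟩
  rw [h (rowAct g v), ← rowAct_inv_apply, rowAct_inv_rowAct]

theorem borel_entries {g : GL (Fin 2) F} (hg : g ∈ borelQ D) (v : Fin 2 → F) :
    v ᵥ* g.1 = ![v 0 * g.1 0 0, v 0 * g.1 0 1 + v 1 * g.1 1 1] := by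
  apply vec_ext
  · rw [vecMul_zero_coord, hg.2]; simp
  · rw [vecMul_one_coord]; simp

/-- On the two axes the diagonal entries of `g` act as multipliers of `p` and `q`, and so do those
of `g⁻¹`; hence they are units. -/
theorem exists_triMat_of_borel {g : GL (Fin 2) F} (hb : g ∈ borelQ D)
    (hg : g ∈ Gplus D (prodLat p q)) :
    ∃ u : (𝓞 F)ˣ, ∃ ε ∈ unitsDPlus D, ∃ ξ, g = triMat u ε ξ := by
  have key : ∀ h : GL (Fin 2) F, h ∈ borelQ D → h ∈ Gplus D (prodLat p q) →
      (∀ x ∈ p.mod, h.1 0 0 * x ∈ p.mod) ∧ ∀ x ∈ q.mod, h.1 1 1 * x ∈ q.mod := by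
    intro h hb hh
    constructor
    · intro x hx
      have := (Gplus_vecMul_mem hh ![x, 0]).1 ⟨by simpa using hx, by simp⟩
      rw [borel_entries hb] at this
      simpa [mul_comm] using this.1
    · intro x hx
      have := (Gplus_vecMul_mem hh ![0, x]).1 ⟨by simp, by simpa using hx⟩
      rw [borel_entries hb] at this
      simpa [mul_comm] using this.2
  have e : g.1 * (g⁻¹).1 = 1 := by rw [← Units.val_mul, mul_inv_cancel, Units.val_one]
  have e0 := congrFun (congrFun e 0) 0
  have e1 := congrFun (congrFun e 1) 1
  have hi := (inv_mem hb).2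
  simp only [Matrix.mul_apply, Fin.sum_univ_two, Matrix.one_apply_eq] at e0 e1
  rw [hi, mul_zero, add_zero] at e0
  rw [hb.2, zero_mul, zero_add] at e1
  obtain ⟨u₀, h0, -⟩ := exists_unit_of_mul_mem e0 (key g hb hg).1
    (key _ (inv_mem hb) (inv_mem hg)).1
  obtain ⟨u₁, h1, -⟩ := exists_unit_of_mul_mem e1 (key g hb hg).2
    (key _ (inv_mem hb) (inv_mem hg)).2
  -- Solving `uε = u₀` and `u⁻¹ = u₁` for the parameters of `triMat`.
  have hval : g = triMat u₁⁻¹ (u₀ * u₁) (g.1 0 1) := by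
    refine Units.ext ?_
    rw [triMat_val, Matrix.eta_fin_two g.1, hb.2, ← h0, ← h1, inv_inv]
    congr 2
    rw [← map_mul, ← Units.val_mul, mul_comm u₀, inv_mul_cancel_left]
    simp
  refine ⟨u₁⁻¹, u₀ * u₁, ?_, _, hval⟩
  have hdet : Matrix.GeneralLinearGroup.det g = unitsToField (u₀ * u₁) := by
    rw [hval, det_triMat]
  have h2 := hg.1
  exact ⟨hdet ▸ h2.2, hdet ▸ h2.1⟩

theorem triMat_mem_Gplus_iff (u : (𝓞 F)ˣ) {ε : (𝓞 F)ˣ} (hε : ε ∈ unitsDPlus D) (ξ : F) :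
    triMat u ε ξ ∈ Gplus D (prodLat p q) ↔ ξ ∈ (q * p⁻¹).mod := by
  constructor
  · intro h
    rw [mem_mul_inv_iff]
    intro x hx
    have := (Gplus_vecMul_mem h ![x, 0]).1 ⟨by simpa using hx, by simp⟩
    rw [vecMul_triMat] at this
    simpa using this.2
  · intro h
    rw [mem_mul_inv_iff] at h
    refine mem_Gplus_of_vecMul (GDint_le_GDplus D (TZUQ_le_GDint D (triMat_mem u hε ξ)))
      fun v => ?_
    rw [vecMul_triMat, mem_prodLat, mem_prodLat]
    simp only [Matrix.cons_val_zero, Matrix.cons_val_one]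
    rw [← map_mul, ← Units.val_mul, unit_mul_mem_iff]
    refine and_congr_right fun h0 => ?_
    rw [Submodule.add_mem_iff_right _ (h _ h0), unit_mul_mem_iff]

theorem mem_conjGam {γ h : GL (Fin 2) F} :
    h ∈ conjGam D c n γ ↔ γ * h * γ⁻¹ ∈ Gam D c n := by
  constructor
  · rintro ⟨δ, hδ, rfl⟩
    have : γ * (γ⁻¹ * δ * γ⁻¹⁻¹) * γ⁻¹ = δ := by group
    change γ * (γ⁻¹ * δ * γ⁻¹⁻¹) * γ⁻¹ ∈ _
    rwa [this]
  · intro h'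
    refine ⟨_, h', ?_⟩
    simp only [MulEquiv.coe_toMonoidHom, MulAut.conj_apply]
    group

theorem conj_mem_GDplus {γ h : GL (Fin 2) F} : γ * h * γ⁻¹ ∈ GDplus D ↔ h ∈ GDplus D := by
  have : Matrix.GeneralLinearGroup.det (γ * h * γ⁻¹) = Matrix.GeneralLinearGroup.det h := by
    rw [map_mul, map_mul, map_inv, mul_comm (Matrix.GeneralLinearGroup.det γ),
      mul_inv_cancel_right]
  constructor
  · rintro ⟨h1, h2⟩
    exact ⟨show _ ∈ D from this ▸ h1, show _ ∈ totPos F from this ▸ h2⟩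
  · rintro ⟨h1, h2⟩
    exact ⟨show _ ∈ D from this ▸ h1, show _ ∈ totPos F from this ▸ h2⟩

/-- Right multiplication by `γ` carries `𝓞 ⊕ c^*` onto `b ⊕ (bc)^*`, so conjugation exchanges the
two stabilizers. -/
theorem conj_mem_Gplus_iff {γ h : GL (Fin 2) F} (hγ : γ ∈ GDint D) (hn : IsNormalized c b γ) :
    γ * h * γ⁻¹ ∈ Gplus D (baseLat c) ↔ h ∈ Gplus D (prodLat b (b * c).star) := by
  have key : ∀ v : Fin 2 → F, (v ᵥ* (γ * h * γ⁻¹).1) ᵥ* γ.1 = (v ᵥ* γ.1) ᵥ* h.1 := fun v => by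
    rw [Matrix.vecMul_vecMul, Matrix.vecMul_vecMul, ← Units.val_mul, ← Units.val_mul,
      inv_mul_cancel_right]
  constructor
  · intro H
    refine mem_Gplus_of_vecMul (conj_mem_GDplus.1 H.1) fun v => ?_
    have h1 := Gplus_vecMul_mem H (rowAct γ v)
    rw [mem_baseLat_iff_normalized hγ hn, mem_baseLat_iff_normalized hγ hn, key,
      ← rowAct_inv_apply γ, rowAct_inv_rowAct] at h1
    exact h1
  · intro H
    refine mem_Gplus_of_vecMul (conj_mem_GDplus.2 H.1) fun v => ?_
    rw [mem_baseLat_iff_normalized hγ hn, mem_baseLat_iff_normalized hγ hn, key]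
    exact Gplus_vecMul_mem H _

/-- Transport by `γ` of the description of `Γ` as the group fixing `β₀`. One vector suffices,
because `n⁻¹𝔡⁻¹ = 𝔡⁻¹ + 𝓞t` and the part coming from `𝔡⁻¹` already lies in the lattice. -/
theorem mem_conjGam_iff (hy₀ : (n : FractionalIdeal (𝓞 F)⁰ F) +
      FractionalIdeal.spanSingleton (𝓞 F)⁰ y₀ * (c : FractionalIdeal (𝓞 F)⁰ F) = 1)
    {γ h : GL (Fin 2) F} (hγ : γ ∈ GDint D) (hn : IsNormalized c b γ)
    {t : divBy n (diff F)⁻¹.mod} (ht : adjoin (diff F)⁻¹ t.1 = (ofIdeal n)⁻¹ * (diff F)⁻¹) :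
    h ∈ conjGam D c n γ ↔ h ∈ Gplus D (prodLat b (b * c).star) ∧
      ((![0, y₀ * t.1] : Fin 2 → F) ᵥ* γ.1) ᵥ* h.1 - ![0, y₀ * t.1] ᵥ* γ.1 ∈
        prodLat b (b * c).star := by
  rw [mem_conjGam]
  have key : ∀ s : F, (![0, y₀ * s] : Fin 2 → F) ᵥ* (γ * h * γ⁻¹).1 - ![0, y₀ * s] ∈ baseLat c ↔
      ((![0, y₀ * s] : Fin 2 → F) ᵥ* γ.1) ᵥ* h.1 - ![0, y₀ * s] ᵥ* γ.1 ∈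
        prodLat b (b * c).star := fun s => by
    rw [mem_baseLat_iff_normalized hγ hn, Matrix.sub_vecMul, Matrix.vecMul_vecMul,
      Matrix.vecMul_vecMul _ γ.1, ← Units.val_mul, ← Units.val_mul, inv_mul_cancel_right]
  constructor
  · intro H
    exact ⟨(conj_mem_Gplus_iff hγ hn).1 H.1, (key _).1 ((mem_Gam_iff hy₀ H.1).1 H _ t.2)⟩
  · rintro ⟨H, H'⟩
    rw [mem_Gam_iff hy₀ ((conj_mem_Gplus_iff hγ hn).2 H)]
    intro s hs
    rw [key]
    rw [mem_divBy_mod, ← ht] at hs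
    obtain ⟨z, hz, r, rfl⟩ := mem_adjoin.1 hs
    have hz' : (![0, y₀ * z] : Fin 2 → F) ᵥ* γ.1 ∈ prodLat b (b * c).star := by
      rw [← mem_baseLat_iff_normalized hγ hn, aux_vec_mem_iff hy₀ (le_divBy n _ hz)]
      exact hz
    have e : (![0, y₀ * (z + r * t.1)] : Fin 2 → F) = ![0, y₀ * z] + (r : F) • ![0, y₀ * t.1] := by
      apply vec_ext
      · simp
      · simp [smul_eq_coe_mul]; ring
    have h1 := add_mem (sub_mem ((Gplus_vecMul_mem H _).1 hz') hz')
      ((prodLat b (b * c).star).smul_mem r H')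
    convert h1 using 1
    rw [e, Matrix.add_vecMul, Matrix.add_vecMul, Matrix.smul_vecMul, Matrix.smul_vecMul]
    rw [show ∀ w : Fin 2 → F, r • w = (r : F) • w from fun w => by
      rw [← algebraMap_smul F r w]]
    rw [smul_sub]
    abel

theorem triMat_mem_conjGam_iff (hy₀ : (n : FractionalIdeal (𝓞 F)⁰ F) +
      FractionalIdeal.spanSingleton (𝓞 F)⁰ y₀ * (c : FractionalIdeal (𝓞 F)⁰ F) = 1)
    {γ : GL (Fin 2) F} (hγ : γ ∈ GDint D) (hn : IsNormalized c b γ)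
    {t : divBy n (diff F)⁻¹.mod} (ht : adjoin (diff F)⁻¹ t.1 = (ofIdeal n)⁻¹ * (diff F)⁻¹)
    {w : Fin 2 → F} (hw : w = ![0, y₀ * t.1] ᵥ* γ.1)
    (u : (𝓞 F)ˣ) {ε : (𝓞 F)ˣ} (hε : ε ∈ unitsDPlus D) (ξ : F) :
    triMat u ε ξ ∈ conjGam D c n γ ↔ ξ ∈ ((b * c).star * b⁻¹).mod ∧
      (((u : 𝓞 F) : F) * ((ε : 𝓞 F) : F) - 1) * w 0 ∈ b.mod ∧
      ξ * w 0 + ((((u⁻¹ : (𝓞 F)ˣ) : 𝓞 F) : F) - 1) * w 1 ∈ (b * c).star.mod := by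
  rw [mem_conjGam_iff hy₀ hγ hn ht, triMat_mem_Gplus_iff u hε, ← hw, vecMul_triMat, mem_prodLat]
  simp only [Pi.sub_apply, Matrix.cons_val_zero, Matrix.cons_val_one]
  rw [sub_one_mul, sub_one_mul, add_sub_assoc]

theorem unit_sub_one_mem_iff {f : FracId F} (u : (𝓞 F)ˣ) :
    (((u⁻¹ : (𝓞 F)ˣ) : 𝓞 F) : F) - 1 ∈ f.mod ↔ ((u : 𝓞 F) : F) - 1 ∈ f.mod := by
  rw [← unit_mul_mem_iff f u, mul_sub, unit_mul_inv_coe, mul_one, ← neg_mem_iff, neg_sub]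

/-- The congruence conditions on the diagonal entries. -/
theorem mem_unitsC_iff {A : FracId F} {v : Fin 2 → F}
    (hv : adjoin (A * adjoin b (v 0) * b⁻¹) (v 1) = (ofIdeal n)⁻¹ * A)
    (p : (𝓞 F)ˣ × unitsDPlus D) : p ∈ unitsC D n b (adjoin b (v 0)) ↔
      (((p.1 : 𝓞 F) : F) * ((p.2.1 : 𝓞 F) : F) - 1) * v 0 ∈ b.mod ∧
      ∃ ξ ∈ (A * b⁻¹).mod, ξ * v 0 + ((((p.1⁻¹ : (𝓞 F)ˣ) : 𝓞 F) : F) - 1) * v 1 ∈ A.mod := by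
  -- Existence of `ξ` says that `(u⁻¹ - 1)v₁` lies in `Ab'b⁻¹`. As `v₁` generates `n⁻¹A` over that
  -- ideal, this becomes `u⁻¹ - 1 ∈ nb'b⁻¹`, a condition on `u` alone.
  rw [int_mul_mem_iff_adjoin (mem_mod_one.2 ⟨(p.1 : 𝓞 F) * (p.2.1 : 𝓞 F) - 1, by simp⟩),
    ← mem_mul_adjoin_iff, int_mul_mem_iff_adjoin (mem_mod_one.2 ⟨((p.1⁻¹ : (𝓞 F)ˣ) : 𝓞 F) - 1,
      by simp⟩), hv, unit_sub_one_mem_iff]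
  have e : A * adjoin b (v 0) * b⁻¹ * ((ofIdeal n)⁻¹ * A)⁻¹ = ofIdeal n * adjoin b (v 0) * b⁻¹ :=
    Additive.ofMul.injective (by simp only [ofMul_mul, ofMul_inv]; abel)
  rw [e]
  exact and_comm

theorem eq_triMat_of_mem {γ h : GL (Fin 2) F} (hγ : γ ∈ GDint D) (hn : IsNormalized c b γ)
    (hh : h ∈ conjGam D c n γ ⊓ borelQ D) :
    ∃ u : (𝓞 F)ˣ, ∃ ε ∈ unitsDPlus D, ∃ ξ, h = triMat u ε ξ :=
  exists_triMat_of_borel hh.2 ((conj_mem_Gplus_iff hγ hn).1 (mem_conjGam.1 hh.1).1)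

/-- The exact sequence `0 → X^* → γ⁻¹Γγ ∩ B → 𝓞_C^× → 1`. -/
theorem exists_exact_sequence (hy₀ : (n : FractionalIdeal (𝓞 F)⁰ F) +
      FractionalIdeal.spanSingleton (𝓞 F)⁰ y₀ * (c : FractionalIdeal (𝓞 F)⁰ F) = 1)
    {γ : GL (Fin 2) F} (hγ : γ ∈ GDint D) (hn : IsNormalized c b γ)
    {t : divBy n (diff F)⁻¹.mod} (ht : adjoin (diff F)⁻¹ t.1 = (ofIdeal n)⁻¹ * (diff F)⁻¹)
    {w : Fin 2 → F} (hw : w = ![0, y₀ * t.1] ᵥ* γ.1)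
    (hprim : adjoin ((b * c).star * adjoin b (w 0) * b⁻¹) (w 1) = (ofIdeal n)⁻¹ * (b * c).star)
    {b' : FracId F} (hb' : b' = adjoin b (w 0)) :
    ∃ (ι : Multiplicative (c * b * b').star.mod →*
          (conjGam D c n γ ⊓ borelQ D : Subgroup (GL (Fin 2) F)))
        (π : (conjGam D c n γ ⊓ borelQ D : Subgroup (GL (Fin 2) F)) →* unitsC D n b b'),
      (∀ ξ : (c * b * b').star.mod,
        (ι (Multiplicative.ofAdd ξ) : GL (Fin 2) F) = unip (ξ : F)) ∧
      (∀ h : (conjGam D c n γ ⊓ borelQ D : Subgroup (GL (Fin 2) F)), (h : GL (Fin 2) F).1 0 0 =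
          (((π h).1.1 : 𝓞 F) : F) * (((π h).1.2.1 : 𝓞 F) : F) ∧
        (h : GL (Fin 2) F).1 1 1 = ((((π h).1.1)⁻¹ : (𝓞 F)ˣ) : 𝓞 F)) ∧
      Function.Injective ι ∧ π.ker = ι.range ∧ Function.Surjective π := by
  have hX : (c * b * b').star = (b * c).star * b'⁻¹ := Additive.ofMul.injective (by
    simp only [FracId.star, ofMul_mul, ofMul_inv]; abel)
  -- Stabilizing the lattice means `ξb ⊆ (bc)^*`, and fixing the level vector means `ξw₀ ∈ (bc)^*`.
  -- Together they say `ξb' ⊆ (bc)^*`.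
  have hunip : ∀ ξ : F, triMat 1 1 ξ ∈ conjGam D c n γ ↔ ξ ∈ (c * b * b').star.mod := by
    intro ξ
    rw [triMat_mem_conjGam_iff hy₀ hγ hn ht hw 1 (one_mem _), hX, mem_mul_inv_iff, mem_mul_inv_iff,
      hb']
    simp only [Units.val_one, map_one, mul_one, sub_self, zero_mul, zero_mem, true_and, inv_one,
      add_zero]
    constructor
    · rintro ⟨h1, h2⟩ y hy
      obtain ⟨z, hz, r, rfl⟩ := mem_adjoin.1 hy
      have := add_mem (h1 z hz) (int_mul_mem _ r h2)
      convert this using 1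
      ring
    · intro h
      exact ⟨fun y hy => h y (le_adjoin b _ hy), h _ (mem_adjoin_self b _)⟩
  have hB : ∀ (u : (𝓞 F)ˣ) {ε : (𝓞 F)ˣ} (hε : ε ∈ unitsDPlus D) (ξ : F),
      triMat u ε ξ ∈ borelQ D := fun u ε hε ξ => TZUQ_le_borelQ D (triMat_mem u hε ξ)
  have hex : ∀ h : (conjGam D c n γ ⊓ borelQ D : Subgroup (GL (Fin 2) F)),
      ∃ p : unitsC D n b b', ∃ ξ, (h : GL (Fin 2) F) = triMat p.1.1 p.1.2.1 ξ := by
    intro h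
    obtain ⟨u, ε, hε, ξ, e⟩ := eq_triMat_of_mem hγ hn h.2
    refine ⟨⟨(u, ⟨ε, hε⟩), ?_⟩, ξ, e⟩
    have h1 : triMat u ε ξ ∈ conjGam D c n γ := e ▸ h.2.1
    rw [triMat_mem_conjGam_iff hy₀ hγ hn ht hw u hε] at h1
    rw [hb', mem_unitsC_iff hprim]
    exact ⟨h1.2.1, ξ, h1.1, h1.2.2⟩
  choose π ξ hπ using hex
  -- A triangular matrix determines its parameters, so the chosen `π` is the diagonal part.
  -- Multiplicativity, part of the kernel computation and surjectivity rest on this.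
  have huniq : ∀ (h : (conjGam D c n γ ⊓ borelQ D : Subgroup (GL (Fin 2) F))) (p : unitsC D n b b') (ξ' : F),
      (h : GL (Fin 2) F) = triMat p.1.1 p.1.2.1 ξ' → π h = p := by
    intro h p ξ' e
    rw [hπ] at e
    obtain ⟨h1, h2, -⟩ := triMat_inj e
    exact Subtype.ext (Prod.ext h1 (Subtype.ext h2))
  have hπmul : ∀ h h', π (h * h') = π h * π h' := by
    intro h h'
    refine huniq _ _ (((unitsToField (π h).1.1 * unitsToField (π h).1.2.1 : Fˣ) : F) * ξ h' +
      ξ h * (((unitsToField (π h').1.1)⁻¹ : Fˣ) : F)) ?_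
    rw [Subgroup.coe_mul, hπ h, hπ h', triMat, triMat, upperMat_mul, triMat]
    congr 1
    · simp only [Subgroup.coe_mul, Prod.fst_mul, Prod.snd_mul, map_mul]
      rw [mul_mul_mul_comm]
    · simp only [Subgroup.coe_mul, Prod.fst_mul, map_mul, mul_inv]
  let ι : Multiplicative (c * b * b').star.mod →*
      (conjGam D c n γ ⊓ borelQ D : Subgroup (GL (Fin 2) F)) :=
    MonoidHom.mk' (fun x => ⟨unip (x.toAdd : F), by
      rw [unip_eq_triMat]
      exact ⟨(hunip _).2 x.toAdd.2, hB 1 (one_mem _) _⟩⟩) (fun x y => Subtype.ext (by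
        change unip _ = unip _ * unip _
        rw [unip, unip, unip, upperMat_mul]
        congr 1
        · simp
        · simp
        · simp [add_comm]))
  refine ⟨ι, MonoidHom.mk' π hπmul, fun _ => rfl, fun h => ?_, ?_, ?_, ?_⟩
  · change (h : GL (Fin 2) F).1 0 0 = (((π h).1.1 : 𝓞 F) : F) * (((π h).1.2.1 : 𝓞 F) : F) ∧
      (h : GL (Fin 2) F).1 1 1 = ((((π h).1.1)⁻¹ : (𝓞 F)ˣ) : 𝓞 F)
    have := hπ h
    generalize (π h).1.1 = u, (π h).1.2.1 = ε, ξ h = z at this ⊢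
    rw [this, triMat_val]
    simp
  · intro x y hxy
    have h1 : unip (x.toAdd : F) = unip (y.toAdd : F) := congrArg Subtype.val hxy
    rw [unip_eq_triMat, unip_eq_triMat] at h1
    exact Multiplicative.toAdd.injective (Subtype.ext (triMat_inj h1).2.2)
  · ext h
    rw [MonoidHom.mem_ker, MonoidHom.mem_range]
    constructor
    · intro h1
      have h1 : π h = 1 := h1
      have h2 := hπ h
      rw [h1] at h2
      have h2 : (h : GL (Fin 2) F) = triMat 1 1 (ξ h) := h2
      refine ⟨Multiplicative.ofAdd ⟨ξ h, (hunip _).1 (h2 ▸ h.2.1)⟩, Subtype.ext ?_⟩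
      change unip (ξ h) = _
      rw [h2, unip_eq_triMat]
    · rintro ⟨x, rfl⟩
      refine huniq _ 1 (x.toAdd : F) ?_
      change unip (x.toAdd : F) = triMat 1 1 _
      rw [unip_eq_triMat]
  · intro p
    obtain ⟨h1, z, hz, h2⟩ := (mem_unitsC_iff hprim p.1).1 (hb' ▸ p.2)
    refine ⟨⟨triMat p.1.1 p.1.2.1 z, (triMat_mem_conjGam_iff hy₀ hγ hn ht hw p.1.1 p.1.2.2 z).2
      ⟨hz, h1, h2⟩, hB p.1.1 p.1.2.2 z⟩, ?_⟩
    exact huniq _ p z rfl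

theorem mem_automorphisms_iff {x : LevelDatum c n} (hx : x.toCuspDatum.IsStandard)
    {τ : Tors n (diff F)⁻¹.mod} (hτ : Submodule.span (𝓞 F) {τ} = ⊤) {v : divBy n x.L}
    (hv : x.β τ = Tors.mk v) (f : (Fin 2 → F) ≃ₗ[F] (Fin 2 → F)) :
    f ∈ x.automorphisms D ↔ ∃ g ∈ TZUQ D, f = rowAct g⁻¹ ∧
      (∀ v, v ∈ x.L ↔ v ᵥ* g.1 ∈ x.L) ∧ v.1 ᵥ* g.1 - v.1 ∈ x.L := by
  constructor
  · rintro ⟨h, hc, hβ⟩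
    obtain ⟨u, ε, hε, ξ, hf⟩ := (compat_iff hx hx rfl rfl _).1 hc
    have hf' : ∀ v, f v = v ᵥ* (triMat u ε ξ).1 := hf
    refine ⟨_, triMat_mem u hε ξ, LinearEquiv.ext fun v => ?_, fun v => ?_, ?_⟩
    · rw [hf', rowAct_inv_apply]
    · rw [← hf', ← h]
    · have := hβ τ
      rw [hv, LatIso.onTors_mk, Tors.mk_eq_mk_iff] at this
      rw [← hf']
      exact this
  · rintro ⟨g, hg, rfl, hL, h⟩
    obtain ⟨u, ε, hε, ξ, rfl⟩ := hg
    have hL' : ∀ v, v ∈ x.L ↔ rowAct (triMat u ε ξ)⁻¹ v ∈ x.L := fun v => by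
      rw [rowAct_inv_apply, ← hL]
    refine ⟨hL', (compat_iff hx hx rfl rfl _).2 ⟨u, ε, hε, ξ, fun v => rowAct_inv_apply _ v⟩, ?_⟩
    intro s
    have : (LatIso.mk _ hL').onTors n ∘ₗ x.β = x.β := by
      refine linearMap_eq_of_span hτ ?_
      rw [LinearMap.comp_apply, hv, LatIso.onTors_mk, Tors.mk_eq_mk_iff]
      change rowAct (triMat u ε ξ)⁻¹ v.1 - v.1 ∈ x.L
      rwa [rowAct_inv_apply]
    exact LinearMap.congr_fun this s

/-- By `compat_iff` an automorphism is a triangular matrix, and it must preserve the lattice and fix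
the level vector `(0, y₀t)γ`; this is the criterion of `mem_conjGam_iff`. The inverse built into
`rowAct` is harmless for a group. -/
theorem automorphisms_eq (hy₀ : (n : FractionalIdeal (𝓞 F)⁰ F) +
      FractionalIdeal.spanSingleton (𝓞 F)⁰ y₀ * (c : FractionalIdeal (𝓞 F)⁰ F) = 1)
    {γ : GL (Fin 2) F} (hγ : γ ∈ GDint D) (hn : IsNormalized c b γ) {x : LevelDatum c n}
    (hx : x.IsTransform y₀ γ⁻¹) (hL : x.L = prodLat b (b * c).star) : x.automorphisms D =
      (((conjGam D c n γ ⊓ borelQ D).map rowAct :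
        Subgroup ((Fin 2 → F) ≃ₗ[F] (Fin 2 → F))) : Set ((Fin 2 → F) ≃ₗ[F] (Fin 2 → F))) := by
  obtain ⟨t, ht⟩ := exists_generator n (diff F)⁻¹
  have ht' := (span_mk_eq_top_iff t).1 ht
  obtain ⟨v, hv, hβ⟩ := hx.2.2 t
  rw [rowAct_inv_apply] at hv
  have hmem := fun h => mem_conjGam_iff (h := h) hy₀ hγ hn ht'
  ext f
  rw [mem_automorphisms_iff hx.1 ht hβ, hv, hL]
  constructor
  · rintro ⟨g, hg, rfl, h1, h2⟩
    refine ⟨g⁻¹, inv_mem ⟨(hmem g).2 ⟨?_, h2⟩, TZUQ_le_borelQ D hg⟩, rfl⟩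
    exact mem_Gplus_of_vecMul (GDint_le_GDplus D (TZUQ_le_GDint D hg)) h1
  · rintro ⟨g, hg, rfl⟩
    have hg' := inv_mem (S := Subgroup (GL (Fin 2) F)) hg
    obtain ⟨u, ε, hε, ξ, e⟩ := eq_triMat_of_mem hγ hn hg'
    obtain ⟨h1, h2⟩ := (hmem _).1 hg'.1
    exact ⟨g⁻¹, e ▸ triMat_mem u hε ξ, by rw [inv_inv], Gplus_vecMul_mem h1, h2⟩

theorem unitsToField_eq_one_iff (u : (𝓞 F)ˣ) : unitsToField u = 1 ↔ u = 1 := by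
  constructor
  · intro h
    refine Units.ext (NumberField.RingOfIntegers.ext ?_)
    rw [← unitsToField_coe, h]
    simp
  · rintro rfl
    exact map_one _

theorem unitsC_inter_det_one (b b' : FracId F) (p : (𝓞 F)ˣ × unitsDPlus D) :
    (p ∈ unitsC D n b b' ∧ Matrix.GeneralLinearGroup.det (triMat p.1 p.2.1 0) = 1) ↔
      (p.2 = 1 ∧ ((p.1 : 𝓞 F) : F) - 1 ∈ (b * b'⁻¹).mod ∧
        ((p.1 : 𝓞 F) : F) - 1 ∈ (ofIdeal n * b' * b⁻¹).mod) := by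
  obtain ⟨u, ε⟩ := p
  rw [det_triMat, unitsToField_eq_one_iff, OneMemClass.coe_eq_one, and_comm]
  refine and_congr_right fun h => ?_
  subst h
  change (_ ∧ _) ↔ _
  simp [and_comm]

theorem unitsCbar_inter_det_one (b b' : FracId F) (p : (𝓞 F)ˣ × unitsDPlus D) :
    (p ∈ unitsCbar D n b b' ∧ Matrix.GeneralLinearGroup.det (triMat p.1 p.2.1 0) = 1) ↔
      (p.2 = 1 ∧ ((p.1 : 𝓞 F) : F) - 1 ∈ (ofIdeal n * b' * b⁻¹).mod ∧
        ∃ k : ℤ, IsCoprime k (quotExponent b.mod b'.mod : ℤ) ∧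
          ((p.1 : 𝓞 F) : F) - (k : F) ∈ (b * b'⁻¹).mod) := by
  obtain ⟨u, ε⟩ := p
  rw [det_triMat, unitsToField_eq_one_iff, OneMemClass.coe_eq_one, and_comm]
  refine and_congr_right fun h => ?_
  subst h
  change (_ ∧ _) ↔ _
  simp

end Stabilizers

/-! ### The cusps with a given ideal `b` as double cosets -/

section Fibre

variable {F : Type*} [Field F] [NumberField F]
variable {D : Subgroup Fˣ} {c b : FracId F} {n : Ideal (𝓞 F)} [NeZero n] {y₀ : F}

/-- Always `b ⊆ b'`, since `c^* ⊆ (cn)^*`, and `p` already lies in `b`. So equality amounts to `q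
(cn)^* ⊆ b`. -/
theorem bPrime_eq_iff {b b' : FracId F} {p q : F}
    (hb : (b : FractionalIdeal (𝓞 F)⁰ F) = prin p + prin q * (c.star : FractionalIdeal (𝓞 F)⁰ F))
    (hb' : (b' : FractionalIdeal (𝓞 F)⁰ F) =
      prin p + prin q * ((c * ofIdeal n).star : FractionalIdeal (𝓞 F)⁰ F)) :
    b' = b ↔ q ∈ (ofIdeal n * b * c * diff F).mod := by
  have e : ofIdeal n * b * c * diff F = b * ((c * ofIdeal n).star)⁻¹ :=
    Additive.ofMul.injective (by simp only [FracId.star, ofMul_mul, ofMul_inv]; abel)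
  have hp : prin p ≤ (b : FractionalIdeal (𝓞 F)⁰ F) := hb ▸ le_add_left' _ _
  have hle : (c.star).mod ≤ (c * ofIdeal n).star.mod := by
    have : (c * ofIdeal n).star = (ofIdeal n)⁻¹ * c.star := Additive.ofMul.injective (by
      simp only [FracId.star, ofMul_mul, ofMul_inv]; abel)
    rw [this]
    exact le_ofIdeal_inv_mul n _
  rw [e, mem_mul_inv_iff]
  constructor
  · rintro rfl y hy
    rw [mem_mod, hb']
    exact le_add_right' _ _ (mem_prin_mul.2 ⟨y, hy, rfl⟩)
  · intro h
    refine Units.ext (le_antisymm ?_ ?_)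
    · rw [hb', fadd_le]
      refine ⟨hp, fun z hz => ?_⟩
      obtain ⟨y, hy, rfl⟩ := mem_prin_mul.1 hz
      exact h y hy
    · rw [hb, fadd_le, hb']
      refine ⟨le_add_left' _ _, le_trans (fun z hz => ?_) (le_add_right' _ _)⟩
      obtain ⟨y, hy, rfl⟩ := mem_prin_mul.1 hz
      exact mem_prin_mul.2 ⟨y, hle hy, rfl⟩

/-- Stabilizers of lattices have unit determinant. -/
theorem mem_GDint_of_Gplus_prodLat {p q : FracId F} {g : GL (Fin 2) F}
    (hg : g ∈ Gplus D (prodLat p q)) : g ∈ GDint D := by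
  have key : ∀ h ∈ Gplus D (prodLat p q),
      ((Matrix.GeneralLinearGroup.det h : Fˣ) : F) ∈ (1 : FracId F).mod := by
    intro h hh
    have e : (1 : FracId F) = p * q * q⁻¹ * p⁻¹ := by rw [mul_inv_cancel_right, mul_inv_cancel]
    rw [e]
    -- The product `det(h) x y` is the determinant of the images of `(x, 0)` and `(0, y)`, hence
    -- lies in `pq`.
    refine mem_mul_inv fun x hx => mem_mul_inv fun y hy => ?_
    have h1 := (Gplus_vecMul_mem hh ![x, 0]).1 ⟨by simpa using hx, by simp⟩
    have h2 := (Gplus_vecMul_mem hh ![0, y]).1 ⟨by simp, by simpa using hy⟩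
    have := prodLat_det_mem p q _ h1 _ h2
    simp only [vecMul_zero_coord, vecMul_one_coord, Matrix.cons_val_zero,
      Matrix.cons_val_one] at this
    rw [det_val_eq]
    convert this using 1
    ring
  obtain ⟨u, hu, -⟩ := exists_unit_of_mul_mem (f := 1)
    (μ := ((Matrix.GeneralLinearGroup.det g : Fˣ) : F))
    (ν := ((Matrix.GeneralLinearGroup.det g⁻¹ : Fˣ) : F))
    (by rw [map_inv, ← Units.val_mul, mul_inv_cancel, Units.val_one])
    (fun x hx => by simpa using mem_mod_mul (key g hg) hx)
    (fun x hx => by simpa using mem_mod_mul (key _ (inv_mem hg)) hx)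
  exact ⟨hg.1.1, hg.1.2, u, Units.ext (by rw [unitsToField_coe]; exact hu)⟩

theorem normalized_lattice_iff {γ γ' : GL (Fin 2) F} (hγ : γ ∈ GDint D) (hn : IsNormalized c b γ)
    (hγ' : γ' ∈ GDint D) (hn' : IsNormalized c b γ') :
    γ'⁻¹ * γ ∈ Gplus D (prodLat b (b * c).star) := by
  refine mem_Gplus_of_vecMul (GDint_le_GDplus D (mul_mem (inv_mem hγ') hγ)) fun v => ?_
  have h1 := mem_baseLat_iff_normalized hγ' hn' (rowAct γ' v)
  rw [← rowAct_inv_apply γ', rowAct_inv_rowAct, mem_baseLat_iff_normalized hγ hn] at h1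
  rw [← h1, rowAct_apply, Matrix.vecMul_vecMul, Units.val_mul]

theorem IsTransform.L_eq {γ g : GL (Fin 2) F} (hγ : γ ∈ GDint D) (hn : IsNormalized c b γ)
    (hg : g ∈ Gplus D (prodLat b (b * c).star)) {x : LevelDatum c n}
    (hx : x.IsTransform y₀ (g * γ⁻¹)) : x.L = prodLat b (b * c).star := by
  ext v
  rw [hx.mem_L, mem_baseLat_iff_normalized hγ hn, mul_inv_rev, inv_inv, rowAct_mul_apply,
    ← rowAct_inv_apply γ, rowAct_inv_rowAct, ← (inv_mem hg).2]

theorem IsStandard.b_eq {x : CuspDatum c} (hx : x.IsStandard) {q : FracId F}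
    (hL : x.L = prodLat b q) : x.b = b := by
  apply mod_injective
  ext y
  rw [hx.mem_b]
  constructor
  · rintro ⟨v, hv, rfl⟩
    exact (hL.le hv).1
  · intro hy
    exact ⟨![y, 0], hL.ge ⟨by simpa using hy, by simp⟩, by simp⟩

/-- The cusps with ideal `b` as a double coset space. -/
theorem exists_fibre_equiv (hy₀ : (n : FractionalIdeal (𝓞 F)⁰ F) +
      FractionalIdeal.spanSingleton (𝓞 F)⁰ y₀ * (c : FractionalIdeal (𝓞 F)⁰ F) = 1)
    {γ : GL (Fin 2) F} (hγ : γ ∈ GDint D) (hn : IsNormalized c b γ) :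
    ∃ e : DoubleCoset.Quotient (fibreLeft D c b : Set (Gplus D (prodLat b (b * c).star)))
        (fibreRight D c b n γ : Set (Gplus D (prodLat b (b * c).star))) ≃
        {C : Cusp D c n // C.b = b},
      ∀ g : Gplus D (prodLat b (b * c).star),
        (e (DoubleCoset.mk (fibreLeft D c b) (fibreRight D c b n γ) g)).1.IsGivenBy y₀
          ((g : GL (Fin 2) F) * γ⁻¹) := by
  have hG : ∀ g : Gplus D (prodLat b (b * c).star), (g : GL (Fin 2) F) * γ⁻¹ ∈ GDint D :=
    fun g => mul_mem (mem_GDint_of_Gplus_prodLat g.2) (inv_mem hγ)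
  have hex : ∀ g : Gplus D (prodLat b (b * c).star), ∃ C : {C : Cusp D c n // C.b = b},
      C.1.IsGivenBy y₀ ((g : GL (Fin 2) F) * γ⁻¹) := by
    intro g
    obtain ⟨x, hx⟩ := exists_transform (c := c) hy₀ (hG g)
    exact ⟨⟨Cusp.mk D x, IsStandard.b_eq hx.1 (IsTransform.L_eq hγ hn g.2 hx)⟩, x, hx, rfl⟩
  choose f hf using hex
  have hiff : ∀ g g', f g = f g' ↔
      DoubleCoset.mk (fibreLeft D c b) (fibreRight D c b n γ) g =
        DoubleCoset.mk (fibreLeft D c b) (fibreRight D c b n γ) g' := by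
    intro g g'
    rw [DoubleCoset.eq]
    have h1 := Cusp.isGivenBy_iff hy₀ (hG g) (hG g') (hf g)
    constructor
    · intro h
      obtain ⟨t, ht, δ, hδ, e⟩ := h1.1 (h ▸ hf g')
      have hk : γ⁻¹ * δ * γ ∈ conjGam D c n γ := by
        rw [mem_conjGam]
        rwa [show γ * (γ⁻¹ * δ * γ) * γ⁻¹ = δ by group]
      have hk' : γ⁻¹ * δ * γ ∈ Gplus D (prodLat b (b * c).star) :=
        (conj_mem_Gplus_iff hγ hn).1 (mem_conjGam.1 hk).1
      have e' : (g' : GL (Fin 2) F) = t * g * (γ⁻¹ * δ * γ) := by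
        rw [← inv_mul_cancel_right (g' : GL (Fin 2) F) γ, e]
        group
      -- The left factor is only known to lie in `T_ℤ U_ℚ`; it stabilizes the lattice because the
      -- other three factors of the equation do.
      have ht' : t ∈ Gplus D (prodLat b (b * c).star) := by
        have : t = g' * (γ⁻¹ * δ * γ)⁻¹ * (g : GL (Fin 2) F)⁻¹ := by rw [e']; group
        rw [this]
        exact mul_mem (mul_mem g'.2 (inv_mem hk')) (inv_mem g.2)
      exact ⟨⟨t, ht'⟩, ht, ⟨_, hk'⟩, hk, Subtype.ext e'⟩
    · rintro ⟨t, ht, k, hk, e⟩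
      have h2 : (f g).1.IsGivenBy y₀ ((g' : GL (Fin 2) F) * γ⁻¹) := by
        refine h1.2 ⟨t, ht, γ * k * γ⁻¹, mem_conjGam.1 hk, ?_⟩
        rw [e, Subgroup.coe_mul, Subgroup.coe_mul]
        group
      exact Subtype.ext ((Cusp.existsUnique_isGivenBy hy₀ (hG g')).unique h2 (hf g'))
  let φ : DoubleCoset.Quotient (fibreLeft D c b : Set (Gplus D (prodLat b (b * c).star)))
      (fibreRight D c b n γ : Set (Gplus D (prodLat b (b * c).star))) →
      {C : Cusp D c n // C.b = b} :=
    Quotient.lift f fun g g' h => (hiff g g').2 (Quotient.sound h)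
  have hφ : ∀ g, φ (DoubleCoset.mk (fibreLeft D c b) (fibreRight D c b n γ) g) = f g :=
    fun g => rfl
  have hbij : Function.Bijective φ := by
    constructor
    · intro q q' h
      obtain ⟨g, rfl⟩ := Quotient.exists_rep q
      obtain ⟨g', rfl⟩ := Quotient.exists_rep q'
      exact (hiff g g').1 h
    · rintro ⟨C, rfl⟩
      obtain ⟨γ', hγ', hn', hC⟩ := C.exists_normalized_isGivenBy hy₀
      refine ⟨DoubleCoset.mk _ _ ⟨γ'⁻¹ * γ, normalized_lattice_iff hγ hn hγ' hn'⟩, ?_⟩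
      rw [hφ]
      refine Subtype.ext ((Cusp.existsUnique_isGivenBy hy₀ (hG _)).unique (hf _) ?_)
      rwa [mul_inv_cancel_right]
  exact ⟨Equiv.ofBijective φ hbij, fun g => hf g⟩

end Fibre

/-! ### Transfer of quotients along a correspondence -/

section QuotEquiv

/-- A correspondence `H` between representatives that matches two relations induces a bijection of
the quotients. -/
theorem exists_quot_equiv {X W B : Type*} (E r : X → X → Prop) (s : W → W → Prop) (β : X → B)
    (b : B) (H : X → W → Prop) (hβ : ∀ x y, r x y → β x = β y) (hE : Equivalence E)
    (hEr : ∀ x y, E x y → r x y) (hl : ∀ x y z, E x y → r y z → r x z)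
    (hr : ∀ x y z, r x y → E y z → r x z) (hb : ∀ x w, H x w → β x = b)
    (rep : ∀ x, β x = b → ∃ y w, E x y ∧ H y w) (real : ∀ w, ∃ x, H x w)
    (hiff : ∀ x w x' w', H x w → H x' w' → (r x x' ↔ s w w')) :
    ∃ e : {K : Quot r // Quot.lift β hβ K = b} ≃ Quot s,
      ∀ (K : {K : Quot r // Quot.lift β hβ K = b}) (x : X) (w : W),
        Quot.mk r x = K.1 → H x w → e K = Quot.mk s w := by
  choose x hx using real
  have hs : ∀ w, s w w := fun w => (hiff _ _ _ _ (hx w) (hx w)).1 (hEr _ _ (hE.refl _))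
  let g : Quot s → {K : Quot r // Quot.lift β hβ K = b} :=
    Quot.lift (fun w => ⟨Quot.mk r (x w), hb _ _ (hx w)⟩) fun w w' h =>
      Subtype.ext (Quot.sound ((hiff _ _ _ _ (hx w) (hx w')).2 h))
  have hg : ∀ y w, H y w → (g (Quot.mk s w)).1 = Quot.mk r y := fun y w h =>
    Quot.sound ((hiff _ _ _ _ (hx w) h).2 (hs w))
  have hbgen : ∀ y y', Relation.EqvGen r y y' → β y = β y' := by
    intro y y' h
    induction h with
    | rel _ _ h => exact hβ _ _ h
    | refl => rfl
    | symm _ _ _ ih => exact ih.symm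
    | trans _ _ _ _ _ ih ih' => exact ih.trans ih'
  -- The relation `r` is not assumed to be an equivalence, so equality in `Quot r` is a chain of
  -- steps. Intermediate elements need not have a partner under `H`; each is replaced by an
  -- `E`-equivalent one that does, and `hl`, `hr` absorb the replacements.
  have key : ∀ y y', Relation.EqvGen r y y' → β y = b → ∀ z w z' w', E y z → H z w → E y' z' →
      H z' w' → Quot.mk s w = Quot.mk s w' := by
    intro y y' h
    induction h with
    | rel y y' h =>
      intro _ z w z' w' h1 h2 h3 h4
      exact Quot.sound ((hiff _ _ _ _ h2 h4).1 (hr _ _ _ (hl _ _ _ (hE.symm h1) h) h3))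
    | refl y =>
      intro _ z w z' w' h1 h2 h3 h4
      exact Quot.sound ((hiff _ _ _ _ h2 h4).1 (hEr _ _ (hE.trans (hE.symm h1) h3)))
    | symm y y' h ih =>
      intro hy z w z' w' h1 h2 h3 h4
      exact (ih ((hbgen _ _ h).trans hy) _ _ _ _ h3 h4 h1 h2).symm
    | trans y y' y'' h h' ih ih' =>
      intro hy z w z' w' h1 h2 h3 h4
      have hy' := (hbgen _ _ h).symm.trans hy
      obtain ⟨u, v, h5, h6⟩ := rep y' hy'
      exact (ih hy _ _ _ _ h1 h2 h5 h6).trans (ih' hy' _ _ _ _ h5 h6 h3 h4)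
  have hbij : Function.Bijective g := by
    constructor
    · intro q q' h
      obtain ⟨w, rfl⟩ := Quot.exists_rep q
      obtain ⟨w', rfl⟩ := Quot.exists_rep q'
      have h1 : Quot.mk r (x w) = Quot.mk r (x w') := congrArg Subtype.val h
      exact key _ _ (Quot.eqvGen_exact h1) (hb _ _ (hx w)) _ _ _ _ (hE.refl _) (hx w) (hE.refl _)
        (hx w')
    · rintro ⟨K, hK⟩
      obtain ⟨y, rfl⟩ := Quot.exists_rep K
      obtain ⟨z, w, h1, h2⟩ := rep y hK
      exact ⟨Quot.mk s w, Subtype.ext ((hg z w h2).trans (Quot.sound (hEr _ _ h1)).symm)⟩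
  refine ⟨(Equiv.ofBijective g hbij).symm, fun K y w h1 h2 => ?_⟩
  rw [Equiv.symm_apply_eq]
  exact Subtype.ext (h1.symm.trans (hg y w h2).symm)

end QuotEquiv

/-! ### Cusps and orbits of primitive vectors -/

section Vectors

variable {F : Type*} [Field F] [NumberField F]
variable {D : Subgroup Fˣ} {c b : FracId F} {n : Ideal (𝓞 F)} [NeZero n] {y₀ : F}
variable {τ : Tors n (diff F)⁻¹.mod}

theorem HasVector.b_eq {x : LevelDatum c n} {w : Prim c b n} (h : x.HasVector b τ w) : x.b = b :=
  IsStandard.b_eq h.1 h.2.1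

theorem HasVector.a_eq {x : LevelDatum c n} {w : Prim c b n} (h : x.HasVector b τ w) :
    x.a = b * c := by
  rw [x.a_eq, HasVector.b_eq h]

theorem HasVector.exists_rep {x : LevelDatum c n} {w : Prim c b n} (h : x.HasVector b τ w)
    (v : divBy n (prodLat b (b * c).star)) (hv : w.1 = Tors.mk v) :
    ∃ v' : divBy n x.L, v'.1 = v.1 ∧ x.β τ = Tors.mk v' := by
  obtain ⟨-, hL, v₁, v₂, h12, h1, h2⟩ := h
  refine ⟨⟨v.1, (congrArg (divBy n) hL).ge v.2⟩, rfl, ?_⟩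
  rw [h1, Tors.mk_eq_mk_iff, h12]
  rw [h2, Tors.mk_eq_mk_iff] at hv
  exact hL.ge hv

theorem isPrimitive_rep (w : Prim c b n) : ∃ v : divBy n (prodLat b (b * c).star),
    w.1 = Tors.mk v ∧ adjoin ((b * c).star * adjoin b (v.1 0) * b⁻¹) (v.1 1) =
      (ofIdeal n)⁻¹ * (b * c).star := by
  obtain ⟨v, hv⟩ := Tors.exists_mk w.1
  exact ⟨v, hv, (isPrimitive_iff rfl v).1 (hv ▸ w.2)⟩

theorem exists_hasVector (hτ : Submodule.span (𝓞 F) {τ} = ⊤) (x : LevelDatum c n)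
    (hx : x.toCuspDatum.IsStandard) (hL : x.L = prodLat b (b * c).star) :
    ∃ w : Prim c b n, x.HasVector b τ w := by
  obtain ⟨v, hv⟩ := Tors.exists_mk (x.β τ)
  have hp := x.isPrimitive_β hτ
  rw [hv, isPrimitive_iff hL] at hp
  exact ⟨⟨Tors.mk ⟨v.1, (congrArg (divBy n) hL).le v.2⟩, (isPrimitive_iff rfl _).2 hp⟩, hx, hL, v,
    _, rfl, hv, rfl⟩

theorem exists_equiv_hasVector (hτ : Submodule.span (𝓞 F) {τ} = ⊤) (x : LevelDatum c n)
    (hx : x.b = b) : ∃ (y : LevelDatum c n) (w : Prim c b n),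
      LevelDatum.CuspEquiv D x y ∧ y.HasVector b τ w := by
  subst hx
  obtain ⟨y, hy, hs, hL⟩ := exists_std_equiv D x
  obtain ⟨w, hw⟩ := exists_hasVector hτ y hs hL
  exact ⟨y, w, hy, hw⟩

/-- Strong approximation writes the vector as `(0, y₀t)γ`, and the transform of the base datum by
`γ⁻¹` has it as the value of `β`. -/
theorem exists_datum (hy₀ : (n : FractionalIdeal (𝓞 F)⁰ F) +
      FractionalIdeal.spanSingleton (𝓞 F)⁰ y₀ * (c : FractionalIdeal (𝓞 F)⁰ F) = 1)
    (hτ : Submodule.span (𝓞 F) {τ} = ⊤) (w : Prim c b n) :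
    ∃ x : LevelDatum c n, x.HasVector b τ w := by
  obtain ⟨t, rfl⟩ := Tors.exists_mk τ
  obtain ⟨v, hv, hp⟩ := isPrimitive_rep w
  -- A tuple does not refer to `D`, and the lift has determinant `1`, so the trivial group can
  -- serve.
  obtain ⟨γ, hγ, hn, h⟩ := exists_normalized_lift hy₀ ⊥ ((span_mk_eq_top_iff t).1 hτ)
    (mem_divBy_prodLat.1 v.2).1 hp
  obtain ⟨x, hx⟩ := exists_transform (c := c) hy₀ (inv_mem hγ)
  have hL : x.L = prodLat b (b * c).star :=
    IsTransform.L_eq (y₀ := y₀) hγ hn (one_mem _) (by rwa [one_mul])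
  obtain ⟨v', hv', hβ⟩ := hx.2.2 t
  refine ⟨x, hx.1, hL, v', ⟨v'.1, (congrArg (divBy n) hL).le v'.2⟩, rfl, hβ, ?_⟩
  rw [hv, eq_comm, Tors.mk_eq_mk_iff]
  rw [hv', rowAct_inv_apply]
  exact h

/-- The right-hand side consists of the multipliers of `b` into `(bc)^*`, that is, of the shears
preserving `b ⊕ (bc)^*`. -/
theorem star_sq (c b : FracId F) : (c * b ^ 2).star = (b * c).star * b⁻¹ :=
  Additive.ofMul.injective (by
    simp only [FracId.star, ofMul_mul, ofMul_inv, ofMul_pow]; abel)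

theorem vecMul_triMat_mem_iff {q : FracId F} (u ε : (𝓞 F)ˣ) {ξ : F} (hξ : ξ ∈ (q * b⁻¹).mod)
    (v : Fin 2 → F) : v ∈ prodLat b q ↔ v ᵥ* (triMat u ε ξ).1 ∈ prodLat b q := by
  rw [mem_mul_inv_iff] at hξ
  rw [vecMul_triMat, mem_prodLat, mem_prodLat]
  simp only [Matrix.cons_val_zero, Matrix.cons_val_one]
  rw [← map_mul, ← Units.val_mul, unit_mul_mem_iff]
  refine and_congr_right fun h0 => ?_
  rw [Submodule.add_mem_iff_right _ (hξ _ h0), unit_mul_mem_iff]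

/-- The lattice isomorphism `v ↦ v (uε ξ; 0 u⁻¹)`. -/
theorem exists_triLatIso {q : FracId F} {L L' : Submodule (𝓞 F) (Fin 2 → F)}
    (hL : L = prodLat b q) (hL' : L' = prodLat b q) (u ε : (𝓞 F)ˣ) {ξ : F}
    (hξ : ξ ∈ (q * b⁻¹).mod) :
    ∃ f : LatIso L L', ∀ v, f.toEquiv v = v ᵥ* (triMat u ε ξ).1 := by
  subst hL hL'
  exact ⟨⟨rowAct (triMat u ε ξ)⁻¹, fun v => by
    rw [rowAct_inv_apply]; exact vecMul_triMat_mem_iff u ε hξ v⟩, fun v => rowAct_inv_apply _ v⟩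

theorem triLatIso_mem {q : FracId F} {L L' : Submodule (𝓞 F) (Fin 2 → F)}
    (hL : L = prodLat b q) (hL' : L' = prodLat b q) {u ε : (𝓞 F)ˣ} {ξ : F} (f : LatIso L L')
    (hf : ∀ v, f.toEquiv v = v ᵥ* (triMat u ε ξ).1) : ξ ∈ (q * b⁻¹).mod := by
  subst hL hL'
  rw [mem_mul_inv_iff]
  intro x hx
  have := (f.mem_iff ![x, 0]).1 ⟨by simpa using hx, by simp⟩
  rw [hf, vecMul_triMat] at this
  simpa using this.2

/-- Isomorphisms of standard tuples are the triangular matrices preserving the lattice, and they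
match the level structures once they do so at the generator `τ`. -/
theorem cuspEquiv_iff_primRel (hτ : Submodule.span (𝓞 F) {τ} = ⊤) {x x' : LevelDatum c n}
    {w w' : Prim c b n} (h : x.HasVector b τ w) (h' : x'.HasVector b τ w') :
    LevelDatum.CuspEquiv D x x' ↔ primRel D c b n w w' := by
  have ha : x.a = x'.a := (HasVector.a_eq h).trans (HasVector.a_eq h').symm
  have hb : x.b = x'.b := (HasVector.b_eq h).trans (HasVector.b_eq h').symm
  constructor
  · rintro ⟨-, -, f, hc, hβ⟩
    obtain ⟨u, ε, hε, ξ, hf⟩ := (compat_iff h.1 h'.1 ha hb f).1 hc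
    have hξ := triLatIso_mem h.2.1 h'.2.1 f hf
    obtain ⟨v, hv⟩ := Tors.exists_mk w.1
    obtain ⟨v₁, hv₁, e₁⟩ := HasVector.exists_rep h v hv
    obtain ⟨v', hv'⟩ := Tors.exists_mk w'.1
    obtain ⟨v₂, hv₂, e₂⟩ := HasVector.exists_rep h' v' hv'
    have e := hβ τ
    rw [e₁, e₂, LatIso.onTors_mk, Tors.mk_eq_mk_iff] at e
    have hL' := h'.2.1
    have hd : v.1 ᵥ* (triMat u ε ξ).1 - v'.1 ∈ prodLat b (b * c).star := by
      rw [← hf, ← hv₁, ← hv₂]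
      exact hL'.le e
    have hmem : v.1 ᵥ* (triMat u ε ξ).1 ∈ divBy n (prodLat b (b * c).star) := by
      rw [← sub_add_cancel (v.1 ᵥ* (triMat u ε ξ).1) v'.1]
      exact add_mem (le_divBy n _ hd) v'.2
    refine ⟨u, ε, ξ, v, ⟨_, hmem⟩, hε, by rwa [star_sq], hv, ?_, ?_⟩
    · rw [hv', eq_comm, Tors.mk_eq_mk_iff]
      exact hd
    · change v.1 ᵥ* (triMat u ε ξ).1 = _
      rw [triMat_val]
  · rintro ⟨u, ε, ξ, v, v', hε, hξ, hv, hv', e⟩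
    rw [star_sq] at hξ
    rw [← triMat_val] at e
    obtain ⟨f, hf⟩ := exists_triLatIso h.2.1 h'.2.1 u ε hξ
    refine ⟨ha, hb, f, (compat_iff h.1 h'.1 ha hb f).2 ⟨u, ε, hε, ξ, hf⟩, ?_⟩
    obtain ⟨v₁, hv₁, e₁⟩ := HasVector.exists_rep h v hv
    obtain ⟨v₂, hv₂, e₂⟩ := HasVector.exists_rep h' v' hv'
    have : f.onTors n ∘ₗ x.β = x'.β := by
      refine linearMap_eq_of_span hτ ?_
      rw [LinearMap.comp_apply, e₁, e₂, LatIso.onTors_mk, Tors.mk_eq_mk_iff]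
      change f.toEquiv v₁.1 - v₂.1 ∈ x'.L
      rw [hf, hv₁, hv₂, e, sub_self]
      exact zero_mem _
    exact LinearMap.congr_fun this

theorem exists_cusp_vector_equiv (hy₀ : (n : FractionalIdeal (𝓞 F)⁰ F) +
      FractionalIdeal.spanSingleton (𝓞 F)⁰ y₀ * (c : FractionalIdeal (𝓞 F)⁰ F) = 1)
    (D : Subgroup Fˣ) (b : FracId F) (hτ : Submodule.span (𝓞 F) {τ} = ⊤) :
    ∃ e : {C : Cusp D c n // C.b = b} ≃ Quot (primRel D c b n),
      ∀ (C : {C : Cusp D c n // C.b = b}) (x : LevelDatum c n) (w : Prim c b n),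
        Cusp.mk D x = C.1 → x.HasVector b τ w → e C = Quot.mk _ w :=
  exists_quot_equiv (LevelDatum.CuspEquiv D) (LevelDatum.CuspEquiv D) (primRel D c b n)
    (fun x => x.b) b (fun x w => x.HasVector b τ w) (fun _ _ h => h.2.1) (cuspSetoid D c n).iseqv
    (fun _ _ h => h) (fun _ _ _ => LevelDatum.equiv_trans D)
    (fun _ _ _ => LevelDatum.equiv_trans D) (fun _ _ h => HasVector.b_eq h)
    (fun x hx => exists_equiv_hasVector hτ x hx) (exists_datum hy₀ hτ)
    (fun _ _ _ _ => cuspEquiv_iff_primRel hτ)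

end Vectors

/-! ### Components and orbits under the enlarged group -/

section Components

variable {F : Type*} [Field F] [NumberField F]
variable {D : Subgroup Fˣ} {c b : FracId F} {n : Ideal (𝓞 F)} [NeZero n] {y₀ : F}
variable {τ : Tors n (diff F)⁻¹.mod}

theorem CuspDatum.Compat.trans {x y z : CuspDatum c} {f : LatIso x.L y.L} {f' : LatIso y.L z.L}
    (h : x.Compat D y f) (h' : y.Compat D z f') : x.Compat D z (f.trans f') := by
  obtain ⟨⟨q, hq⟩, ⟨p, hp⟩, ε, hε, hl⟩ := h
  obtain ⟨⟨q', hq'⟩, ⟨p', hp'⟩, ε', hε', hl'⟩ := h'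
  refine ⟨⟨q.trans q', fun w => ?_⟩, ⟨p.trans p', fun v => ?_⟩, ε' * ε, mul_mem hε' hε,
    fun w => ?_⟩
  · change f'.toEquiv (f.toEquiv (x.i w)) = z.i (q'.toEquiv (q.toEquiv w))
    rw [hq, hq']
  · change z.j (f'.toEquiv (f.toEquiv v)) = p'.toEquiv (p.toEquiv (x.j v))
    rw [hp', hp]
  · have e : (f.trans f').onLat = f'.onLat ∘ₗ f.onLat := rfl
    rw [e, exteriorPower.map_comp, LinearMap.comp_apply, hl', hl, smul_smul, Units.val_mul]

theorem LatIso.onTors_trans {L M N : Submodule (𝓞 F) (Fin 2 → F)} (f : LatIso L M)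
    (g : LatIso M N) (w : Tors n L) : (f.trans g).onTors n w = g.onTors n (f.onTors n w) := by
  obtain ⟨v, rfl⟩ := Tors.exists_mk w
  rfl

/-- The isomorphism of torsion modules induced by an isomorphism of lattices. -/
theorem LatIso.exists_torsEquiv {L M : Submodule (𝓞 F) (Fin 2 → F)} (f : LatIso L M) :
    ∃ T : Tors n L ≃ₗ[𝓞 F] Tors n M, ∀ w, T w = f.onTors n w := by
  refine ⟨LinearEquiv.ofBijective (f.onTors n) ⟨LatIso.onTors_injective n f, fun w => ?_⟩,
    fun _ => rfl⟩
  refine ⟨f.symm.onTors n w, ?_⟩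
  obtain ⟨v, rfl⟩ := Tors.exists_mk w
  rw [LatIso.onTors_mk, LatIso.onTors_mk]
  congr 1
  exact Subtype.ext (f.toEquiv.apply_symm_apply v.1)

theorem LevelDatum.sameComponent_iff {x x' : LevelDatum c n} :
    LevelDatum.SameComponent D x x' ↔ ∃ (k : ℤ) (φ : Tors n x.L ≃ₗ[𝓞 F] Tors n x.L),
      IsUnit (k : ZMod (quotExponent x.b.mod x.bPrime.mod)) ∧
      (∀ y, φ (torsMap n x.i x.i_mem y) = torsMap n x.i x.i_mem y) ∧
      (∀ w, torsMap n x.j x.j_mem (φ w) = k • torsMap n x.j x.j_mem w) ∧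
      x.a = x'.a ∧ x.b = x'.b ∧ ∃ f : LatIso x.L x'.L,
        x.toCuspDatum.Compat D x'.toCuspDatum f ∧ ∀ t, f.onTors n (φ (x.β t)) = x'.β t := by
  constructor
  · rintro ⟨a, k, φ, h1, h⟩
    exact ⟨k, φ, h1 ▸ a.isUnit, h⟩
  · rintro ⟨k, φ, h1, h⟩
    exact ⟨h1.unit, k, φ, h1.unit_spec.symm, h⟩

theorem LevelDatum.sameComponent_of_equiv {x x' : LevelDatum c n}
    (h : LevelDatum.CuspEquiv D x x') : LevelDatum.SameComponent D x x' := by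
  obtain ⟨ha, hb, f, hc, hβ⟩ := h
  exact LevelDatum.sameComponent_iff.2 ⟨1, LinearEquiv.refl _ _, by simp, fun _ => rfl,
    fun _ => (one_zsmul _).symm, ha, hb, f, hc, hβ⟩

theorem LevelDatum.sameComponent_trans_equiv {x y z : LevelDatum c n}
    (h : LevelDatum.SameComponent D x y) (h' : LevelDatum.CuspEquiv D y z) :
    LevelDatum.SameComponent D x z := by
  obtain ⟨a, k, φ, h1, h2, h3, ha, hb, f, hc, hβ⟩ := h
  obtain ⟨ha', hb', f', hc', hβ'⟩ := h'
  refine ⟨a, k, φ, h1, h2, h3, ha.trans ha', hb.trans hb', f.trans f', hc.trans hc', fun t => ?_⟩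
  rw [LatIso.onTors_trans, hβ, hβ']

/-- The automorphism `φ` lives on the first datum, so it is conjugated by the isomorphism `T` of
torsion modules. The modulus for `k` is unchanged because `b` and `b'` are invariants of the cusp.
-/
theorem LevelDatum.equiv_trans_sameComponent {x y z : LevelDatum c n}
    (h : LevelDatum.CuspEquiv D x y) (h' : LevelDatum.SameComponent D y z) :
    LevelDatum.SameComponent D x z := by
  have hb' := LevelDatum.bPrime_eq_of_equiv h
  obtain ⟨ha, hb, f, hc, hβ⟩ := h
  obtain ⟨k, φ, h1, h2, h3, ha', hb'', f', hc', hβ'⟩ := LevelDatum.sameComponent_iff.1 h'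
  obtain ⟨T, hT⟩ := f.exists_torsEquiv (n := n)
  obtain ⟨⟨q, hq⟩, ⟨p, hp⟩, -⟩ := id hc
  rw [← hb, ← hb'] at h1
  have hTj : ∀ w, p.onTors n (torsMap n x.j x.j_mem w) = torsMap n y.j y.j_mem (T w) := by
    intro w
    obtain ⟨v, rfl⟩ := Tors.exists_mk w
    rw [torsMap_mk, hT, LatIso.onTors_mk, LatIso.onTors_mk, torsMap_mk]
    congr 1
    exact Subtype.ext (hp v.1).symm
  refine LevelDatum.sameComponent_iff.2 ⟨k, (T.trans φ).trans T.symm, h1, fun w => ?_, fun w => ?_,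
    ha.trans ha', hb.trans hb'', f.trans f', hc.trans hc', fun t => ?_⟩
  · obtain ⟨v, rfl⟩ := Tors.exists_mk w
    rw [LinearEquiv.trans_apply, LinearEquiv.trans_apply, LinearEquiv.symm_apply_eq]
    have e : T (torsMap n x.i x.i_mem (Tors.mk v)) =
        torsMap n y.i y.i_mem (q.onTors n (Tors.mk v)) := by
      rw [torsMap_mk, hT, LatIso.onTors_mk, LatIso.onTors_mk, torsMap_mk]
      congr 1
      exact Subtype.ext (hq v.1)
    rw [e, h2]
  · apply LatIso.onTors_injective n p
    rw [hTj, LinearEquiv.trans_apply, LinearEquiv.trans_apply, LinearEquiv.apply_symm_apply, h3,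
      map_zsmul, hTj]
  · rw [LatIso.onTors_trans, ← hT, LinearEquiv.trans_apply, LinearEquiv.trans_apply,
      LinearEquiv.apply_symm_apply, hT, hβ, hβ']

theorem intCast_mul_mem (f : FracId F) (k : ℤ) {x : F} (hx : x ∈ f.mod) : (k : F) * x ∈ f.mod := by
  rw [← zsmul_eq_mul]
  exact zsmul_mem hx k

theorem exponent_mul_mem {b b' : FracId F} {k : ℤ} (hk : (quotExponent b.mod b'.mod : ℤ) ∣ k)
    {v : F} (hv : v ∈ b'.mod) : (k : F) * v ∈ b.mod := by
  obtain ⟨m, rfl⟩ := hk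
  have := intCast_mul_mem b m (mem_mul_inv_iff.1 (exponent_mem b b') v hv)
  convert this using 1
  push_cast
  ring

theorem absNorm_mul_mem {f : FracId F} {k : ℤ} (hk : (Ideal.absNorm n : ℤ) ∣ k) {v : F}
    (hv : v ∈ ((ofIdeal n)⁻¹ * f).mod) : (k : F) * v ∈ f.mod := by
  obtain ⟨m, rfl⟩ := hk
  have h := mem_ofIdeal_inv_mul.1 hv _ (Ideal.absNorm_mem n)
  have := intCast_mul_mem f m h
  convert this using 1
  push_cast
  ring

theorem quotExponent_dvd_absNorm {b b' : FracId F} (h : b'.mod ≤ ((ofIdeal n)⁻¹ * b).mod) :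
    quotExponent b.mod b'.mod ∣ Ideal.absNorm n := by
  refine AddMonoid.exponent_dvd_of_forall_nsmul_eq_zero fun w => ?_
  obtain ⟨v, rfl⟩ := Submodule.Quotient.mk_surjective _ w
  rw [← Submodule.Quotient.mk_smul, Submodule.Quotient.mk_eq_zero]
  change Ideal.absNorm n • v.1 ∈ b.mod
  have := absNorm_mul_mem (n := n) (k := Ideal.absNorm n) dvd_rfl (h v.2)
  rwa [nsmul_eq_mul, ← Int.cast_natCast]

/-- Units of `ℤ/e` lift to units of `ℤ/N`. An arbitrary integer lift of a unit modulo the exponent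
of `b'/b` need not act invertibly on `n⁻¹L/L`, whereas a lift prime to the norm of `n` does. -/
theorem exists_coprime_lift {e N : ℕ} [NeZero N] (h : e ∣ N) {k : ℤ} (hk : IsUnit (k : ZMod e)) :
    ∃ k' k'' : ℤ, (e : ℤ) ∣ k' - k ∧ (N : ℤ) ∣ k'' * k' - 1 := by
  obtain ⟨a, ha⟩ := ZMod.unitsMap_surjective h hk.unit
  obtain ⟨k', hk'⟩ := ZMod.intCast_surjective (a : ZMod N)
  obtain ⟨k'', hk''⟩ := ZMod.intCast_surjective ((a⁻¹ : (ZMod N)ˣ) : ZMod N)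
  refine ⟨k', k'', ?_, ?_⟩
  · rw [← ZMod.intCast_eq_intCast_iff_dvd_sub]
    have h1 := congrArg Units.val ha
    rw [IsUnit.unit_spec, ZMod.unitsMap_val, ← hk', ZMod.cast_intCast h] at h1
    exact h1.symm
  · rw [← ZMod.intCast_eq_intCast_iff_dvd_sub]
    push_cast
    rw [hk', hk'', Units.inv_mul]

/-- Multiplication of the first coordinate by `k`. -/
def scaleCoord (k : F) : (Fin 2 → F) →ₗ[F] (Fin 2 → F) where
  toFun v := ![k * v 0, v 1]
  map_add' v w := vec_ext (by simp [mul_add]) (by simp)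
  map_smul' s v := vec_ext (by simp [mul_left_comm]) (by simp)

theorem scaleCoord_mem {p q : FracId F} (k : ℤ) : ∀ v ∈ prodLat p q,
    scaleCoord (k : F) v ∈ prodLat p q := by
  rintro v ⟨h0, h1⟩
  exact ⟨intCast_mul_mem p k h0, h1⟩

theorem exists_scale_aut {q : FracId F} {L : Submodule (𝓞 F) (Fin 2 → F)} (hL : L = prodLat b q)
    {k k' : ℤ} (h : (Ideal.absNorm n : ℤ) ∣ k' * k - 1) :
    ∃ φ : Tors n L ≃ₗ[𝓞 F] Tors n L, ∀ v : divBy n L, ∃ v' : divBy n L,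
      v'.1 = ![(k : F) * v.1 0, v.1 1] ∧ φ (Tors.mk v) = Tors.mk v' := by
  subst hL
  have key : ∀ k k' : ℤ, (Ideal.absNorm n : ℤ) ∣ k' * k - 1 →
      torsMap n (scaleCoord (k' : F)) (scaleCoord_mem (p := b) (q := q) k') ∘ₗ
        torsMap n (scaleCoord (k : F)) (scaleCoord_mem k) = LinearMap.id := by
    intro k k' h
    refine LinearMap.ext fun w => ?_
    obtain ⟨v, rfl⟩ := Tors.exists_mk w
    rw [LinearMap.comp_apply, torsMap_mk, torsMap_mk, LinearMap.id_apply, Tors.mk_eq_mk_iff]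
    refine ⟨?_, ?_⟩
    · change (k' : F) * ((k : F) * v.1 0) - v.1 0 ∈ b.mod
      have := absNorm_mul_mem h (mem_divBy_prodLat.1 v.2).1
      convert this using 1
      push_cast
      ring
    · change v.1 1 - v.1 1 ∈ q.mod
      rw [sub_self]
      exact zero_mem _
  refine ⟨LinearEquiv.ofLinearMap (torsMap n (scaleCoord (k : F)) (scaleCoord_mem k))
    (torsMap n (scaleCoord (k' : F)) (scaleCoord_mem k')) (key _ _ (by rwa [mul_comm]))
    (key _ _ h), fun v => ⟨⟨scaleCoord (k : F) v.1, divBy_map n _ (scaleCoord_mem k) _ v.2⟩, rfl, ?_⟩⟩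
  rw [LinearEquiv.coe_ofLinearMap, torsMap_mk]

theorem HasVector.bPrime_eq (hτ : Submodule.span (𝓞 F) {τ} = ⊤) {x : LevelDatum c n}
    {w : Prim c b n} (h : x.HasVector b τ w) (v : divBy n (prodLat b (b * c).star))
    (hv : w.1 = Tors.mk v) : x.bPrime = adjoin b (v.1 0) := by
  obtain ⟨v', hv', e⟩ := HasVector.exists_rep h v hv
  rw [x.bPrime_eq hτ e, HasVector.b_eq h, h.1.2.1, hv']

/-- An automorphism of `n⁻¹L/L` that is the identity on the second summand and multiplication by
`k` on the quotient, on a vector `v`. -/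
theorem aut_apply_mk {x : LevelDatum c n} (hx : x.toCuspDatum.IsStandard)
    (hL : x.L = prodLat b (b * c).star) {k : ℤ} {φ : Tors n x.L ≃ₗ[𝓞 F] Tors n x.L}
    (hi : ∀ y, φ (torsMap n x.i x.i_mem y) = torsMap n x.i x.i_mem y)
    (hj : ∀ w, torsMap n x.j x.j_mem (φ w) = k • torsMap n x.j x.j_mem w) (v : divBy n x.L) :
    ∃ ξ ∈ ((b * c).star * b⁻¹).mod, ∃ v' : divBy n x.L,
      v'.1 = ![(k : F) * v.1 0, ξ * v.1 0 + v.1 1] ∧ φ (Tors.mk v) = Tors.mk v' := by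
  have hdiv : divBy n x.L = divBy n (prodLat b (b * c).star) := congrArg (divBy n) hL
  have hv := mem_divBy_prodLat.1 (hdiv.le v.2)
  have ha : x.a.star = (b * c).star := by rw [x.a_eq, IsStandard.b_eq hx hL]
  let v₀ : divBy n x.L := ⟨![v.1 0, 0], hdiv.ge (mem_divBy_prodLat.2 ⟨hv.1, by simp⟩)⟩
  let y₁ : divBy n x.a.star.mod := ⟨v.1 1, mem_divBy_mod.2 (by rw [ha]; exact hv.2)⟩
  let v₁ : divBy n x.L := ⟨x.i y₁.1, divBy_map n x.i x.i_mem _ y₁.2⟩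
  have hsum : (Tors.mk v : Tors n x.L) = Tors.mk v₀ + Tors.mk v₁ := by
    have : v = v₀ + v₁ := Subtype.ext (vec_ext
      (by change v.1 0 = v.1 0 + x.i (v.1 1) 0; rw [hx.1]; simp)
      (by change v.1 1 = 0 + x.i (v.1 1) 1; rw [hx.1]; simp))
    rw [this]
    rfl
  have h1 : φ (Tors.mk v₁) = Tors.mk v₁ := by
    have := hi (Tors.mk y₁)
    rwa [torsMap_mk] at this
  obtain ⟨z, hz⟩ := Tors.exists_mk (φ (Tors.mk v₀))
  have hzm := mem_divBy_prodLat.1 (hdiv.le z.2)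
  have hz0 : z.1 0 - (k : F) * v.1 0 ∈ b.mod := by
    have h2 := hj (Tors.mk v₀)
    rw [hz, torsMap_mk, torsMap_mk] at h2
    have h3 : (k • (Tors.mk ⟨x.j v₀.1, divBy_map n x.j x.j_mem _ v₀.2⟩ : Tors n x.b.mod)) =
      Tors.mk (k • ⟨x.j v₀.1, divBy_map n x.j x.j_mem _ v₀.2⟩) := rfl
    rw [h3, Tors.mk_eq_mk_iff] at h2
    have h4 : x.j z.1 - k • x.j v₀.1 ∈ x.b.mod := h2
    rw [hx.2.1, hx.2.1, zsmul_eq_mul, IsStandard.b_eq hx hL] at h4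
    exact h4
  -- The vector `(v₀, 0)` is killed by `bb'⁻¹`, hence so is its image under `φ`. The second
  -- coordinate of the image thus lies in `(bc)^* b'b⁻¹ = (bc)^* + (bc)^* b⁻¹v₀`, which means that
  -- `φ` acts on it as a shear.
  have hz1 : z.1 1 ∈ ((b * c).star * adjoin b (v.1 0) * b⁻¹).mod := by
    have e : (b * c).star * adjoin b (v.1 0) * b⁻¹ =
        (b * c).star * (b * (adjoin b (v.1 0))⁻¹)⁻¹ := by
      rw [mul_inv, inv_inv, mul_comm b⁻¹, mul_assoc]
    rw [e, mem_mul_inv_iff]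
    intro r hr
    have hr1 : r ∈ (1 : FracId F).mod := by
      have := mod_mono_mul (h := (adjoin b (v.1 0))⁻¹) (le_adjoin b (v.1 0)) hr
      rwa [mul_inv_cancel] at this
    have hr0 := (int_mul_mem_iff_adjoin hr1).2 hr
    obtain ⟨s, rfl⟩ := mem_mod_one.1 hr1
    have h5 : s • (Tors.mk v₀ : Tors n x.L) = 0 := by
      rw [← Submodule.Quotient.mk_smul, Tors.mk_eq_zero_iff]
      refine hL.ge ⟨?_, ?_⟩
      · change s • v.1 0 ∈ b.mod
        rwa [smul_eq_coe_mul]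
      · change s • (0 : F) ∈ (b * c).star.mod
        rw [smul_zero]
        exact zero_mem _
    have h6 := congrArg φ h5
    rw [map_smul, hz, map_zero, ← Submodule.Quotient.mk_smul, Tors.mk_eq_zero_iff] at h6
    have h7 : s • z.1 1 ∈ (b * c).star.mod := (hL.le h6).2
    rwa [smul_eq_coe_mul, mul_comm (s : F)] at h7
  obtain ⟨ξ, hξ, hξz⟩ := mem_mul_adjoin_iff.1 hz1
  have hmem : (![(k : F) * v.1 0, -ξ * v.1 0 + v.1 1] : Fin 2 → F) - (z + v₁ : divBy n x.L).1 ∈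
      prodLat b (b * c).star := by
    refine ⟨?_, ?_⟩
    · change (k : F) * v.1 0 - (z.1 0 + x.i (v.1 1) 0) ∈ b.mod
      rw [hx.1]
      have := neg_mem (S := Submodule (𝓞 F) F) hz0
      convert this using 1
      simp
    · change -ξ * v.1 0 + v.1 1 - (z.1 1 + x.i (v.1 1) 1) ∈ (b * c).star.mod
      rw [hx.1]
      have := neg_mem (S := Submodule (𝓞 F) F) hξz
      convert this using 1
      simp
      ring
  refine ⟨-ξ, neg_mem (S := Submodule (𝓞 F) F) hξ, ⟨_, ?_⟩, rfl, ?_⟩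
  · have := add_mem (le_divBy n _ (hL.ge hmem)) (z + v₁).2
    rwa [sub_add_cancel] at this
  · rw [hsum, map_add, hz, h1, eq_comm]
    exact Tors.mk_eq_mk_iff.2 (hL.ge hmem)

/-- On a single vector, `φ` acts as a matrix `(k η; 0 1)` by `aut_apply_mk`; composed with a
triangular isomorphism this is a matrix of the enlarged group. Conversely the shear is put into the
lattice isomorphism and `φ` is a pure scaling. -/
theorem sameComponent_iff_primRelBar (hτ : Submodule.span (𝓞 F) {τ} = ⊤) {x x' : LevelDatum c n}
    {w w' : Prim c b n} (h : x.HasVector b τ w) (h' : x'.HasVector b τ w') :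
    LevelDatum.SameComponent D x x' ↔ primRelBar D c b n w w' := by
  have ha : x.a = x'.a := (HasVector.a_eq h).trans (HasVector.a_eq h').symm
  have hb : x.b = x'.b := (HasVector.b_eq h).trans (HasVector.b_eq h').symm
  have hL := h.2.1
  have hL' := h'.2.1
  have hexp : ∀ v : divBy n (prodLat b (b * c).star), w.1 = Tors.mk v →
      quotExponent x.b.mod x.bPrime.mod =
        quotExponent b.mod (Submodule.span (𝓞 F) {v.1 0} ⊔ b.mod) := fun v hv => by
    rw [HasVector.bPrime_eq hτ h v hv, HasVector.b_eq h, adjoin_mod]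
  rw [LevelDatum.sameComponent_iff]
  constructor
  · rintro ⟨k, φ, hk, hi, hj, -, -, f, hc, hβ⟩
    obtain ⟨u, ε, hε, ξ, hf⟩ := (compat_iff h.1 h'.1 ha hb f).1 hc
    have hξ := triLatIso_mem h.2.1 h'.2.1 f hf
    obtain ⟨v, hv⟩ := Tors.exists_mk w.1
    obtain ⟨v₁, hv₁, e₁⟩ := HasVector.exists_rep h v hv
    obtain ⟨v', hv'⟩ := Tors.exists_mk w'.1
    obtain ⟨v₂, hv₂, e₂⟩ := HasVector.exists_rep h' v' hv'
    obtain ⟨η, hη, v₃, hv₃, e₃⟩ := aut_apply_mk h.1 hL hi hj v₁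
    rw [hexp v hv] at hk
    have e := hβ τ
    rw [e₁, e₃, e₂, LatIso.onTors_mk, Tors.mk_eq_mk_iff] at e
    -- The upper right entry of `(k η; 0 1)` times `(uε ξ; 0 u⁻¹)`.
    set ζ : F := k * ξ + (((u⁻¹ : (𝓞 F)ˣ) : 𝓞 F) : F) * η with hζ
    have hζm : ζ ∈ ((b * c).star * b⁻¹).mod := by
      exact add_mem (intCast_mul_mem _ k hξ) (int_mul_mem _ _ hη)
    set M : Matrix (Fin 2) (Fin 2) F := !![(k : F) * ((u : 𝓞 F) : F) * ((ε : 𝓞 F) : F), ζ;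
      0, (((u⁻¹ : (𝓞 F)ˣ) : 𝓞 F) : F)] with hM
    have hfv : f.toEquiv v₃.1 = v.1 ᵥ* M := by
      rw [hf, vecMul_triMat, hv₃, hv₁]
      apply vec_ext
      · simp [vecMul_zero_coord, hM]; ring
      · simp [vecMul_one_coord, hM, hζ]; ring
    have hd : v.1 ᵥ* M - v'.1 ∈ prodLat b (b * c).star := by
      rw [← hfv, ← hv₂]
      exact hL'.le e
    have hmem : v.1 ᵥ* M ∈ divBy n (prodLat b (b * c).star) := by
      rw [← sub_add_cancel (v.1 ᵥ* M) v'.1]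
      exact add_mem (le_divBy n _ hd) v'.2
    refine ⟨u, ε, ζ, v, ⟨_, hmem⟩, hk.unit, k, hε, by rwa [star_sq], hv, ?_,
      hk.unit_spec.symm, rfl⟩
    rw [hv', eq_comm, Tors.mk_eq_mk_iff]
    exact hd
  · rintro ⟨u, ε, ξ, v, v', abar, k, hε, hξ, hv, hv', hk, e⟩
    rw [star_sq] at hξ
    have hk' : IsUnit (k : ZMod (quotExponent b.mod (Submodule.span (𝓞 F) {v.1 0} ⊔ b.mod))) :=
      hk ▸ abar.isUnit
    rw [← hexp v hv] at hk'
    have : NeZero (Ideal.absNorm n) := ⟨fun h0 => NeZero.ne n (Ideal.absNorm_eq_zero_iff.1 h0)⟩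
    have hle := x.bPrime_le
    -- The integer `l` has the same residue as `k` modulo the exponent of `b'/b`, but scaling by `l`
    -- is invertible on `n⁻¹L/L`, with inverse the scaling by `l'`.
    obtain ⟨l, l', hl, hl'⟩ := exists_coprime_lift (quotExponent_dvd_absNorm hle) hk'
    obtain ⟨φ, hφ⟩ := exists_scale_aut hL hl'
    have hvm := mem_divBy_prodLat.1 v.2
    -- The scaling by `l` precedes the shear, so `ξ` is multiplied by `l'` to compensate.
    have hη : (l' : F) * ξ ∈ ((b * c).star * b⁻¹).mod := intCast_mul_mem _ l' hξ
    obtain ⟨f, hf⟩ := exists_triLatIso hL hL' u ε hη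
    obtain ⟨v₁, hv₁, e₁⟩ := HasVector.exists_rep h v hv
    obtain ⟨v₂, hv₂, e₂⟩ := HasVector.exists_rep h' v' hv'
    refine ⟨l, φ, ?_, fun y => ?_, fun z => ?_, ha, hb, f,
      (compat_iff h.1 h'.1 ha hb f).2 ⟨u, ε, hε, _, hf⟩, ?_⟩
    · have : (l : ZMod (quotExponent x.b.mod x.bPrime.mod)) = k :=
        ((ZMod.intCast_eq_intCast_iff_dvd_sub _ _ _).2 hl).symm
      rwa [this]
    · obtain ⟨y, rfl⟩ := Tors.exists_mk y
      rw [torsMap_mk]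
      obtain ⟨v', hv', e⟩ := hφ ⟨x.i y.1, divBy_map n x.i x.i_mem _ y.2⟩
      rw [e]
      congr 1
      refine Subtype.ext (hv'.trans ?_)
      change ![(l : F) * x.i y.1 0, x.i y.1 1] = x.i y.1
      rw [h.1.1]
      simp
    · obtain ⟨v, rfl⟩ := Tors.exists_mk z
      obtain ⟨v', hv', e⟩ := hφ v
      rw [e, torsMap_mk, torsMap_mk]
      refine Tors.mk_eq_mk_iff.2 ?_
      change x.j v'.1 - l • x.j v.1 ∈ x.b.mod
      rw [h.1.2.1, h.1.2.1, hv', zsmul_eq_mul]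
      simp
    · have : (f.onTors n ∘ₗ φ.toLinearMap) ∘ₗ x.β = x'.β := by
        refine linearMap_eq_of_span hτ ?_
        obtain ⟨v₃, hv₃, e₃⟩ := hφ v₁
        rw [LinearMap.comp_apply, LinearMap.comp_apply, e₁, e₂, LinearEquiv.coe_coe, e₃,
          LatIso.onTors_mk, Tors.mk_eq_mk_iff]
        change f.toEquiv v₃.1 - v₂.1 ∈ x'.L
        rw [hf, hv₃, hv₁, hv₂, e, vecMul_triMat]
        refine hL'.ge ⟨?_, ?_⟩
        · rw [Pi.sub_apply, vecMul_zero_coord]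
          simp only [Matrix.cons_val_zero, Matrix.cons_val_one, Matrix.of_apply, mul_zero,
            add_zero]
          have hv0 : v.1 0 ∈ x.bPrime.mod := by
            rw [HasVector.bPrime_eq hτ h v hv]
            exact mem_adjoin_self b _
          -- Replacing `k` by `l` changes the first coordinate by a multiple of `(l - k)v₀`, which
          -- lies in `b` because `v₀ ∈ b'`.
          have h2 := exponent_mul_mem hl hv0
          rw [HasVector.b_eq h] at h2
          have := int_mul_mem b ((u : 𝓞 F) * (ε : 𝓞 F)) h2
          convert this using 1
          push_cast
          ring
        · rw [Pi.sub_apply, vecMul_one_coord]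
          simp only [Matrix.cons_val_zero, Matrix.cons_val_one, Matrix.of_apply]
          have h2 := mem_mul_inv_iff.1 hξ _ (absNorm_mul_mem hl' hvm.1)
          convert h2 using 1
          push_cast
          ring
      exact fun t => LinearMap.congr_fun this t

theorem exists_component_vector_equiv (hy₀ : (n : FractionalIdeal (𝓞 F)⁰ F) +
      FractionalIdeal.spanSingleton (𝓞 F)⁰ y₀ * (c : FractionalIdeal (𝓞 F)⁰ F) = 1)
    (D : Subgroup Fˣ) (b : FracId F) (hτ : Submodule.span (𝓞 F) {τ} = ⊤) :
    ∃ e : {K : Component D c n // K.b = b} ≃ Quot (primRelBar D c b n),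
      ∀ (K : {K : Component D c n // K.b = b}) (x : LevelDatum c n) (w : Prim c b n),
        Component.mk D x = K.1 → x.HasVector b τ w → e K = Quot.mk _ w :=
  exists_quot_equiv (LevelDatum.CuspEquiv D) (LevelDatum.SameComponent D) (primRelBar D c b n)
    (fun x => x.b) b (fun x w => x.HasVector b τ w)
    (fun _ _ h => (LevelDatum.sameComponent_iff.1 h).choose_spec.choose_spec.2.2.2.2.1)
    (cuspSetoid D c n).iseqv (fun _ _ => LevelDatum.sameComponent_of_equiv)
    (fun _ _ _ => LevelDatum.equiv_trans_sameComponent)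
    (fun _ _ _ => LevelDatum.sameComponent_trans_equiv) (fun _ _ h => HasVector.b_eq h)
    (fun x hx => exists_equiv_hasVector hτ x hx) (exists_datum hy₀ hτ)
    (fun _ _ _ _ => sameComponent_iff_primRelBar hτ)

end Components

/-! ### Coordinates of level vectors in finite unit groups -/

section Coordinates

variable {F : Type*} [Field F] [NumberField F]
variable {D : Subgroup Fˣ} {c b : FracId F} {n : Ideal (𝓞 F)} [NeZero n]

theorem mem_toIdeal {f : FracId F} {r : 𝓞 F} : r ∈ f.toIdeal ↔ (r : F) ∈ f.mod := Iff.rfl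

theorem toIdeal_ne_bot {f : FracId F} (h : f.mod ≤ (1 : FracId F).mod) : f.toIdeal ≠ ⊥ := by
  obtain ⟨x, hx, hx0⟩ := mod_ne_bot f
  obtain ⟨s, rfl⟩ := mem_mod_one.1 (h hx)
  intro h0
  have : s ∈ f.toIdeal := hx
  rw [h0, Ideal.mem_bot] at this
  exact hx0 (by rw [this]; exact map_zero (algebraMap (𝓞 F) F))

theorem toIdeal_injOn {f g : FracId F} (hf : f.mod ≤ (1 : FracId F).mod)
    (hg : g.mod ≤ (1 : FracId F).mod) (h : f.toIdeal = g.toIdeal) : f = g := by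
  apply mod_injective
  ext x
  constructor
  · intro hx
    obtain ⟨s, rfl⟩ := mem_mod_one.1 (hf hx)
    exact mem_toIdeal.1 (h ▸ mem_toIdeal.2 hx)
  · intro hx
    obtain ⟨s, rfl⟩ := mem_mod_one.1 (hg hx)
    exact mem_toIdeal.1 (h ▸ mem_toIdeal.2 hx)

theorem mul_inv_le_one {f g : FracId F} (h : f.mod ≤ g.mod) :
    (f * g⁻¹).mod ≤ (1 : FracId F).mod := by
  have := mod_mono_mul (h := g⁻¹) h
  rwa [mul_inv_cancel] at this

theorem conductor_le_one {b' : FracId F} (h : b'.mod ≤ ((ofIdeal n)⁻¹ * b).mod) :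
    (ofIdeal n * b' * b⁻¹).mod ≤ (1 : FracId F).mod := by
  have := mod_mono_mul (h := ofIdeal n * b⁻¹) h
  rwa [show (ofIdeal n)⁻¹ * b * (ofIdeal n * b⁻¹) = 1 by
      rw [mul_mul_mul_comm, inv_mul_cancel, mul_inv_cancel, mul_one],
    show b' * (ofIdeal n * b⁻¹) = ofIdeal n * b' * b⁻¹ by
      rw [mul_left_comm, mul_assoc]] at this

/-- The map `b' ↦ bb'⁻¹` is injective with values in the divisors of `n`. -/
theorem finite_between (n : Ideal (𝓞 F)) [NeZero n] (b : FracId F) :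
    {b' : FracId F | b.mod ≤ b'.mod ∧ b'.mod ≤ ((ofIdeal n)⁻¹ * b).mod}.Finite := by
  have hfin : {I : Ideal (𝓞 F) | I ∣ n}.Finite := by
    have : Finite {I : Ideal (𝓞 F) // I ∣ n} :=
      @Finite.of_fintype _ (UniqueFactorizationMonoid.fintypeSubtypeDvd n (NeZero.ne n))
    exact Set.finite_coe_iff.1 this
  refine Set.Finite.of_finite_image (f := fun b' => (b * b'⁻¹).toIdeal) (hfin.subset ?_) ?_
  · rintro _ ⟨b', ⟨h1, h2⟩, rfl⟩
    refine Ideal.dvd_iff_le.2 ?_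
    intro s hs
    rw [mem_toIdeal, mem_mul_inv_iff]
    exact fun y hy => mem_ofIdeal_inv_mul.1 (h2 hy) s hs
  · rintro b₁ ⟨h1, -⟩ b₂ ⟨h2, -⟩ h
    exact inv_injective (mul_left_cancel
      (toIdeal_injOn (mul_inv_le_one h1) (mul_inv_le_one h2) h))

/-- `p ∈ (𝓞/I)^×` is the coordinate of `z` modulo `f` with respect to the generator `x₀`. -/
def IsCoord (f : FracId F) (x₀ : F) {I : Ideal (𝓞 F)} (p : (𝓞 F ⧸ I)ˣ) (z : F) : Prop :=
  ∃ r : 𝓞 F, (p : 𝓞 F ⧸ I) = Ideal.Quotient.mk I r ∧ z - (r : F) * x₀ ∈ f.mod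

section IsCoord

variable {f g : FracId F} {x₀ : F} {I : Ideal (𝓞 F)}

theorem mem_ideal_iff (hx : adjoin f x₀ = g) (r : 𝓞 F) :
    r ∈ (f * g⁻¹).toIdeal ↔ (r : F) * x₀ ∈ f.mod := by
  rw [mem_toIdeal, ← hx, int_mul_mem_iff_adjoin (mem_mod_one.2 ⟨r, rfl⟩)]

/-- Two generators of `g/f` express each other with coefficients `r` and `s`; then `sr - 1`
annihilates `x₀` modulo `f`, so it lies in `I`. -/
theorem exists_isCoord (hx : adjoin f x₀ = g) (hI : ∀ r : 𝓞 F, r ∈ I ↔ (r : F) * x₀ ∈ f.mod)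
    {z : F} (hz : adjoin f z = g) : ∃ p : (𝓞 F ⧸ I)ˣ, IsCoord f x₀ p z := by
  have h1 := mem_adjoin_self f z
  rw [hz, ← hx] at h1
  have h2 := mem_adjoin_self f x₀
  rw [hx, ← hz] at h2
  obtain ⟨y, hy, r, e⟩ := mem_adjoin.1 h1
  obtain ⟨y', hy', s, e'⟩ := mem_adjoin.1 h2
  have hs : Ideal.Quotient.mk I (s * r) = 1 := by
    rw [← map_one (Ideal.Quotient.mk I), Ideal.Quotient.eq, hI]
    have := neg_mem (S := Submodule (𝓞 F) F) (add_mem hy' (int_mul_mem f s hy))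
    convert this using 1
    simp only [map_sub, map_mul, map_one]
    linear_combination -e' - (s : F) * e
  have hu : IsUnit (Ideal.Quotient.mk I r) :=
    IsUnit.of_mul_eq_one_right (Ideal.Quotient.mk I s) (by rw [← map_mul, hs])
  exact ⟨hu.unit, r, hu.unit_spec, by rw [e, add_sub_cancel_right]; exact hy⟩

theorem exists_of_isCoord (f : FracId F) (x₀ : F) (p : (𝓞 F ⧸ I)ˣ) : ∃ z, IsCoord f x₀ p z := by
  obtain ⟨r, hr⟩ := Ideal.Quotient.mk_surjective (p : 𝓞 F ⧸ I)
  exact ⟨r * x₀, r, hr.symm, by rw [sub_self]; exact zero_mem _⟩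

theorem IsCoord.adjoin_eq (hx : adjoin f x₀ = g)
    (hI : ∀ r : 𝓞 F, r ∈ I ↔ (r : F) * x₀ ∈ f.mod) {p : (𝓞 F ⧸ I)ˣ} {z : F}
    (h : IsCoord f x₀ p z) : adjoin f z = g := by
  obtain ⟨r, hr, hz⟩ := h
  rw [adjoin_congr hz, ← hx]
  apply mod_injective
  apply le_antisymm
  · exact adjoin_le (le_adjoin f x₀) (int_mul_mem _ r (mem_adjoin_self f x₀))
  · refine adjoin_le (le_adjoin f _) ?_
    obtain ⟨s, hs⟩ := Ideal.Quotient.mk_surjective ((p⁻¹ : (𝓞 F ⧸ I)ˣ) : 𝓞 F ⧸ I)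
    have h1 : Ideal.Quotient.mk I (s * r) = Ideal.Quotient.mk I 1 := by
      rw [map_mul, hs, ← hr, Units.inv_mul, map_one]
    rw [Ideal.Quotient.eq, hI] at h1
    refine mem_adjoin.2 ⟨_, neg_mem (S := Submodule (𝓞 F) F) h1, s, ?_⟩
    simp only [map_sub, map_mul, map_one]
    ring

/-- As `I` is exactly the annihilator of `x₀` modulo `f`, congruences between vectors become
equations in `𝓞/I`. -/
theorem IsCoord.mul_iff (hI : ∀ r : 𝓞 F, r ∈ I ↔ (r : F) * x₀ ∈ f.mod) {p p' : (𝓞 F ⧸ I)ˣ}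
    {z z' : F} (h : IsCoord f x₀ p z) (h' : IsCoord f x₀ p' z') (s : 𝓞 F) :
    z' - (s : F) * z ∈ f.mod ↔ (p' : 𝓞 F ⧸ I) = Ideal.Quotient.mk I s * p := by
  obtain ⟨r, hr, hz⟩ := h
  obtain ⟨r', hr', hz'⟩ := h'
  rw [hr, hr', ← map_mul, Ideal.Quotient.eq, hI]
  have h1 := sub_mem hz' (int_mul_mem f s hz)
  have e : z' - (s : F) * z = (z' - (r' : F) * x₀ - (s : F) * (z - (r : F) * x₀)) +
      ((r' - s * r : 𝓞 F) : F) * x₀ := by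
    simp only [map_sub, map_mul]
    ring
  rw [e, Submodule.add_mem_iff_right _ h1]

theorem IsCoord.mul {p q : (𝓞 F ⧸ I)ˣ} {z z' : F} (h : IsCoord f x₀ p z) {s : 𝓞 F}
    (hq : (q : 𝓞 F ⧸ I) = Ideal.Quotient.mk I s) (hz : z' - (s : F) * z ∈ f.mod) :
    IsCoord f x₀ (q * p) z' := by
  obtain ⟨r, hr, h⟩ := h
  refine ⟨s * r, by rw [Units.val_mul, hq, hr, map_mul], ?_⟩
  have := add_mem hz (int_mul_mem f s h)
  convert this using 1
  simp only [map_mul]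
  ring

end IsCoord

/-- `(𝓞/bb'⁻¹)^× × (𝓞/nb'b⁻¹)^×`. -/
abbrev LevelUnits (n : Ideal (𝓞 F)) [NeZero n] (b b' : FracId F) : Type _ :=
  (𝓞 F ⧸ (b * b'⁻¹).toIdeal)ˣ × (𝓞 F ⧸ (ofIdeal n * b' * b⁻¹).toIdeal)ˣ

/-- The homomorphism `(u, ε) ↦ (uε, u⁻¹)`. -/
def unitsChar (D : Subgroup Fˣ) (n : Ideal (𝓞 F)) [NeZero n] (b b' : FracId F) :
    (𝓞 F)ˣ × unitsDPlus D →* LevelUnits n b b' :=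
  ((Units.map (Ideal.Quotient.mk (b * b'⁻¹).toIdeal).toMonoidHom).comp
    (MonoidHom.fst _ _ * (unitsDPlus D).subtype.comp (MonoidHom.snd _ _))).prod
  ((Units.map (Ideal.Quotient.mk (ofIdeal n * b' * b⁻¹).toIdeal).toMonoidHom).comp
    (MonoidHom.fst _ _)⁻¹)

theorem unitsChar_fst (b' : FracId F) (p : (𝓞 F)ˣ × unitsDPlus D) :
    ((unitsChar D n b b' p).1 : 𝓞 F ⧸ (b * b'⁻¹).toIdeal) =
      Ideal.Quotient.mk _ ((p.1 : 𝓞 F) * p.2.1) := rfl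

theorem unitsChar_snd (b' : FracId F) (p : (𝓞 F)ˣ × unitsDPlus D) :
    ((unitsChar D n b b' p).2 : 𝓞 F ⧸ (ofIdeal n * b' * b⁻¹).toIdeal) =
      Ideal.Quotient.mk _ ((p.1⁻¹ : (𝓞 F)ˣ) : 𝓞 F) := rfl

theorem finite_levelUnits {b' : FracId F} (h : b.mod ≤ b'.mod)
    (h' : b'.mod ≤ ((ofIdeal n)⁻¹ * b).mod) : Finite (LevelUnits n b b') := by
  have h1 := Ideal.finiteQuotientOfFreeOfNeBot _ (toIdeal_ne_bot (mul_inv_le_one h))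
  have h2 := Ideal.finiteQuotientOfFreeOfNeBot _ (toIdeal_ne_bot (conductor_le_one h'))
  infer_instance

/-- By the second isomorphism theorem `[N · im χ : N] = [U : χ⁻¹N]`. This index is finite although
`U`, a group of units, may be infinite. -/
theorem card_quotient_sup {Q U : Type*} [CommGroup Q] [Finite Q] [Group U] (χ : U →* Q)
    (N : Subgroup Q) : (Nat.card (Q ⧸ (N ⊔ χ.range)) : ℚ) =
      (Nat.card Q : ℚ) / ((Nat.card N : ℚ) * ((N.comap χ).index : ℚ)) := by
  have h1 : (N.comap χ).index = N.relIndex (χ.range ⊔ N) := by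
    rw [Subgroup.index_comap, Subgroup.relIndex_sup_right]
  have h2 : N.relIndex (χ.range ⊔ N) * (χ.range ⊔ N).index = N.index :=
    Subgroup.relIndex_mul_index le_sup_right
  have h3 := N.card_mul_index
  have h4 : Nat.card (Q ⧸ (N ⊔ χ.range)) * (Nat.card N * (N.comap χ).index) = Nat.card Q := by
    rw [← h3, ← h2, h1, sup_comm]
    change (χ.range ⊔ N).index * _ = _
    ring
  have h5 : Nat.card N * (N.comap χ).index ≠ 0 := by
    intro h0
    rw [h0, mul_zero] at h4
    exact Nat.card_pos.ne h4
  rw [eq_div_iff (by exact_mod_cast h5)]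
  exact_mod_cast h4

/-- A matrix `(α ξ; 0 δ)` with free entry `ξ ∈ (cb²)^*`, acting on classes of vectors. -/
theorem exists_upper_iff (α δ : 𝓞 F) {w w' : Tors n (prodLat b (b * c).star)}
    {v v' : divBy n (prodLat b (b * c).star)} (hw : w = Tors.mk v) (hw' : w' = Tors.mk v') :
    (∃ (ξ : F) (x x' : divBy n (prodLat b (b * c).star)), ξ ∈ (c * b ^ 2).star.mod ∧
      w = Tors.mk x ∧ w' = Tors.mk x' ∧ x'.1 = x.1 ᵥ* !![(α : F), ξ; 0, (δ : F)]) ↔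
    v'.1 0 - α * v.1 0 ∈ b.mod ∧
      v'.1 1 - δ * v.1 1 ∈ ((b * c).star * adjoin b (v.1 0) * b⁻¹).mod := by
  subst hw hw'
  rw [mem_mul_adjoin_iff]
  constructor
  · rintro ⟨ξ, x, x', hξ, h, h', e⟩
    rw [Tors.mk_eq_mk_iff] at h h'
    rw [star_sq] at hξ
    have e0 : x'.1 0 = α * x.1 0 := by rw [e, vecMul_zero_coord]; simp [mul_comm]
    have e1 : x'.1 1 = ξ * x.1 0 + δ * x.1 1 := by rw [e, vecMul_one_coord]; simp [mul_comm]
    obtain ⟨h0, h1⟩ := h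
    obtain ⟨h0', h1'⟩ := h'
    rw [Pi.sub_apply] at h0 h1 h0' h1'
    rw [e0] at h0'
    rw [e1] at h1'
    refine ⟨?_, -ξ, neg_mem (S := Submodule (𝓞 F) F) hξ, ?_⟩
    · have := sub_mem h0' (int_mul_mem b α h0)
      convert this using 1
      ring
    · have := sub_mem h1' (add_mem (mem_mul_inv_iff.1 hξ _ h0) (int_mul_mem _ δ h1))
      convert this using 1
      ring
  · rintro ⟨h0, ξ, hξ, h1⟩
    set M : Matrix (Fin 2) (Fin 2) F := !![(α : F), -ξ; 0, (δ : F)] with hM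
    have hd : v'.1 - v.1 ᵥ* M ∈ prodLat b (b * c).star := by
      refine ⟨?_, ?_⟩
      · rw [Pi.sub_apply, vecMul_zero_coord]
        simpa [hM, mul_comm] using h0
      · rw [Pi.sub_apply, vecMul_one_coord]
        convert h1 using 1
        simp [hM]
        ring
    have hmem : v.1 ᵥ* M ∈ divBy n (prodLat b (b * c).star) := by
      have := sub_mem v'.2 (le_divBy n _ hd)
      rwa [sub_sub_cancel] at this
    exact ⟨-ξ, v, ⟨_, hmem⟩, by rw [star_sq]; exact neg_mem (S := Submodule (𝓞 F) F) hξ, rfl,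
      Tors.mk_eq_mk_iff.2 hd, rfl⟩

/-- Eliminating `ξ` leaves one congruence for each coordinate. The redundant integer `k = 1` gives
cusps the same shape as components, so that one count serves both. -/
theorem primRel_iff {w w' : Prim c b n} {v v' : divBy n (prodLat b (b * c).star)}
    (hw : w.1 = Tors.mk v) (hw' : w'.1 = Tors.mk v') : primRel D c b n w w' ↔
      ∃ p : (𝓞 F)ˣ × unitsDPlus D, ∃ k : ℤ, k = 1 ∧
        v'.1 0 - ((k * (p.1 * p.2.1) : 𝓞 F) : F) * v.1 0 ∈ b.mod ∧
        v'.1 1 - ((p.1⁻¹ : (𝓞 F)ˣ) : 𝓞 F) * v.1 1 ∈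
          ((b * c).star * adjoin b (v.1 0) * b⁻¹).mod := by
  constructor
  · rintro ⟨u, ε, ξ, x, x', hε, hξ, h, h', e⟩
    refine ⟨(u, ⟨ε, hε⟩), 1, rfl, (exists_upper_iff _ _ hw hw').1 ⟨ξ, x, x', hξ, h, h', ?_⟩⟩
    simpa using e
  · rintro ⟨⟨u, ε, hε⟩, k, rfl, h⟩
    obtain ⟨ξ, x, x', hξ, h1, h2, e⟩ := (exists_upper_iff _ _ hw hw').2 h
    exact ⟨u, ε, ξ, x, x', hε, hξ, h1, h2, by simpa using e⟩

theorem primRelBar_iff {w w' : Prim c b n} {v v' : divBy n (prodLat b (b * c).star)}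
    (hw : w.1 = Tors.mk v) (hw' : w'.1 = Tors.mk v') : primRelBar D c b n w w' ↔
      ∃ p : (𝓞 F)ˣ × unitsDPlus D, ∃ k : ℤ,
        IsUnit (k : ZMod (quotExponent b.mod (adjoin b (v.1 0)).mod)) ∧
        v'.1 0 - ((k * (p.1 * p.2.1) : 𝓞 F) : F) * v.1 0 ∈ b.mod ∧
        v'.1 1 - ((p.1⁻¹ : (𝓞 F)ˣ) : 𝓞 F) * v.1 1 ∈
          ((b * c).star * adjoin b (v.1 0) * b⁻¹).mod := by
  -- Another representative changes `v₀` by an element of `b`, so `b'` and the exponent of `b'/b`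
  -- depend only on the class.
  have hadj : ∀ x : divBy n (prodLat b (b * c).star), w.1 = Tors.mk x →
      Submodule.span (𝓞 F) {x.1 0} ⊔ b.mod = (adjoin b (v.1 0)).mod := fun x hx => by
    rw [← adjoin_mod]
    rw [hw, Tors.mk_eq_mk_iff] at hx
    exact congrArg FracId.mod (adjoin_congr hx.1).symm
  constructor
  · rintro ⟨u, ε, ξ, x, x', a, k, hε, hξ, h, h', hk, e⟩
    have hk' := a.isUnit
    rw [← hk, hadj x h] at hk'
    refine ⟨(u, ⟨ε, hε⟩), k, hk', (exists_upper_iff _ _ hw hw').1 ⟨ξ, x, x', hξ, h, h', ?_⟩⟩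
    simpa [mul_assoc] using e
  · rintro ⟨⟨u, ε, hε⟩, k, hk, h⟩
    obtain ⟨ξ, x, x', hξ, h1, h2, e⟩ := (exists_upper_iff _ _ hw hw').2 h
    rw [← hadj x h1] at hk
    exact ⟨u, ε, ξ, x, x', hk.unit, k, hε, hξ, h1, h2, hk.unit_spec.symm, by
      simpa [mul_assoc] using e⟩

end Coordinates

/-! ### Cardinalities of the orbit sets -/

section Counting

variable {F : Type*} [Field F] [NumberField F]
variable {D : Subgroup Fˣ} {c b : FracId F} {n : Ideal (𝓞 F)} [NeZero n] {y₀ : F}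

/-- The set of ideals `b'` with `b ⊆ b' ⊆ n⁻¹b`. -/
abbrev Between (n : Ideal (𝓞 F)) [NeZero n] (b : FracId F) : Type _ :=
  {b' : FracId F // b.mod ≤ b'.mod ∧ b'.mod ≤ ((ofIdeal n)⁻¹ * b).mod}

/-- The relation is the kernel of a map, hence an equivalence, and `Quot` makes no further
identifications. -/
theorem card_quot_congr {W Y : Type*} {s : W → W → Prop} (f : W → Y) (hf : Function.Surjective f)
    (h : ∀ w w', s w w' ↔ f w = f w') : Nonempty (Quot s ≃ Y) := by
  let g : Quot s → Y := Quot.lift f fun w w' hw => (h w w').1 hw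
  refine ⟨Equiv.ofBijective g ⟨?_, fun y => ?_⟩⟩
  · intro q q' hq
    obtain ⟨w, rfl⟩ := Quot.exists_rep q
    obtain ⟨w', rfl⟩ := Quot.exists_rep q'
    exact Quot.sound ((h w w').2 hq)
  · obtain ⟨w, rfl⟩ := hf y
    exact ⟨Quot.mk s w, rfl⟩

theorem exists_adjoin_eq {f g : FracId F} (h : f.mod ≤ g.mod) : ∃ x, adjoin f x = g := by
  obtain ⟨x, hx⟩ := exists_add_prin_eq h
  exact ⟨x, Units.ext ((coe_adjoin f x).trans hx)⟩

theorem second_le {b' : FracId F} (A : FracId F) (h : b'.mod ≤ ((ofIdeal n)⁻¹ * b).mod) :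
    (A * b' * b⁻¹).mod ≤ ((ofIdeal n)⁻¹ * A).mod := by
  have := mod_mono_mul (h := A * b⁻¹) h
  rwa [show (ofIdeal n)⁻¹ * b * (A * b⁻¹) = (ofIdeal n)⁻¹ * A by
      rw [mul_mul_mul_comm, mul_inv_cancel, mul_one],
    show b' * (A * b⁻¹) = A * b' * b⁻¹ by rw [mul_left_comm, mul_assoc]] at this

theorem second_ideal (A b' : FracId F) :
    A * b' * b⁻¹ * ((ofIdeal n)⁻¹ * A)⁻¹ = ofIdeal n * b' * b⁻¹ :=
  Additive.ofMul.injective (by simp only [ofMul_mul, ofMul_inv]; abel)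

/-- A relation on primitive vectors that is described by a subgroup `N` of the level units. -/
theorem exists_sigma_equiv {s : Prim c b n → Prim c b n → Prop} (Z : FracId F → Set ℤ)
    (N : ∀ b', Subgroup (LevelUnits n b b'))
    (hs : ∀ (w w' : Prim c b n) (v v' : divBy n (prodLat b (b * c).star)), w.1 = Tors.mk v →
      w'.1 = Tors.mk v' → (s w w' ↔ ∃ p : (𝓞 F)ˣ × unitsDPlus D, ∃ k : ℤ,
        k ∈ Z (adjoin b (v.1 0)) ∧
        v'.1 0 - ((k * (p.1 * p.2.1) : 𝓞 F) : F) * v.1 0 ∈ b.mod ∧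
        v'.1 1 - ((p.1⁻¹ : (𝓞 F)ˣ) : 𝓞 F) * v.1 1 ∈
          ((b * c).star * adjoin b (v.1 0) * b⁻¹).mod))
    (hN : ∀ b' q, q ∈ N b' ↔ ∃ k ∈ Z b', (q.1 : 𝓞 F ⧸ (b * b'⁻¹).toIdeal) =
      Ideal.Quotient.mk _ (k : 𝓞 F) ∧ q.2 = 1)
    (hZ : ∀ b', ∀ k ∈ Z b', ∃ q : (𝓞 F ⧸ (b * b'⁻¹).toIdeal)ˣ,
      (q : 𝓞 F ⧸ (b * b'⁻¹).toIdeal) = Ideal.Quotient.mk _ (k : 𝓞 F)) :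
    Nonempty (Quot s ≃
      Σ β : Between n b, LevelUnits n b β.1 ⧸ (N β.1 ⊔ (unitsChar D n b β.1).range)) := by
  choose x₀ hx₀ using fun β : Between n b => exists_adjoin_eq β.2.1
  choose y₁ hy₁ using fun β : Between n b => exists_adjoin_eq (second_le (b * c).star β.2.2)
  have hI : ∀ (β : Between n b) (r : 𝓞 F),
      r ∈ (b * β.1⁻¹).toIdeal ↔ (r : F) * x₀ β ∈ b.mod := fun β => mem_ideal_iff (hx₀ β)
  have hJ : ∀ (β : Between n b) (r : 𝓞 F), r ∈ (ofIdeal n * β.1 * b⁻¹).toIdeal ↔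
      (r : F) * y₁ β ∈ ((b * c).star * β.1 * b⁻¹).mod := fun β r => by
    rw [← mem_ideal_iff (hy₁ β), second_ideal]
  -- A primitive vector is encoded by `b'`, by the unit comparing `v₀` with a fixed generator of
  -- `b'/b`, and by the unit comparing `v₁` with a fixed generator of `n⁻¹(bc)^*` over `(bc)^*
  -- b'b⁻¹`. The code sees `v₁` only up to shears.
  let Rel : Prim c b n → (Σ β : Between n b, LevelUnits n b β.1) → Prop := fun w y =>
    ∃ v : divBy n (prodLat b (b * c).star), w.1 = Tors.mk v ∧
      IsCoord b (x₀ y.1) y.2.1 (v.1 0) ∧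
      IsCoord ((b * c).star * y.1.1 * b⁻¹) (y₁ y.1) y.2.2 (v.1 1)
  let π : (Σ β : Between n b, LevelUnits n b β.1) →
      Σ β : Between n b, LevelUnits n b β.1 ⧸ (N β.1 ⊔ (unitsChar D n b β.1).range) :=
    fun y => ⟨y.1, QuotientGroup.mk y.2⟩
  have htot : ∀ w, ∃ y, Rel w y := by
    intro w
    obtain ⟨v, hv, hp⟩ := isPrimitive_rep w
    have hvm := mem_divBy_prodLat.1 v.2
    let β : Between n b := ⟨adjoin b (v.1 0), le_adjoin _ _,
      adjoin_le (le_ofIdeal_inv_mul n b) hvm.1⟩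
    obtain ⟨p, hp1⟩ := exists_isCoord (hx₀ β) (hI β) (z := v.1 0) rfl
    obtain ⟨q, hq1⟩ := exists_isCoord (hy₁ β) (hJ β) hp
    exact ⟨⟨β, p, q⟩, v, hv, hp1, hq1⟩
  have hsurj : ∀ y, ∃ w, Rel w y := by
    rintro ⟨β, p, q⟩
    obtain ⟨z₀, h0⟩ := exists_of_isCoord b (x₀ β) p
    obtain ⟨z₁, h1⟩ := exists_of_isCoord ((b * c).star * β.1 * b⁻¹) (y₁ β) q
    have e0 := h0.adjoin_eq (hx₀ β) (hI β)
    have e1 := h1.adjoin_eq (hy₁ β) (hJ β)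
    have hm : (![z₀, z₁] : Fin 2 → F) ∈ divBy n (prodLat b (b * c).star) := by
      refine mem_divBy_prodLat.2 ⟨?_, ?_⟩
      · exact β.2.2 (e0 ▸ mem_adjoin_self b z₀)
      · exact e1 ▸ mem_adjoin_self ((b * c).star * β.1 * b⁻¹) z₁
    refine ⟨⟨Tors.mk ⟨_, hm⟩, (isPrimitive_iff rfl _).2 ?_⟩, ⟨_, hm⟩, rfl, h0, h1⟩
    change adjoin ((b * c).star * adjoin b z₀ * b⁻¹) z₁ = _
    rw [e0, e1]
  have key : ∀ w w' y y', Rel w y → Rel w' y' → (s w w' ↔ π y = π y') := by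
    rintro w w' ⟨β, q⟩ ⟨β', q'⟩ ⟨v, hv, h0, h1⟩ ⟨v', hv', h0', h1'⟩
    have e0 : adjoin b (v.1 0) = β.1 := h0.adjoin_eq (hx₀ β) (hI β)
    have e0' : adjoin b (v'.1 0) = β'.1 := h0'.adjoin_eq (hx₀ β') (hI β')
    rw [hs w w' v v' hv hv', e0]
    constructor
    · rintro ⟨p, k, hk, h2, h3⟩
      obtain ⟨a, ha⟩ := hZ β.1 k hk
      -- Since `kuε` is a unit modulo `bb'⁻¹`, the new first coordinate generates the same `b'`:
      -- orbits do not mix different `b'`.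
      have h4 : IsCoord b (x₀ β) (a * (unitsChar D n b β.1 p).1 * q.1) (v'.1 0) :=
        h0.mul (s := (k : 𝓞 F) * ((p.1 : 𝓞 F) * p.2.1)) (by
          rw [Units.val_mul, ha, unitsChar_fst, ← map_mul]) h2
      have hβ : β = β' := Subtype.ext ((h4.adjoin_eq (hx₀ β) (hI β)).symm.trans e0')
      subst hβ
      have h5 := (h0.mul_iff (hI β) h0' _).1 h2
      have h6 := (h1.mul_iff (hJ β) h1' _).1 h3
      refine Sigma.ext rfl (heq_of_eq ?_)
      refine QuotientGroup.eq.2 (Subgroup.mem_sup.2 ⟨(a, 1), (hN _ _).2 ⟨k, hk, ha, rfl⟩,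
        unitsChar D n b β.1 p, ⟨p, rfl⟩, ?_⟩)
      refine eq_inv_mul_of_mul_eq (Prod.ext (Units.ext ?_) (Units.ext ?_))
      · change (q.1 : 𝓞 F ⧸ (b * β.1⁻¹).toIdeal) * ((a : 𝓞 F ⧸ (b * β.1⁻¹).toIdeal) *
          ((unitsChar D n b β.1 p).1 : 𝓞 F ⧸ (b * β.1⁻¹).toIdeal)) = q'.1
        exact (mul_comm _ _).trans ((congrArg (· * (q.1 : 𝓞 F ⧸ (b * β.1⁻¹).toIdeal))
          (by rw [ha, unitsChar_fst, ← map_mul])).trans h5.symm)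
      · change (q.2 : 𝓞 F ⧸ (ofIdeal n * β.1 * b⁻¹).toIdeal) * (1 *
          ((unitsChar D n b β.1 p).2 : 𝓞 F ⧸ (ofIdeal n * β.1 * b⁻¹).toIdeal)) = q'.2
        exact (mul_comm _ _).trans
          ((congrArg (· * (q.2 : 𝓞 F ⧸ (ofIdeal n * β.1 * b⁻¹).toIdeal))
            (by rw [one_mul, unitsChar_snd])).trans h6.symm)
    · intro h
      have hβ : β = β' := congrArg Sigma.fst h
      subst hβ
      have h2 := eq_of_heq (Sigma.mk.inj h).2
      rw [QuotientGroup.eq, Subgroup.mem_sup] at h2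
      obtain ⟨⟨a, a'⟩, hν, _, ⟨p, rfl⟩, e⟩ := h2
      obtain ⟨k, hk, ha, rfl⟩ := (hN _ _).1 hν
      have e := eq_mul_of_inv_mul_eq e.symm
      have e1 := congrArg (fun z : LevelUnits n b β.1 => (z.1 : 𝓞 F ⧸ (b * β.1⁻¹).toIdeal)) e
      have e2 := congrArg (fun z : LevelUnits n b β.1 =>
        (z.2 : 𝓞 F ⧸ (ofIdeal n * β.1 * b⁻¹).toIdeal)) e
      refine ⟨p, k, hk, (h0.mul_iff (hI β) h0' _).2 ?_, (h1.mul_iff (hJ β) h1' _).2 ?_⟩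
      · refine e1.trans ?_
        change (q.1 : 𝓞 F ⧸ (b * β.1⁻¹).toIdeal) * ((a : 𝓞 F ⧸ (b * β.1⁻¹).toIdeal) *
          ((unitsChar D n b β.1 p).1 : 𝓞 F ⧸ (b * β.1⁻¹).toIdeal)) = _
        have ha : (a : 𝓞 F ⧸ (b * β.1⁻¹).toIdeal) = Ideal.Quotient.mk _ (k : 𝓞 F) := ha
        exact (mul_comm _ _).trans (congrArg (· * (q.1 : 𝓞 F ⧸ (b * β.1⁻¹).toIdeal))
          ((congrArg₂ (· * ·) ha (unitsChar_fst _ _)).trans (map_mul _ _ _).symm))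
      · refine e2.trans ?_
        change (q.2 : 𝓞 F ⧸ (ofIdeal n * β.1 * b⁻¹).toIdeal) * (1 *
          ((unitsChar D n b β.1 p).2 : 𝓞 F ⧸ (ofIdeal n * β.1 * b⁻¹).toIdeal)) = _
        exact (mul_comm _ _).trans
          (congrArg (· * (q.2 : 𝓞 F ⧸ (ofIdeal n * β.1 * b⁻¹).toIdeal))
            ((one_mul _).trans (unitsChar_snd _ _)))
  choose y hy using htot
  refine card_quot_congr (fun w => π (y w)) ?_ fun w w' => key _ _ _ _ (hy w) (hy w')
  rintro ⟨β, q⟩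
  obtain ⟨q, rfl⟩ := QuotientGroup.mk_surjective q
  obtain ⟨w, hw⟩ := hsurj ⟨β, q⟩
  exact ⟨w, (key _ _ _ _ (hy w) hw).1 ((key _ _ _ _ hw hw).2 rfl)⟩

/-- Each fibre over `b'` is the quotient of a finite commutative group by `N` together with the
image of the units, and is counted by `card_quotient_sup`. -/
theorem card_of_sigma_equiv {X : Type*} (N : ∀ b', Subgroup (LevelUnits n b b'))
    (h : Nonempty (X ≃
      Σ β : Between n b, LevelUnits n b β.1 ⧸ (N β.1 ⊔ (unitsChar D n b β.1).range))) :
    Finite X ∧ (Nat.card X : ℚ) =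
      ∑ᶠ (b' : FracId F) (_ : b.mod ≤ b'.mod ∧ b'.mod ≤ ((ofIdeal n)⁻¹ * b).mod),
        (Nat.card (𝓞 F ⧸ (b * b'⁻¹).toIdeal)ˣ : ℚ) *
          (Nat.card (𝓞 F ⧸ (ofIdeal n * b' * b⁻¹).toIdeal)ˣ : ℚ) /
          ((Nat.card (N b') : ℚ) * (((N b').comap (unitsChar D n b b')).index : ℚ)) := by
  obtain ⟨e⟩ := h
  have hfin : Finite (Between n b) := (finite_between n b).to_subtype
  have hQ : ∀ β : Between n b, Finite (LevelUnits n b β.1) := fun β =>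
    finite_levelUnits β.2.1 β.2.2
  have := Fintype.ofFinite (Between n b)
  refine ⟨Finite.of_equiv _ e.symm, ?_⟩
  rw [Nat.card_congr e, Nat.card_sigma, Nat.cast_sum]
  rw [← finsum_subtype_eq_finsum_cond, finsum_eq_sum_of_fintype]
  refine Finset.sum_congr rfl fun β _ => ?_
  rw [card_quotient_sup, Nat.card_prod, Nat.cast_mul]

/-- The second component of the character is `u⁻¹`, but `u⁻¹ ≡ 1` and `u ≡ 1` are the same
condition. The preimage of `N` is thus `unitsC` or `unitsCbar`, according to the choice of `Z`. -/
theorem mem_comap_unitsChar {Z : Set ℤ} {b' : FracId F} {N : Subgroup (LevelUnits n b b')}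
    (hN : ∀ q, q ∈ N ↔ ∃ k ∈ Z, (q.1 : 𝓞 F ⧸ (b * b'⁻¹).toIdeal) =
      Ideal.Quotient.mk _ (k : 𝓞 F) ∧ q.2 = 1) (p : (𝓞 F)ˣ × unitsDPlus D) :
    p ∈ N.comap (unitsChar D n b b') ↔
      ((p.1 : 𝓞 F) : F) - 1 ∈ (ofIdeal n * b' * b⁻¹).mod ∧
      ∃ k ∈ Z, ((p.1 : 𝓞 F) : F) * ((p.2.1 : 𝓞 F) : F) - (k : F) ∈ (b * b'⁻¹).mod := by
  have h2 : (unitsChar D n b b' p).2 = 1 ↔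
      ((p.1 : 𝓞 F) : F) - 1 ∈ (ofIdeal n * b' * b⁻¹).mod := by
    rw [Units.ext_iff, unitsChar_snd, Units.val_one,
      ← map_one (Ideal.Quotient.mk (ofIdeal n * b' * b⁻¹).toIdeal), Ideal.Quotient.eq, mem_toIdeal]
    simp only [map_sub, map_one]
    exact unit_sub_one_mem_iff _
  have h1 : ∀ k : ℤ, ((unitsChar D n b b' p).1 : 𝓞 F ⧸ (b * b'⁻¹).toIdeal) =
      Ideal.Quotient.mk _ (k : 𝓞 F) ↔
      ((p.1 : 𝓞 F) : F) * ((p.2.1 : 𝓞 F) : F) - (k : F) ∈ (b * b'⁻¹).mod := fun k => by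
    rw [unitsChar_fst, Ideal.Quotient.eq, mem_toIdeal]
    simp only [map_sub, map_mul, map_intCast]
  rw [Subgroup.mem_comap, hN, h2]
  simp only [h1]
  constructor
  · rintro ⟨k, hk, h3, h4⟩
    exact ⟨h4, k, hk, h3⟩
  · rintro ⟨h4, k, hk, h3⟩
    exact ⟨k, hk, h3, h4⟩

/-- With `N` trivial, the fibre over `b'` is the cokernel of `(u, ε) ↦ (uε, u⁻¹)`, whose kernel is
`𝓞_C^×`. -/
theorem card_quot_primRel (D : Subgroup Fˣ) (c b : FracId F) (n : Ideal (𝓞 F)) [NeZero n] :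
    Finite (Quot (primRel D c b n)) ∧ (Nat.card (Quot (primRel D c b n)) : ℚ) =
      ∑ᶠ (b' : FracId F) (_ : b.mod ≤ b'.mod ∧ b'.mod ≤ ((ofIdeal n)⁻¹ * b).mod),
        (Nat.card (𝓞 F ⧸ (b * b'⁻¹).toIdeal)ˣ : ℚ) *
          (Nat.card (𝓞 F ⧸ (ofIdeal n * b' * b⁻¹).toIdeal)ˣ : ℚ) /
          ((unitsC D n b b').index : ℚ) := by
  have hN : ∀ (b' : FracId F) (q : LevelUnits n b b'), q ∈ (⊥ : Subgroup (LevelUnits n b b')) ↔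
      ∃ k ∈ ({1} : Set ℤ), (q.1 : 𝓞 F ⧸ (b * b'⁻¹).toIdeal) =
        Ideal.Quotient.mk _ (k : 𝓞 F) ∧ q.2 = 1 := by
    intro b' q
    rw [Subgroup.mem_bot]
    constructor
    · rintro rfl
      exact ⟨1, rfl, by simp, rfl⟩
    · rintro ⟨k, rfl, h1, h2⟩
      exact Prod.ext (Units.ext (by simpa using h1)) h2
  have hcomap : ∀ b', (⊥ : Subgroup (LevelUnits n b b')).comap (unitsChar D n b b') =
      unitsC D n b b' := by
    intro b'
    ext p
    rw [mem_comap_unitsChar (hN b')]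
    change _ ↔ _ ∧ _
    simp
  have h := card_of_sigma_equiv (D := D) (fun b' => ⊥) (exists_sigma_equiv (D := D)
    (s := primRel D c b n) (fun _ => {1}) (fun b' => ⊥) (fun w w' v v' h h' => primRel_iff h h') hN
    (fun b' k hk => ⟨1, by rw [Set.mem_singleton_iff.1 hk]; simp⟩))
  simpa only [hcomap, Nat.card_unique, Nat.cast_one, one_mul] using h

/-- An integer `m` lies in `bb'⁻¹` iff `mb' ⊆ b`, iff the exponent of `b'/b` divides `m`. For `b' =
b` the exponent is `1` and the quotient is the zero ring. -/
theorem quot_charP (b b' : FracId F) :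
    CharP (𝓞 F ⧸ (b * b'⁻¹).toIdeal) (quotExponent b.mod b'.mod) := by
  constructor
  intro m
  rw [← map_natCast (Ideal.Quotient.mk (b * b'⁻¹).toIdeal), Ideal.Quotient.eq_zero_iff_mem,
    mem_toIdeal]
  simp only [map_natCast]
  rw [mem_mul_inv_iff]
  constructor
  · intro h
    refine AddMonoid.exponent_dvd_of_forall_nsmul_eq_zero fun w => ?_
    obtain ⟨v, rfl⟩ := Submodule.Quotient.mk_surjective _ w
    rw [← Submodule.Quotient.mk_smul, Submodule.Quotient.mk_eq_zero]
    change m • v.1 ∈ b.mod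
    rw [nsmul_eq_mul]
    exact h _ v.2
  · intro h y hy
    exact_mod_cast exponent_mul_mem (k := m) (Int.natCast_dvd_natCast.2 h) hy

/-- The embedding `(ℤ/e)^× → (𝓞/bb'⁻¹)^×`, where `e` is the exponent of `b'/b`. -/
def intUnits (b b' : FracId F) :
    (ZMod (quotExponent b.mod b'.mod))ˣ →* (𝓞 F ⧸ (b * b'⁻¹).toIdeal)ˣ :=
  haveI := quot_charP b b'
  Units.map (ZMod.castHom dvd_rfl (𝓞 F ⧸ (b * b'⁻¹).toIdeal)).toMonoidHom

theorem intUnits_injective (b b' : FracId F) : Function.Injective (intUnits b b') := by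
  have := quot_charP b b'
  exact Units.map_injective (ZMod.castHom_injective _)

theorem intUnits_coe (b b' : FracId F) (a : (ZMod (quotExponent b.mod b'.mod))ˣ) {k : ℤ}
    (hk : (k : ZMod (quotExponent b.mod b'.mod)) = a) :
    (intUnits b b' a : 𝓞 F ⧸ (b * b'⁻¹).toIdeal) = Ideal.Quotient.mk _ (k : 𝓞 F) := by
  have := quot_charP b b'
  change ZMod.castHom dvd_rfl (𝓞 F ⧸ (b * b'⁻¹).toIdeal) a.1 = _
  rw [← hk, map_intCast, map_intCast]

/-- Here `N` is the image of `(ℤ/e)^×` in the first factor, with `e` the exponent of `b'/b`.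
Injectivity of that map puts the order of `(ℤ/e)^×` in the denominator. -/
theorem card_quot_primRelBar (D : Subgroup Fˣ) (c b : FracId F) (n : Ideal (𝓞 F)) [NeZero n] :
    Finite (Quot (primRelBar D c b n)) ∧ (Nat.card (Quot (primRelBar D c b n)) : ℚ) =
      ∑ᶠ (b' : FracId F) (_ : b.mod ≤ b'.mod ∧ b'.mod ≤ ((ofIdeal n)⁻¹ * b).mod),
        (Nat.card (𝓞 F ⧸ (b * b'⁻¹).toIdeal)ˣ : ℚ) *
          (Nat.card (𝓞 F ⧸ (ofIdeal n * b' * b⁻¹).toIdeal)ˣ : ℚ) /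
          ((Nat.card (ZMod (quotExponent b.mod b'.mod))ˣ : ℚ) *
            ((unitsCbar D n b b').index : ℚ)) := by
  let ι : ∀ b' : FracId F, (ZMod (quotExponent b.mod b'.mod))ˣ →* LevelUnits n b b' :=
    fun b' => (intUnits b b').prod 1
  have hι : ∀ b', Function.Injective (ι b') := fun b' a a' h =>
    intUnits_injective b b' (congrArg Prod.fst h)
  have hN : ∀ (b' : FracId F) (q : LevelUnits n b b'), q ∈ (ι b').range ↔
      ∃ k ∈ {k : ℤ | IsUnit (k : ZMod (quotExponent b.mod b'.mod))},
        (q.1 : 𝓞 F ⧸ (b * b'⁻¹).toIdeal) = Ideal.Quotient.mk _ (k : 𝓞 F) ∧ q.2 = 1 := by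
    intro b' q
    constructor
    · rintro ⟨a, rfl⟩
      obtain ⟨k, hk⟩ := ZMod.intCast_surjective (a : ZMod (quotExponent b.mod b'.mod))
      exact ⟨k, (by
        change IsUnit ((k : ℤ) : ZMod (quotExponent b.mod b'.mod))
        rw [hk]
        exact a.isUnit), intUnits_coe b b' a hk, rfl⟩
    · rintro ⟨k, hk, h1, h2⟩
      refine ⟨IsUnit.unit hk, Prod.ext (Units.ext ?_) h2.symm⟩
      exact (intUnits_coe b b' _ (IsUnit.unit_spec hk).symm).trans h1.symm
  have hcomap : ∀ b', (ι b').range.comap (unitsChar D n b b') = unitsCbar D n b b' := by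
    intro b'
    ext p
    rw [mem_comap_unitsChar (hN b')]
    change _ ↔ _ ∧ _
    refine and_congr_right fun _ => exists_congr fun k => and_congr_left fun _ => ?_
    exact (ZMod.coe_int_isUnit_iff_isCoprime _ _).trans isCoprime_comm
  have hcard : ∀ b', Nat.card (ι b').range = Nat.card (ZMod (quotExponent b.mod b'.mod))ˣ :=
    fun b' => Nat.card_congr (MonoidHom.ofInjective (hι b')).toEquiv.symm
  have h := card_of_sigma_equiv (D := D) (fun b' => (ι b').range) (exists_sigma_equiv (D := D)
    (s := primRelBar D c b n) (fun b' => {k : ℤ | IsUnit (k : ZMod (quotExponent b.mod b'.mod))})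
    (fun b' => (ι b').range) (fun w w' v v' h h' => primRelBar_iff h h') hN
    (fun b' k hk => ⟨intUnits b b' (IsUnit.unit hk), intUnits_coe b b' _
      (IsUnit.unit_spec hk).symm⟩))
  simpa only [hcomap, hcard] using h

end Counting

/-! ### Assembly of the statements for a cusp or component -/

section Conclusion

variable {F : Type*} [Field F] [NumberField F] {D : Subgroup Fˣ} {c : FracId F} {n : Ideal (𝓞 F)}
  [NeZero n] {y₀ : F}

/-- The ideal `b'` of the cusp given by `γ⁻¹`, and the criterion for it to be unramified. -/
theorem Cusp.bPrime_unramified (hy₀ : (n : FractionalIdeal (𝓞 F)⁰ F) +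
      FractionalIdeal.spanSingleton (𝓞 F)⁰ y₀ * (c : FractionalIdeal (𝓞 F)⁰ F) = 1)
    {C : Cusp D c n} {γ : GL (Fin 2) F} (hC : C.IsGivenBy y₀ γ⁻¹) {x : LevelDatum c n}
    (hx : Cusp.mk D x = C) :
    x.bPrime.mod ≤ ((ofIdeal n)⁻¹ * C.b).mod ∧
      (x.bPrime : FractionalIdeal (𝓞 F)⁰ F) = prin (γ.1 0 0) +
        prin (γ.1 1 0) * ((c * ofIdeal n).star : FractionalIdeal (𝓞 F)⁰ F) ∧
      (x.Unramified ↔ γ.1 1 0 ∈ (ofIdeal n * C.b * c * diff F).mod) ∧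
      (x.Unramified ↔ x.bPrime = C.b) := by
  have hb := Cusp.b_eq hC
  obtain ⟨x₀, h₀, h⟩ := hC
  have hb' : (x.bPrime : FractionalIdeal (𝓞 F)⁰ F) = prin (γ.1 0 0) +
      prin (γ.1 1 0) * ((c * ofIdeal n).star : FractionalIdeal (𝓞 F)⁰ F) := by
    rw [LevelDatum.bPrime_eq_of_equiv (Cusp.mk_eq_iff.1 (hx.trans h.symm))]
    exact h₀.bPrime_eq hy₀
  subst hx
  exact ⟨x.bPrime_le, hb', x.unramified_iff.trans (bPrime_eq_iff hb hb'), x.unramified_iff⟩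

/-- The standard representative of a cusp on `b ⊕ (bc)^*`, and its automorphism group. -/
theorem Cusp.exists_standard_rep (hy₀ : (n : FractionalIdeal (𝓞 F)⁰ F) +
      FractionalIdeal.spanSingleton (𝓞 F)⁰ y₀ * (c : FractionalIdeal (𝓞 F)⁰ F) = 1)
    {C : Cusp D c n} {γ : GL (Fin 2) F} (hγ : γ ∈ GDint D) (hC : C.IsGivenBy y₀ γ⁻¹)
    (hn : IsNormalized c C.b γ) :
    ∃ x : LevelDatum c n, Cusp.mk D x = C ∧
      x.a = C.b * c ∧ x.L = prodLat C.b (C.b * c).star ∧ x.toCuspDatum.IsStandard ∧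
      (∀ t : divBy n (diff F)⁻¹.mod, ∃ v : divBy n x.L,
        v.1 = ![y₀ * γ.1 1 0 * t.1, y₀ * γ.1 1 1 * t.1] ∧ x.β (Tors.mk t) = Tors.mk v) ∧
      x.automorphisms D =
        (((conjGam D c n γ ⊓ borelQ D).map rowAct :
          Subgroup ((Fin 2 → F) ≃ₗ[F] (Fin 2 → F))) : Set ((Fin 2 → F) ≃ₗ[F] (Fin 2 → F))) ∧
      (∃ (ι : Multiplicative (c * C.b * x.bPrime).star.mod →*
            (conjGam D c n γ ⊓ borelQ D : Subgroup (GL (Fin 2) F)))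
          (π : (conjGam D c n γ ⊓ borelQ D : Subgroup (GL (Fin 2) F)) →*
            unitsC D n C.b x.bPrime),
        (∀ ξ : (c * C.b * x.bPrime).star.mod,
          (ι (Multiplicative.ofAdd ξ) : GL (Fin 2) F) = unip (ξ : F)) ∧
        (∀ h : (conjGam D c n γ ⊓ borelQ D : Subgroup (GL (Fin 2) F)), (h : GL (Fin 2) F).1 0 0 =
            (((π h).1.1 : 𝓞 F) : F) * (((π h).1.2.1 : 𝓞 F) : F) ∧
          (h : GL (Fin 2) F).1 1 1 = ((((π h).1.1)⁻¹ : (𝓞 F)ˣ) : 𝓞 F)) ∧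
        Function.Injective ι ∧ π.ker = ι.range ∧ Function.Surjective π) := by
  obtain ⟨x, hx, rfl⟩ := hC
  have hL : x.L = prodLat x.b (x.b * c).star :=
    IsTransform.L_eq hγ hn (one_mem _) (by rwa [one_mul])
  obtain ⟨t, ht⟩ := exists_generator n (diff F)⁻¹
  obtain ⟨v, hv, hβ⟩ := hx.2.2 t
  have hprim := (isPrimitive_iff hL v).1 (hβ ▸ x.isPrimitive_β ht)
  have hb' := x.bPrime_eq ht hβ
  rw [hx.1.2.1] at hb'
  rw [rowAct_inv_apply] at hv
  refine ⟨x, rfl, x.a_eq, hL, hx.1, fun t => ?_, automorphisms_eq hy₀ hγ hn hx hL,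
    exists_exact_sequence hy₀ hγ hn ((span_mk_eq_top_iff t).1 ht) hv hprim hb'⟩
  obtain ⟨v, hv, hβ⟩ := hx.2.2 t
  refine ⟨v, hv.trans ?_, hβ⟩
  rw [rowAct_inv_apply]
  apply vec_ext
  · rw [vecMul_zero_coord]
    simp only [Matrix.cons_val_zero, Matrix.cons_val_one]
    ring
  · rw [vecMul_one_coord]
    simp only [Matrix.cons_val_zero, Matrix.cons_val_one]
    ring

theorem Cusp.exists_hasVector {b : FracId F} {τ : Tors n (diff F)⁻¹.mod}
    (hτ : Submodule.span (𝓞 F) {τ} = ⊤) (C : Cusp D c n) (hC : C.b = b) :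
    ∃ (x : LevelDatum c n) (w : Prim c b n), Cusp.mk D x = C ∧ x.HasVector b τ w := by
  obtain ⟨x, rfl⟩ := C.exists_mk
  obtain ⟨y, w, h, hw⟩ := exists_equiv_hasVector (D := D) hτ x hC
  exact ⟨y, w, (Cusp.mk_eq_iff.2 h).symm, hw⟩

theorem Component.exists_hasVector {b : FracId F} {τ : Tors n (diff F)⁻¹.mod}
    (hτ : Submodule.span (𝓞 F) {τ} = ⊤) (K : Component D c n) (hK : K.b = b) :
    ∃ (x : LevelDatum c n) (w : Prim c b n), Component.mk D x = K ∧ x.HasVector b τ w := by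
  obtain ⟨x, rfl⟩ := Quot.exists_rep K
  obtain ⟨y, w, h, hw⟩ := exists_equiv_hasVector (D := D) hτ x hK
  exact ⟨y, w, (Quot.sound (LevelDatum.sameComponent_of_equiv h)).symm, hw⟩

end Conclusion

end HilbertCusp

end

theorem mainTheorem6 {F : Type*} [Field F] [NumberField F] [NumberField.IsTotallyReal F]
    (D : Subgroup Fˣ) (hD : ∀ q : ℚˣ, Units.map (algebraMap ℚ F : ℚ →* F) q ∈ D)
    (c : FracId F) (n : Ideal (𝓞 F)) [NeZero n] (y₀ : F)
    (hy₀ : (n : FractionalIdeal (𝓞 F)⁰ F) +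
      FractionalIdeal.spanSingleton (𝓞 F)⁰ y₀ * (c : FractionalIdeal (𝓞 F)⁰ F) = 1) :
    -- the correspondence between `(R, n)`-cusps and double cosets
    ((∀ g ∈ GDint D, ∃! C : Cusp D c n, C.IsGivenBy y₀ g) ∧
      (∀ C : Cusp D c n, ∃ γ ∈ GDint D, C.IsGivenBy y₀ γ⁻¹) ∧
      (∀ g ∈ GDint D, ∀ g' ∈ GDint D, ∀ C : Cusp D c n, C.IsGivenBy y₀ g →
        (C.IsGivenBy y₀ g' ↔ ∃ t ∈ TZUQ D, ∃ δ ∈ Gam D c n, g' = t * g * δ))) ∧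
    -- the classes of `b` and `b'` depend only on the isomorphism class
    (∀ x x' : LevelDatum c n, x.CuspIso D x' →
      ClassGroup.mk F x.b = ClassGroup.mk F x'.b ∧
      ClassGroup.mk F x.bPrime = ClassGroup.mk F x'.bPrime) ∧
    (∀ γ ∈ GDint D, ∀ C : Cusp D c n, C.IsGivenBy y₀ γ⁻¹ →
      -- (i)
      (C.b : FractionalIdeal (𝓞 F)⁰ F) =
        FractionalIdeal.spanSingleton (𝓞 F)⁰ (γ.1 0 0) +
          FractionalIdeal.spanSingleton (𝓞 F)⁰ (γ.1 1 0) *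
            (c.star : FractionalIdeal (𝓞 F)⁰ F) ∧
      (∃ ξ : F, IsNormalized c C.b (γ * unip ξ) ∧ C.IsGivenBy y₀ (γ * unip ξ)⁻¹) ∧
      -- (iii)
      (∀ x : LevelDatum c n, Cusp.mk D x = C →
        x.bPrime.mod ≤ ((ofIdeal n)⁻¹ * C.b).mod ∧
        (x.bPrime : FractionalIdeal (𝓞 F)⁰ F) =
          FractionalIdeal.spanSingleton (𝓞 F)⁰ (γ.1 0 0) +
            FractionalIdeal.spanSingleton (𝓞 F)⁰ (γ.1 1 0) *
              ((c * ofIdeal n).star : FractionalIdeal (𝓞 F)⁰ F) ∧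
        (x.Unramified ↔ γ.1 1 0 ∈ (ofIdeal n * C.b * c * diff F).mod) ∧
        (x.Unramified ↔ x.bPrime = C.b)) ∧
      -- (ii) and (iv)
      (IsNormalized c C.b γ → ∃ x : LevelDatum c n, Cusp.mk D x = C ∧
        x.a = C.b * c ∧ x.L = prodLat C.b (C.b * c).star ∧ x.toCuspDatum.IsStandard ∧
        (∀ t : divBy n (diff F)⁻¹.mod, ∃ v : divBy n x.L,
          v.1 = ![y₀ * γ.1 1 0 * t.1, y₀ * γ.1 1 1 * t.1] ∧ x.β (Tors.mk t) = Tors.mk v) ∧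
        x.automorphisms D =
          (((conjGam D c n γ ⊓ borelQ D).map rowAct :
            Subgroup ((Fin 2 → F) ≃ₗ[F] (Fin 2 → F))) : Set ((Fin 2 → F) ≃ₗ[F] (Fin 2 → F))) ∧
        (∃ (ι : Multiplicative (c * C.b * x.bPrime).star.mod →*
              (conjGam D c n γ ⊓ borelQ D : Subgroup (GL (Fin 2) F)))
            (π : (conjGam D c n γ ⊓ borelQ D : Subgroup (GL (Fin 2) F)) →*
              unitsC D n C.b x.bPrime),
          (∀ ξ : (c * C.b * x.bPrime).star.mod,
            (ι (Multiplicative.ofAdd ξ) : GL (Fin 2) F) = unip (ξ : F)) ∧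
          (∀ h : (conjGam D c n γ ⊓ borelQ D : Subgroup (GL (Fin 2) F)), (h : GL (Fin 2) F).1 0 0 =
              (((π h).1.1 : 𝓞 F) : F) * (((π h).1.2.1 : 𝓞 F) : F) ∧
            (h : GL (Fin 2) F).1 1 1 = ((((π h).1.1)⁻¹ : (𝓞 F)ˣ) : 𝓞 F)) ∧
          Function.Injective ι ∧ π.ker = ι.range ∧ Function.Surjective π) ∧
        (∀ p : (𝓞 F)ˣ × unitsDPlus D,
          (p ∈ unitsC D n C.b x.bPrime ∧
            Matrix.GeneralLinearGroup.det (triMat p.1 p.2.1 0) = 1) ↔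
          (p.2 = 1 ∧ ((p.1 : 𝓞 F) : F) - 1 ∈ (C.b * x.bPrime⁻¹).mod ∧
            ((p.1 : 𝓞 F) : F) - 1 ∈ (ofIdeal n * x.bPrime * C.b⁻¹).mod)))) ∧
    (∀ b : FracId F,
      {b' : FracId F | b.mod ≤ b'.mod ∧ b'.mod ≤ ((ofIdeal n)⁻¹ * b).mod}.Finite ∧
      (∃ τ : Tors n (diff F)⁻¹.mod, Submodule.span (𝓞 F) {τ} = ⊤) ∧
      (∃ γ ∈ GDint D, IsNormalized c b γ) ∧
      -- (v)
      (∀ γ ∈ GDint D, IsNormalized c b γ →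
        ∃ e : DoubleCoset.Quotient (fibreLeft D c b : Set (Gplus D (prodLat b (b * c).star)))
            (fibreRight D c b n γ : Set (Gplus D (prodLat b (b * c).star))) ≃
            {C : Cusp D c n // C.b = b},
          ∀ g : Gplus D (prodLat b (b * c).star),
            (e (DoubleCoset.mk (fibreLeft D c b) (fibreRight D c b n γ) g)).1.IsGivenBy y₀ ((g : GL (Fin 2) F) * γ⁻¹)) ∧
      (∀ τ : Tors n (diff F)⁻¹.mod, Submodule.span (𝓞 F) {τ} = ⊤ →
        (∀ C : Cusp D c n, C.b = b →
          ∃ (x : LevelDatum c n) (w : Prim c b n), Cusp.mk D x = C ∧ x.HasVector b τ w) ∧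
        ∃ e : {C : Cusp D c n // C.b = b} ≃ Quot (primRel D c b n),
          ∀ (C : {C : Cusp D c n // C.b = b}) (x : LevelDatum c n) (w : Prim c b n),
            Cusp.mk D x = C.1 → x.HasVector b τ w → e C = Quot.mk _ w) ∧
      Finite {C : Cusp D c n // C.b = b} ∧
      (Nat.card {C : Cusp D c n // C.b = b} : ℚ) =
        ∑ᶠ (b' : FracId F) (_ : b.mod ≤ b'.mod ∧ b'.mod ≤ ((ofIdeal n)⁻¹ * b).mod),
          (Nat.card (𝓞 F ⧸ (b * b'⁻¹).toIdeal)ˣ : ℚ) *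
            (Nat.card (𝓞 F ⧸ (ofIdeal n * b' * b⁻¹).toIdeal)ˣ : ℚ) /
            ((unitsC D n b b').index : ℚ) ∧
      -- (vi)
      (∀ τ : Tors n (diff F)⁻¹.mod, Submodule.span (𝓞 F) {τ} = ⊤ →
        (∀ K : Component D c n, K.b = b →
          ∃ (x : LevelDatum c n) (w : Prim c b n), Component.mk D x = K ∧ x.HasVector b τ w) ∧
        ∃ e : {K : Component D c n // K.b = b} ≃ Quot (primRelBar D c b n),
          ∀ (K : {K : Component D c n // K.b = b}) (x : LevelDatum c n) (w : Prim c b n),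
            Component.mk D x = K.1 → x.HasVector b τ w → e K = Quot.mk _ w) ∧
      Finite {K : Component D c n // K.b = b} ∧
      (Nat.card {K : Component D c n // K.b = b} : ℚ) =
        ∑ᶠ (b' : FracId F) (_ : b.mod ≤ b'.mod ∧ b'.mod ≤ ((ofIdeal n)⁻¹ * b).mod),
          (Nat.card (𝓞 F ⧸ (b * b'⁻¹).toIdeal)ˣ : ℚ) *
            (Nat.card (𝓞 F ⧸ (ofIdeal n * b' * b⁻¹).toIdeal)ˣ : ℚ) /
            ((Nat.card (ZMod (quotExponent b.mod b'.mod))ˣ : ℚ) *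
              ((unitsCbar D n b b').index : ℚ)) ∧
      (∀ (b' : FracId F), b.mod ≤ b'.mod → b'.mod ≤ ((ofIdeal n)⁻¹ * b).mod →
        ∀ p : (𝓞 F)ˣ × unitsDPlus D,
          (p ∈ unitsCbar D n b b' ∧
            Matrix.GeneralLinearGroup.det (triMat p.1 p.2.1 0) = 1) ↔
          (p.2 = 1 ∧ ((p.1 : 𝓞 F) : F) - 1 ∈ (ofIdeal n * b' * b⁻¹).mod ∧
            ∃ k : ℤ, IsCoprime k (quotExponent b.mod b'.mod : ℤ) ∧
              ((p.1 : 𝓞 F) : F) - (k : F) ∈ (b * b'⁻¹).mod))) := by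
  refine ⟨⟨fun g hg => Cusp.existsUnique_isGivenBy hy₀ hg, fun C => ?_,
      fun g hg g' hg' C hC => Cusp.isGivenBy_iff hy₀ hg hg' hC⟩,
    fun x x' h => LevelDatum.classes_of_iso h,
    fun γ hγ C hC => ⟨Cusp.b_eq hC, ?_, fun x hx => Cusp.bPrime_unramified hy₀ hC hx, fun hn => ?_⟩,
    fun b => ?_⟩
  · obtain ⟨γ, hγ, -, hC⟩ := Cusp.exists_normalized_isGivenBy hy₀ C
    exact ⟨γ, hγ, hC⟩
  · obtain ⟨ξ, hξ⟩ := exists_unip_normalized hγ (Cusp.b_eq hC)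
    exact ⟨ξ, hξ, Cusp.isGivenBy_mul_unip hy₀ hγ hC ξ⟩
  · obtain ⟨x, h1, h2, h3, h4, h5, h6, h7⟩ := Cusp.exists_standard_rep hy₀ hγ hC hn
    exact ⟨x, h1, h2, h3, h4, h5, h6, h7, unitsC_inter_det_one _ _⟩
  -- The orbit sets do not involve `τ`, so a single generator transfers their finiteness and
  -- cardinality to cusps and components.
  · obtain ⟨t, ht⟩ := exists_generator n (diff F)⁻¹
    obtain ⟨e, -⟩ := exists_cusp_vector_equiv hy₀ D b ht
    obtain ⟨e', -⟩ := exists_component_vector_equiv hy₀ D b ht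
    obtain ⟨hfin, hcard⟩ := card_quot_primRel D c b n
    obtain ⟨hfin', hcard'⟩ := card_quot_primRelBar D c b n
    exact ⟨finite_between n b, ⟨_, ht⟩, exists_normalized hy₀ D b,
      fun γ hγ hn => exists_fibre_equiv hy₀ hγ hn,
      fun τ hτ => ⟨Cusp.exists_hasVector hτ, exists_cusp_vector_equiv hy₀ D b hτ⟩,
      Finite.of_equiv _ e.symm, by rw [Nat.card_congr e, hcard],
      fun τ hτ => ⟨Component.exists_hasVector hτ, exists_component_vector_equiv hy₀ D b hτ⟩,
      Finite.of_equiv _ e'.symm, by rw [Nat.card_congr e', hcard'],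
      fun b' _ _ => unitsCbar_inter_det_one b b'⟩
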